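/- Let $M$ be a smooth manifold and let $\kappa\in\Omega^3(M)$ be a closed 3-form. Let $q_M:T[1]M\to M$ and $q:T^*[2]T[1]M\to T[1]M$ be the projections. For local coordinates $x^a$ on $M$, let $\xi^a=dx^a$ be the induced fibre coordinates (degree $1$) on $T[1]M$, and let $p_a$ (degree $2$), $\eta_a$ (degree $1$) be the momenta conjugate to $x^a,\xi^a$ on $T^*[2]T[1]M$. Let $\omega=dp_a\,dx^a+d\eta_a\,d\xi^a$ be the canonical symplectic form, with Poisson brackets $\{p_a,x^b\}=\delta_a^b=\{\eta_a,\xi^b\}$ (all other brackets of coordinates vanishing), and put $$Q=\xi^a\partial_{x^a}+p_a\partial_{\eta_a},\qquad Q_\kappa=Q+\{q^*\kappa,\cdot\},$$ where $\kappa=\frac1{3!}\kappa(\partial_a,\partial_b,\partial_c)\,\xi^a\xi^b\xi^c$ is regarded as a function of degree $3$ on $T[1]M$. A graded manifold with a symplectic form of degree $2$ and an invariant homological vector field is called an exact Courant algebroid over $M$ if it is isomorphic to $(T^*[2]T[1]M,Q_\kappa,\omega)$ for some closed $\kappa$; the standard one is $(T^*[2]T[1]M,Q,\omega)$. Let $\Phi:(T^*[2]T[1]M,Q)\to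 (T[1]T^*[1]M,Q_{dR})$ be the canonical $NQ$-isomorphism given by the Legendre transform $T^*[2]T[1]M\cong T^*[2]T^*[1]M$ followed by the map $T^*[2]T^*[1]M\cong T[1]T^*[1]M$ defined by the canonical symplectic structure of $T^*[1]M$; in coordinates, $\Phi(x,\xi,p,\eta)$ is the point over $(x,\eta)\in T^*[1]M$ with $dx^a=\xi^a$, $d\eta_a=p_a$. Let $s:T[1]T^*[1]M\to T^*[1]M$ be the projection. Then: 1. $Q_\kappa$ is a homological vector field on $T^*[2]T[1]M$ (a derivation of degree $1$ with $Q_\kappa^2=0$). 2. There is exactly one morphism of graded manifolds $\psi_\kappa:T^*[2]T[1]M\to T^*[2]T[1]M$ over $\mathrm{id}_M$ such that $\Phi\circ\psi_\kappa$ is an $NQ$-morphism $(T^*[2]T[1]M,Q_\kappa)\to(T[1]T^*[1]M,Q_{dR})$ with $s\circ\Phi\circ\psi_\kappa=s\circ\Phi$; that is, $\Phi\circ\psi_\kappa$ corresponds to $s\circ\Phi$ under the adjunction between the forgetful functor from $NQ$-manifolds to $N$-manifolds and $T[1]$. It is an $NQ$-morphism $\psi_\kappa:(T^*[2]T[1]M,Q_\kappa)\to(T^*[2]T[1]M,Q)$,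 and it is the translation along the fibres of $q$ by the 1-form $$\tfrac12\,\iota_{Q_{dR}}\iota_{Q_{dR}}\,q_M^*\kappa$$ of degree $2$ on $T[1]M$, where $Q_{dR}$ is the de Rham vector field on $T[1]M$. (Translation by a 1-form $A_a\,dx^a+B_a\,d\xi^a$ on $T[1]M$ is the map over $T[1]M$ given by $p_a\mapsto p_a+q^*A_a$, $\eta_a\mapsto\eta_a+q^*B_a$.) Moreover $\psi_\kappa$ is a diffeomorphism of graded manifolds, whose inverse is an $NQ$-morphism $(T^*[2]T[1]M,Q)\to(T^*[2]T[1]M,Q_\kappa)$. 3. Every exact Courant algebroid over $M$ is isomorphic, as a dg manifold, to the standard Courant algebroid $(T^*[2]T[1]M,Q)$ over $M$. -/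

import Mathlib

set_option linter.unusedSectionVars false

open Set TopologicalSpace
open scoped Manifold ContDiff TensorProduct

noncomputable section

namespace GradedGeometry

/-! ## Smooth functions on open subsets of `ℝⁿ` -/

abbrev Eu (n : ℕ) := EuclideanSpace ℝ (Fin n)

/-- The algebra `C^∞(W)` of an open subset `W` of `ℝⁿ`. -/
abbrev Sm {n : ℕ} (W : Opens (Eu n)) := ContMDiffMap (𝓡 n) 𝓘(ℝ, ℝ) W ℝ ∞

/-- Smooth maps between open subsets of `ℝⁿ`. -/
abbrev SmMap {n : ℕ} (W W' : Opens (Eu n)) := ContMDiffMap (𝓡 n) (𝓡 n) W W' ∞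

namespace Sm

variable {n : ℕ} {W W' W'' : Opens (Eu n)}

/-- Extension by zero to `ℝⁿ`. -/
def ext0 (f : W → ℝ) : Eu n → ℝ := Function.extend Subtype.val f 0

theorem ext0_coe (f : W → ℝ) (x : W) : ext0 f x = f x :=
  Subtype.val_injective.extend_apply _ _ _

theorem contDiffAt_ext0 (f : Sm W) (x : W) : ContDiffAt ℝ ∞ (ext0 f) x := by
  rw [← contMDiffAt_iff_contDiffAt, ← contMDiffAt_subtype_iff]
  have : (fun y : W => ext0 f y) = f := by
    funext y; exact ext0_coe _ _
  rw [this]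
  exact f.contMDiff x

theorem contDiffOn_ext0 (f : Sm W) : ContDiffOn ℝ ∞ (ext0 f) W := fun x hx =>
  (contDiffAt_ext0 f ⟨x, hx⟩).contDiffWithinAt

/-- A function which is smooth on `W`, as an element of `C^∞(W)`. -/
def mk (g : Eu n → ℝ) (hg : ContDiffOn ℝ ∞ g W) : Sm W :=
  ⟨fun x => g x, fun x => by
    have h := hg.contDiffAt (W.isOpen.mem_nhds x.2)
    exact contMDiffAt_subtype_iff.2 (contMDiffAt_iff_contDiffAt.2 h)⟩

/-- The coordinate functions `x^a`. -/
def crd (a : Fin n) : Sm W :=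
  mk (fun x => x a) (by fun_prop)

/-- The partial derivatives `∂/∂x^a`. -/
def pdFun (a : Fin n) (f : Sm W) : Sm W :=
  mk (fun x => fderiv ℝ (ext0 f) x (EuclideanSpace.single a 1)) (by
    have h : ContDiffOn ℝ ∞ (fderiv ℝ (ext0 f)) W :=
      (contDiffOn_ext0 f).fderiv_of_isOpen W.isOpen (by simp)
    exact h.clm_apply contDiffOn_const)

theorem pdFun_apply (a : Fin n) (f : Sm W) (x : W) :
    pdFun a f x = fderiv ℝ (ext0 f) x (EuclideanSpace.single a 1) := rfl

theorem ext0_eventuallyEq (f : W → ℝ) (g : Eu n → ℝ) (h : ∀ x : W, f x = g x) (x : W) :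
    ext0 f =ᶠ[nhds (x : Eu n)] g := by
  filter_upwards [W.isOpen.mem_nhds x.2] with y hy
  rw [← h ⟨y, hy⟩]; exact ext0_coe f ⟨y, hy⟩

theorem pdFun_apply_of (a : Fin n) (f : Sm W) (g : Eu n → ℝ) (h : ∀ x : W, f x = g x) (x : W) :
    pdFun a f x = fderiv ℝ g x (EuclideanSpace.single a 1) := by
  rw [pdFun_apply, (ext0_eventuallyEq f g h x).fderiv_eq]

theorem differentiableAt_ext0 (f : Sm W) (x : W) : DifferentiableAt ℝ (ext0 f) x :=
  (contDiffAt_ext0 f x).differentiableAt (by simp)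

def pd (a : Fin n) : Derivation ℝ (Sm W) (Sm W) where
  toFun := pdFun a
  map_add' f g := by
    ext x
    rw [pdFun_apply_of a (f + g) (ext0 f + ext0 g)
      (fun y => by simp [ext0_coe]), fderiv_add (differentiableAt_ext0 f x)
      (differentiableAt_ext0 g x)]
    rfl
  map_smul' c f := by
    ext x
    rw [pdFun_apply_of a (c • f) (c • ext0 f)
      (fun y => by simp [ext0_coe]), fderiv_const_smul (differentiableAt_ext0 f x)]
    rfl
  map_one_eq_zero' := by
    ext x
    show pdFun a 1 x = 0
    rw [pdFun_apply_of a 1 (fun _ => 1) (fun y => rfl)]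
    simp
  leibniz' f g := by
    ext x
    show pdFun a (f * g) x = f x * pdFun a g x + g x * pdFun a f x
    rw [pdFun_apply_of a (f * g) (ext0 f * ext0 g)
      (fun y => by simp [ext0_coe]), fderiv_mul (differentiableAt_ext0 f x)
      (differentiableAt_ext0 g x), pdFun_apply, pdFun_apply, ext0_coe, ext0_coe]
    rfl

theorem pd_apply (a : Fin n) (f : Sm W) (x : W) :
    pd a f x = fderiv ℝ (ext0 f) x (EuclideanSpace.single a 1) := rfl

theorem pd_apply_of (a : Fin n) (f : Sm W) (g : Eu n → ℝ) (h : ∀ x : W, f x = g x) (x : W) :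
    pd a f x = fderiv ℝ g x (EuclideanSpace.single a 1) := pdFun_apply_of a f g h x

theorem pd_crd (a b : Fin n) : pd a (crd b : Sm W) = if a = b then 1 else 0 := by
  ext x
  rw [pd_apply_of a (crd b) (fun x => (EuclideanSpace.proj b : Eu n →L[ℝ] ℝ) x) (fun _ => rfl),
    ContinuousLinearMap.fderiv]
  by_cases h : a = b
  · subst h; simp
  · simp [h, Ne.symm h]

theorem pd_comm (a b : Fin n) (f : Sm W) : pd a (pd b f) = pd b (pd a f) := by
  ext x
  have key : ∀ c d : Fin n, pd c (pd d f) x =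
      fderiv ℝ (fderiv ℝ (ext0 f)) x (EuclideanSpace.single c 1) (EuclideanSpace.single d 1) := by
    intro c d
    rw [pd_apply_of c (pd d f) (fun y => fderiv ℝ (ext0 f) y (EuclideanSpace.single d 1))
      (fun y => rfl)]
    have hd : DifferentiableAt ℝ (fderiv ℝ (ext0 f)) x :=
      ((contDiffAt_ext0 f x).fderiv_right (m := 1)
        (show ((2 : ℕ∞) : WithTop ℕ∞) ≤ ((⊤ : ℕ∞) : WithTop ℕ∞) from WithTop.coe_le_coe.2 le_top)).differentiableAt
        (by simp)
    rw [fderiv_clm_apply hd (differentiableAt_const _)]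
    simp
  rw [key, key]
  exact ((contDiffAt_ext0 f x).isSymmSndFDerivAt
    (by
      simp only [minSmoothness_of_isRCLikeNormedField]
      exact (show ((2 : ℕ∞) : WithTop ℕ∞) ≤ ((⊤ : ℕ∞) : WithTop ℕ∞) from WithTop.coe_le_coe.2 le_top))).eq _ _

/-- Pull-back of functions along a smooth map. -/
def pull (φ : SmMap W W') : Sm W' →ₐ[ℝ] Sm W where
  toFun f := f.comp φ
  map_one' := rfl
  map_mul' _ _ := rfl
  map_zero' := rfl
  map_add' _ _ := rfl
  commutes' _ := rfl

theorem pull_apply (φ : SmMap W W') (f : Sm W') (x : W) : pull φ f x = f (φ x) := rfl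

/-- The chain rule. -/
theorem pd_pull (φ : SmMap W W') (a : Fin n) (f : Sm W') :
    pd a (pull φ f) = ∑ i, pd a (pull φ (crd i)) * pull φ (pd i f) := by
  ext x
  let g : Eu n → Eu n := fun y => WithLp.toLp 2 (fun i => ext0 (pull φ (crd i)) y)
  have hgφ : ∀ y : W, g y = φ y := by
    intro y
    ext i
    show ext0 (pull φ (crd i)) y = _
    rw [ext0_coe]; rfl
  have hg : DifferentiableAt ℝ g x := by
    rw [differentiableAt_euclidean]
    intro i
    exact differentiableAt_ext0 (pull φ (crd i)) x
  have hf : DifferentiableAt ℝ (ext0 f) (g x) := by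
    rw [hgφ]; exact differentiableAt_ext0 f (φ x)
  rw [pd_apply_of a (pull φ f) (ext0 f ∘ g) (fun y => by
    simp only [Function.comp, hgφ, ext0_coe]; rfl)]
  rw [fderiv_comp _ hf hg, ContinuousLinearMap.comp_apply]
  have hv : fderiv ℝ g x (EuclideanSpace.single a 1) =
      ∑ i, (pd a (pull φ (crd i)) x) • (EuclideanSpace.single i (1 : ℝ) : Eu n) := by
    ext j
    have h1 : (fderiv ℝ g x (EuclideanSpace.single a 1)) j =
        fderiv ℝ (fun y => g y j) x (EuclideanSpace.single a 1) := by
      have h2 := (EuclideanSpace.proj j : Eu n →L[ℝ] ℝ).hasFDerivAt.comp (x : Eu n) hg.hasFDerivAt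
      have h3 : fderiv ℝ (fun y => g y j) x = _ := h2.fderiv
      rw [h3]; rfl
    rw [h1]
    simp [Pi.single_apply, Finset.sum_ite_eq]
    rfl
  rw [hv, map_sum]
  simp only [map_smul, smul_eq_mul, hgφ]
  have : ∀ s : Finset (Fin n), ∀ F : Fin n → Sm W, (∑ i ∈ s, F i) x = ∑ i ∈ s, F i x := by
    intro s F
    exact map_sum (ContMDiffMap.evalRingHom (I := 𝓡 n) (n := ∞) x : Sm W →+* ℝ) F s
  rw [this]
  rfl

end Sm

/-! ## Free graded-commutative algebras -/

/-- The relations `z_i z_j = (-1)^{|z_i||z_j|} z_j z_i`. -/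
inductive GAlg.Rel {ι : Type} (deg : ι → ℕ) : FreeAlgebra ℝ ι → FreeAlgebra ℝ ι → Prop
  | comm (i j : ι) : GAlg.Rel deg (FreeAlgebra.ι ℝ i * FreeAlgebra.ι ℝ j)
      ((-1 : ℝ) ^ (deg i * deg j) • (FreeAlgebra.ι ℝ j * FreeAlgebra.ι ℝ i))

/-- The free graded-commutative real algebra on generators `z_i` of degree `deg i`, that is
`Λ(generators of odd degree) ⊗ Sym(generators of even degree)`. -/
def GAlg {ι : Type} (deg : ι → ℕ) : Type := RingQuot (GAlg.Rel deg)

namespace GAlg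

variable {ι : Type} {deg : ι → ℕ}

instance : Ring (GAlg deg) := inferInstanceAs (Ring (RingQuot (GAlg.Rel deg)))
instance : Algebra ℝ (GAlg deg) := inferInstanceAs (Algebra ℝ (RingQuot (GAlg.Rel deg)))

def gen (i : ι) : GAlg deg := RingQuot.mkAlgHom ℝ (GAlg.Rel deg) (FreeAlgebra.ι ℝ i)

theorem gen_mul_gen (i j : ι) :
    (gen i * gen j : GAlg deg) = (-1 : ℝ) ^ (deg i * deg j) • (gen j * gen i) := by
  have h := RingQuot.mkAlgHom_rel ℝ (GAlg.Rel.comm (deg := deg) i j)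
  rw [map_mul, map_smul, map_mul] at h
  exact h

theorem induction {C : GAlg deg → Prop} (h0 : ∀ r : ℝ, C (algebraMap ℝ _ r))
    (h1 : ∀ i, C (gen i)) (hm : ∀ a b, C a → C b → C (a * b))
    (ha : ∀ a b, C a → C b → C (a + b)) (u : GAlg deg) : C u := by
  obtain ⟨v, rfl⟩ := RingQuot.mkAlgHom_surjective ℝ (GAlg.Rel deg) u
  induction v using FreeAlgebra.induction with
  | grade0 r => rw [AlgHom.commutes]; exact h0 r
  | grade1 i => exact h1 i
  | mul a b h h' => rw [map_mul]; exact hm _ _ h h'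
  | add a b h h' => rw [map_add]; exact ha _ _ h h'

/-- The universal property. -/
def lift {B : Type*} [Ring B] [Algebra ℝ B] (g : ι → B)
    (hg : ∀ i j, g i * g j = (-1 : ℝ) ^ (deg i * deg j) • (g j * g i)) : GAlg deg →ₐ[ℝ] B :=
  RingQuot.liftAlgHom ℝ ⟨FreeAlgebra.lift ℝ g, by
    rintro _ _ ⟨i, j⟩
    simpa using hg i j⟩

theorem lift_gen {B : Type*} [Ring B] [Algebra ℝ B] (g : ι → B)
    (hg : ∀ i j, g i * g j = (-1 : ℝ) ^ (deg i * deg j) • (g j * g i)) (i : ι) :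
    lift g hg (gen i : GAlg deg) = g i := by
  unfold lift gen
  erw [RingQuot.liftAlgHom_mkAlgHom_apply]
  simp

/-- The action of the multiplicative monoid `ℝ`: `s` acts on `z_i` as `s ^ deg i`. -/
def act (s : ℝ) : GAlg deg →ₐ[ℝ] GAlg deg :=
  lift (fun i => s ^ deg i • gen i) (fun i j => by
    rw [smul_mul_smul_comm, smul_mul_smul_comm, gen_mul_gen i j, smul_comm, mul_comm (s ^ _)])

theorem act_gen (s : ℝ) (i : ι) : act s (gen i : GAlg deg) = s ^ deg i • gen i := lift_gen _ _ _

theorem triMul {A : Type*} [Ring A] [Algebra ℝ A] (a b : ℝ) (x y δ ε : A) :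
    !![a • x, δ; 0, x] * !![b • y, ε; 0, y] =
      !![(a * b) • (x * y), a • (x * ε) + δ * y; 0, x * y] := by
  simp [smul_smul]
  try rw [mul_comm b a]

open Classical in
/-- The algebra map `f ↦ !![± f, ∂f/∂z_i; 0, f]`. -/
def pdMat (i : ι) : GAlg deg →ₐ[ℝ] Matrix (Fin 2) (Fin 2) (GAlg deg) :=
  lift (fun j => !![(-1 : ℝ) ^ (deg i * deg j) • gen j, if j = i then 1 else 0; 0, gen j])
    (fun j k => by
      rw [triMul, triMul, gen_mul_gen j k, Matrix.smul_of, Matrix.smul_cons, Matrix.smul_cons,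
        Matrix.smul_cons, Matrix.smul_cons, Matrix.smul_cons, Matrix.smul_empty]
      have hs : ∀ m : ℕ, (-1 : ℝ) ^ m * (-1 : ℝ) ^ m = 1 := fun m => by
        rw [← pow_add, Even.neg_one_pow ⟨_, rfl⟩]
      congr 3
      · rw [smul_smul, smul_smul]; congr 1; ring
      · congr 1
        by_cases hj : j = i <;> by_cases hk : k = i
        · subst hj; subst hk; simp [smul_smul, hs, smul_add]; abel
        · subst hj; simp [hk, smul_smul, hs]
        · subst hk; simp [hj, mul_comm]
        · simp [hj, hk]
      all_goals simp)

/-- The partial derivative `∂/∂z_i` (acting from the left). -/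
def pd (i : ι) : GAlg deg →ₗ[ℝ] GAlg deg :=
  (Matrix.entryLinearMap ℝ (GAlg deg) (0 : Fin 2) (1 : Fin 2)).comp (pdMat i).toLinearMap

theorem pd_apply (i : ι) (f : GAlg deg) : pd i f = pdMat i f 0 1 := rfl

open Classical in
theorem pd_gen (i j : ι) : pd i (gen j : GAlg deg) = if j = i then 1 else 0 := by
  rw [pd_apply, pdMat, lift_gen]; rfl

theorem pdMat_eq (i : ι) (f : GAlg deg) :
    pdMat i f = !![act ((-1) ^ deg i) f, pd i f; 0, f] := by
  have : pdMat i f 0 0 = act ((-1) ^ deg i) f ∧ pdMat i f 1 0 = 0 ∧ pdMat i f 1 1 = f := by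
    induction f using induction with
    | h0 r =>
      simp only [AlgHom.commutes]
      refine ⟨?_, ?_, ?_⟩ <;> simp [Matrix.algebraMap_matrix_apply]
    | h1 j =>
      rw [act_gen, pdMat, lift_gen]
      simp [pow_mul]
    | hm a b ha hb =>
      simp only [map_mul, Matrix.mul_apply, Fin.sum_univ_two]
      simp [ha, hb]
    | ha a b ha hb =>
      simp only [map_add, Matrix.add_apply]
      simp [ha, hb]
  ext p q
  fin_cases p <;> fin_cases q
  · exact this.1
  · rfl
  · exact this.2.1
  · exact this.2.2

theorem pd_algebraMap (i : ι) (r : ℝ) : pd i (algebraMap ℝ (GAlg deg) r) = 0 := by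
  rw [pd_apply, AlgHom.commutes]; simp [Matrix.algebraMap_matrix_apply]

theorem pd_mul (i : ι) (f g : GAlg deg) :
    pd i (f * g) = pd i f * g + act ((-1) ^ deg i) f * pd i g := by
  rw [pd_apply, map_mul, pdMat_eq i f, pdMat_eq i g, Matrix.mul_fin_two]
  simp [add_comm]

end GAlg

/-! ## Graded domains -/

/-- The tensor product underlying `Fn` below. -/
abbrev FnT {n : ℕ} {ι : Type} (W : Opens (Eu n)) (deg : ι → ℕ) : Type := Sm W ⊗[ℝ] GAlg deg

namespace FnT

variable {n : ℕ} {ι ι' : Type} {W W' W'' : Opens (Eu n)} {deg : ι → ℕ} {deg' : ι' → ℕ}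

def sc : Sm W →ₐ[ℝ] FnT W deg := Algebra.TensorProduct.includeLeft

def gen (i : ι) : FnT W deg := 1 ⊗ₜ GAlg.gen i

theorem induction {C : FnT W deg → Prop} (h0 : ∀ r : Sm W, C (sc r))
    (h1 : ∀ i, C (gen i)) (hm : ∀ a b, C a → C b → C (a * b))
    (ha : ∀ a b, C a → C b → C (a + b)) (u : FnT W deg) : C u := by
  induction u using TensorProduct.induction_on with
  | zero => simpa using h0 0
  | add a b h h' => exact ha a b h h'
  | tmul r g =>
    have : (r ⊗ₜ g : FnT W deg) = sc r * (1 ⊗ₜ g) := by simp [sc]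
    rw [this]
    clear this
    refine hm _ _ (h0 r) ?_
    induction g using GAlg.induction with
    | h0 c =>
      have : (1 ⊗ₜ algebraMap ℝ _ c : FnT W deg) = sc (algebraMap ℝ _ c) := by
        rw [AlgHom.commutes, Algebra.algebraMap_eq_smul_one, Algebra.algebraMap_eq_smul_one,
          TensorProduct.tmul_smul, Algebra.TensorProduct.one_def]
      rw [this]; exact h0 _
    | h1 i => exact h1 i
    | hm a b ha hb =>
      have : (1 ⊗ₜ (a * b) : FnT W deg) = (1 ⊗ₜ a) * (1 ⊗ₜ b) := by simp
      rw [this]; exact hm _ _ ha hb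
    | ha a b ha' hb => rw [TensorProduct.tmul_add]; exact ha _ _ ha' hb

theorem algHom_ext {B : Type*} [Ring B] [Algebra ℝ B] {F G : FnT W deg →ₐ[ℝ] B}
    (h0 : ∀ r, F (sc r) = G (sc r)) (h1 : ∀ i, F (gen i) = G (gen i)) (u : FnT W deg) :
    F u = G u := by
  induction u using induction with
  | h0 r => exact h0 r
  | h1 i => exact h1 i
  | hm a b ha hb => rw [map_mul, map_mul, ha, hb]
  | ha a b ha hb => rw [map_add, map_add, ha, hb]

def lift {B : Type*} [Ring B] [Algebra ℝ B] (f : Sm W →ₐ[ℝ] B) (g : ι → B)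
    (hg : ∀ i j, g i * g j = (-1 : ℝ) ^ (deg i * deg j) • (g j * g i))
    (hfg : ∀ r i, f r * g i = g i * f r) : FnT W deg →ₐ[ℝ] B :=
  Algebra.TensorProduct.lift f (GAlg.lift g hg) (fun r u => by
    show f r * _ = _ * f r
    induction u using GAlg.induction with
    | h0 c => rw [AlgHom.commutes]; exact (Algebra.commutes _ _).symm
    | h1 i => rw [GAlg.lift_gen]; exact hfg r i
    | hm a b ha hb => rw [map_mul, ← mul_assoc, ha, mul_assoc, hb, mul_assoc]
    | ha a b ha hb => rw [map_add, mul_add, add_mul, ha, hb])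

section
variable {B : Type*} [Ring B] [Algebra ℝ B] (f : Sm W →ₐ[ℝ] B) (g : ι → B)
    (hg : ∀ i j, g i * g j = (-1 : ℝ) ^ (deg i * deg j) • (g j * g i))
    (hfg : ∀ r i, f r * g i = g i * f r)

theorem lift_sc (r : Sm W) : lift (deg := deg) f g hg hfg (sc r) = f r := by
  simp [lift, sc]

theorem lift_gen (i : ι) : lift (deg := deg) f g hg hfg (gen i) = g i := by
  simp [lift, gen, GAlg.lift_gen]

end

theorem sc_mul_gen (r : Sm W) (i : ι) : (sc r * gen i : FnT W deg) = gen i * sc r := by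
  simp [sc, gen]

theorem gen_mul_gen (i j : ι) :
    (gen i * gen j : FnT W deg) = (-1 : ℝ) ^ (deg i * deg j) • (gen j * gen i) := by
  simp only [gen, Algebra.TensorProduct.tmul_mul_tmul, mul_one, GAlg.gen_mul_gen i j,
    TensorProduct.tmul_smul]

def act (s : ℝ) : FnT W deg →ₐ[ℝ] FnT W deg :=
  lift sc (fun i => s ^ deg i • gen i)
    (fun i j => by
      rw [smul_mul_smul_comm, smul_mul_smul_comm, gen_mul_gen i j, smul_comm, mul_comm (s ^ _)])
    (fun r i => by rw [mul_smul_comm, smul_mul_assoc, sc_mul_gen])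

theorem act_sc (s : ℝ) (r : Sm W) : act s (sc r : FnT W deg) = sc r := lift_sc _ _ _ _ _
theorem act_gen (s : ℝ) (i : ι) : act s (gen i : FnT W deg) = s ^ deg i • gen i :=
  lift_gen _ _ _ _ _

def pdx (a : Fin n) : FnT W deg →ₗ[ℝ] FnT W deg :=
  LinearMap.rTensor (GAlg deg) (Sm.pd a).toLinearMap

def pdz (i : ι) : FnT W deg →ₗ[ℝ] FnT W deg := LinearMap.lTensor (Sm W) (GAlg.pd i)

theorem pdx_sc (a : Fin n) (r : Sm W) : pdx a (sc r : FnT W deg) = sc (Sm.pd a r) := by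
  simp [pdx, sc]

theorem pdx_gen (a : Fin n) (i : ι) : pdx a (gen i : FnT W deg) = 0 := by
  simp [pdx, gen]

theorem pdz_sc (i : ι) (r : Sm W) : pdz i (sc r : FnT W deg) = 0 := by
  have := GAlg.pd_algebraMap (deg := deg) i 1
  rw [map_one] at this
  simp [pdz, sc, this]

open Classical in
theorem pdz_gen (i j : ι) : pdz i (gen j : FnT W deg) = if j = i then 1 else 0 := by
  by_cases h : j = i
  · simp [pdz, gen, GAlg.pd_gen, h, Algebra.TensorProduct.one_def]
  · simp [pdz, gen, GAlg.pd_gen, h]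

theorem act_tmul (s : ℝ) (r : Sm W) (g : GAlg deg) :
    act s (r ⊗ₜ g : FnT W deg) = r ⊗ₜ GAlg.act s g := by
  have h : ∀ u : GAlg deg, act s (1 ⊗ₜ u : FnT W deg) = 1 ⊗ₜ GAlg.act s u := by
    intro u
    induction u using GAlg.induction with
    | h0 c =>
      rw [AlgHom.commutes, Algebra.algebraMap_eq_smul_one, TensorProduct.tmul_smul, map_smul,
        ← Algebra.TensorProduct.one_def, map_one]
    | h1 i =>
      have := act_gen (W := W) (deg := deg) s i
      rw [gen] at this
      rw [this, GAlg.act_gen, TensorProduct.tmul_smul]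
    | hm a b ha hb =>
      have e : ∀ a b : GAlg deg, (1 ⊗ₜ (a * b) : FnT W deg) = (1 ⊗ₜ a) * (1 ⊗ₜ b) := by simp
      rw [e, map_mul, map_mul, ha, hb, e]
    | ha a b ha hb => rw [TensorProduct.tmul_add, map_add, map_add, ha, hb, TensorProduct.tmul_add]
  have e : ∀ u : GAlg deg, (r ⊗ₜ u : FnT W deg) = sc r * (1 ⊗ₜ u) := by simp [sc]
  rw [e, map_mul, act_sc, h, ← e]

theorem pdx_mul (a : Fin n) (u v : FnT W deg) : pdx a (u * v) = pdx a u * v + u * pdx a v := by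
  induction u using TensorProduct.induction_on with
  | zero => simp
  | add u u' h h' => simp only [add_mul, map_add, h, h']; abel
  | tmul r g =>
    induction v using TensorProduct.induction_on with
    | zero => simp
    | add v v' h h' => simp only [mul_add, map_add, h, h']; abel
    | tmul r' g' =>
      simp only [pdx, Algebra.TensorProduct.tmul_mul_tmul, LinearMap.rTensor_tmul,
        Derivation.coeFn_coe, Derivation.leibniz, smul_eq_mul,
        TensorProduct.add_tmul]
      rw [add_comm, mul_comm r']

theorem pdz_mul (i : ι) (u v : FnT W deg) :
    pdz i (u * v) = pdz i u * v + act ((-1) ^ deg i) u * pdz i v := by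
  induction u using TensorProduct.induction_on with
  | zero => simp
  | add u u' h h' => simp only [add_mul, map_add, h, h']; abel
  | tmul r g =>
    induction v using TensorProduct.induction_on with
    | zero => simp
    | add v v' h h' => simp only [mul_add, map_add, h, h']; abel
    | tmul r' g' =>
      simp only [pdz, act_tmul, Algebra.TensorProduct.tmul_mul_tmul, LinearMap.lTensor_tmul,
        GAlg.pd_mul, TensorProduct.tmul_add]

end FnT

/-- Functions on the graded domain with body `W ⊆ ℝⁿ` and further coordinates `z_i` of degree
`deg i`: the algebra `C^∞(W) ⊗ Λ(odd z_i) ⊗ Sym(even z_i)`. -/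
def Fn {n : ℕ} {ι : Type} (W : Opens (Eu n)) (deg : ι → ℕ) : Type := Sm W ⊗[ℝ] GAlg deg

instance {n : ℕ} {ι : Type} (W : Opens (Eu n)) (deg : ι → ℕ) : Ring (Fn W deg) :=
  inferInstanceAs (Ring (Sm W ⊗[ℝ] GAlg deg))

instance {n : ℕ} {ι : Type} (W : Opens (Eu n)) (deg : ι → ℕ) : Algebra ℝ (Fn W deg) :=
  inferInstanceAs (Algebra ℝ (Sm W ⊗[ℝ] GAlg deg))

namespace Fn

variable {n : ℕ} {ι ι' : Type} {W W' W'' : Opens (Eu n)} {deg : ι → ℕ} {deg' : ι' → ℕ}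

/-- Smooth functions of the coordinates of degree zero. -/
def sc : Sm W →ₐ[ℝ] Fn W deg := Algebra.TensorProduct.includeLeft

/-- The coordinates `z_i`. -/
def gen (i : ι) : Fn W deg := (1 : Sm W) ⊗ₜ[ℝ] (GAlg.gen i : GAlg deg)

theorem induction {C : Fn W deg → Prop} (h0 : ∀ r : Sm W, C (sc r))
    (h1 : ∀ i, C (gen i)) (hm : ∀ a b, C a → C b → C (a * b))
    (ha : ∀ a b, C a → C b → C (a + b)) (u : Fn W deg) : C u :=
  FnT.induction h0 h1 hm ha u

theorem algHom_ext {B : Type*} [Ring B] [Algebra ℝ B] {F G : Fn W deg →ₐ[ℝ] B}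
    (h0 : ∀ r, F (sc r) = G (sc r)) (h1 : ∀ i, F (gen i) = G (gen i)) (u : Fn W deg) :
    F u = G u := by
  induction u using induction with
  | h0 r => exact h0 r
  | h1 i => exact h1 i
  | hm a b ha hb => rw [map_mul, map_mul, ha, hb]
  | ha a b ha hb => rw [map_add, map_add, ha, hb]

/-- The universal property. -/
def lift {B : Type*} [Ring B] [Algebra ℝ B] (f : Sm W →ₐ[ℝ] B) (g : ι → B)
    (hg : ∀ i j, g i * g j = (-1 : ℝ) ^ (deg i * deg j) • (g j * g i))
    (hfg : ∀ r i, f r * g i = g i * f r) : Fn W deg →ₐ[ℝ] B :=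
  FnT.lift f g hg hfg

section
variable {B : Type*} [Ring B] [Algebra ℝ B] (f : Sm W →ₐ[ℝ] B) (g : ι → B)
    (hg : ∀ i j, g i * g j = (-1 : ℝ) ^ (deg i * deg j) • (g j * g i))
    (hfg : ∀ r i, f r * g i = g i * f r)

theorem lift_sc (r : Sm W) : lift (deg := deg) f g hg hfg (sc r) = f r :=
  FnT.lift_sc f g hg hfg r

theorem lift_gen (i : ι) : lift (deg := deg) f g hg hfg (gen i) = g i :=
  FnT.lift_gen f g hg hfg i

end

theorem sc_mul_gen (r : Sm W) (i : ι) : (sc r * gen i : Fn W deg) = gen i * sc r :=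
  FnT.sc_mul_gen r i

theorem gen_mul_gen (i j : ι) :
    (gen i * gen j : Fn W deg) = (-1 : ℝ) ^ (deg i * deg j) • (gen j * gen i) :=
  FnT.gen_mul_gen i j

/-- The action of the multiplicative monoid `ℝ`: `s` fixes the functions on `W` and multiplies
`z_i` by `s ^ deg i`. -/
def act (s : ℝ) : Fn W deg →ₐ[ℝ] Fn W deg :=
  lift sc (fun i => s ^ deg i • gen i)
    (fun i j => by
      rw [smul_mul_smul_comm, smul_mul_smul_comm, gen_mul_gen i j, smul_comm, mul_comm (s ^ _)])
    (fun r i => by rw [mul_smul_comm, smul_mul_assoc, sc_mul_gen])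

theorem act_sc (s : ℝ) (r : Sm W) : act s (sc r : Fn W deg) = sc r := lift_sc _ _ _ _ _
theorem act_gen (s : ℝ) (i : ι) : act s (gen i : Fn W deg) = s ^ deg i • gen i :=
  lift_gen _ _ _ _ _

theorem act_one (u : Fn W deg) : act 1 u = u := by
  have := algHom_ext (F := act 1) (G := AlgHom.id ℝ (Fn W deg)) (fun r => by simp [act_sc])
    (fun i => by simp [act_gen]) u
  simpa using this

theorem act_act (s t : ℝ) (u : Fn W deg) : act s (act t u) = act (s * t) u := by
  have := algHom_ext (F := (act s).comp (act t)) (G := (act (s * t) : Fn W deg →ₐ[ℝ] Fn W deg))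
    (fun r => by simp [act_sc])
    (fun i => by simp [act_gen, smul_smul, mul_pow, mul_comm]) u
  simpa using this

/-- The action as a monoid homomorphism. -/
def actHom (W : Opens (Eu n)) (deg : ι → ℕ) : ℝ →* (Fn W deg →ₐ[ℝ] Fn W deg) where
  toFun := act
  map_one' := AlgHom.ext act_one
  map_mul' s t := by
    apply AlgHom.ext
    intro u
    rw [AlgHom.mul_apply, act_act]

/-- `u` is homogeneous of degree `k`. -/
def IsHom (k : ℕ) (u : Fn W deg) : Prop := ∀ s : ℝ, act s u = s ^ k • u

theorem isHom_sc (r : Sm W) : IsHom 0 (sc r : Fn W deg) := fun s => by simp [act_sc]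
theorem isHom_gen (i : ι) : IsHom (deg i) (gen i : Fn W deg) := fun s => act_gen s i

theorem IsHom.mul {k l : ℕ} {u v : Fn W deg} (hu : IsHom k u) (hv : IsHom l v) :
    IsHom (k + l) (u * v) := fun s => by
  rw [map_mul, hu s, hv s, smul_mul_smul_comm, pow_add]

theorem IsHom.add {k : ℕ} {u v : Fn W deg} (hu : IsHom k u) (hv : IsHom k v) :
    IsHom k (u + v) := fun s => by
  rw [map_add, hu s, hv s, smul_add]

theorem IsHom.sum {k : ℕ} {τ : Type} {s : Finset τ} {u : τ → Fn W deg}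
    (hu : ∀ i, IsHom k (u i)) : IsHom k (∑ i ∈ s, u i) := fun t => by
  rw [map_sum, Finset.smul_sum]
  exact Finset.sum_congr rfl fun i _ => hu i t

theorem IsHom.congr {k l : ℕ} {u : Fn W deg} (hu : IsHom k u) (h : k = l) : IsHom l u := h ▸ hu

/-- Supercommutativity with a generator. -/
theorem gen_mul (i : ι) (u : Fn W deg) : gen i * u = act ((-1) ^ deg i) u * gen i := by
  induction u using induction with
  | h0 r => rw [act_sc, sc_mul_gen]
  | h1 j => rw [act_gen, gen_mul_gen, smul_mul_assoc, pow_mul]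
  | hm a b ha hb => rw [map_mul, ← mul_assoc, ha, mul_assoc, hb, mul_assoc]
  | ha a b ha hb => rw [map_add, mul_add, add_mul, ha, hb]

theorem sc_mul (r : Sm W) (u : Fn W deg) : sc r * u = u * sc r := by
  induction u using induction with
  | h0 r' => rw [← map_mul, ← map_mul, mul_comm]
  | h1 j => exact sc_mul_gen r j
  | hm a b ha hb => rw [← mul_assoc, ha, mul_assoc, hb, mul_assoc]
  | ha a b ha hb => rw [mul_add, add_mul, ha, hb]

theorem neg_one_pow_cases (k : ℕ) : (-1 : ℝ) ^ k = 1 ∨ (-1 : ℝ) ^ k = -1 := neg_one_pow_eq_or ℝ k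

theorem act_sign_of {l : ℕ} {v : Fn W deg} (hv : IsHom l v) (k : ℕ) :
    act ((-1) ^ k) v = (-1 : ℝ) ^ (k * l) • v := by
  rw [hv, pow_mul]

/-- Supercommutativity. -/
theorem IsHom.mul_eq {l : ℕ} {v : Fn W deg} (hv : IsHom l v) (u : Fn W deg) :
    v * u = act ((-1) ^ l) u * v := by
  induction u using induction with
  | h0 r => rw [act_sc, sc_mul]
  | h1 j =>
    have h := gen_mul j v
    rw [act_sign_of hv] at h
    rw [act_gen, smul_mul_assoc, h, smul_mul_assoc, smul_smul, ← pow_mul, mul_comm l (deg j),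
      ← pow_add, Even.neg_one_pow ⟨_, rfl⟩, one_smul]
  | hm a b ha hb => rw [map_mul, ← mul_assoc, ha, mul_assoc, hb, mul_assoc]
  | ha a b ha hb => rw [map_add, mul_add, add_mul, ha, hb]

theorem IsHom.comm {k l : ℕ} {u v : Fn W deg} (hu : IsHom k u) (hv : IsHom l v) :
    u * v = (-1 : ℝ) ^ (k * l) • (v * u) := by
  rw [hu.mul_eq v, act_sign_of hv, smul_mul_assoc]

/-- A morphism of graded domains, given by the images of the coordinates. -/
def hom (f : Sm W' →ₐ[ℝ] Fn W deg) (hf : ∀ r, IsHom 0 (f r)) (g : ι' → Fn W deg)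
    (hg : ∀ i, IsHom (deg' i) (g i)) : Fn W' deg' →ₐ[ℝ] Fn W deg :=
  lift f g (fun i j => (hg i).comm (hg j)) (fun r i => by
    rw [(hf r).comm (hg i), zero_mul, pow_zero, one_smul])

section
variable (f : Sm W' →ₐ[ℝ] Fn W deg) (hf : ∀ r, IsHom 0 (f r)) (g : ι' → Fn W deg)
    (hg : ∀ i, IsHom (deg' i) (g i))

theorem hom_sc (r : Sm W') : hom f hf g hg (sc r) = f r := lift_sc _ _ _ _ _
theorem hom_gen (i : ι') : hom f hf g hg (gen i) = g i := lift_gen _ _ _ _ _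

theorem hom_act (s : ℝ) (u : Fn W' deg') :
    hom f hf g hg (act s u) = act s (hom f hf g hg u) := by
  have := algHom_ext (F := (hom f hf g hg).comp (act s)) (G := (act s).comp (hom f hf g hg))
    (fun r => by
      have := hf r s
      simp [act_sc, hom_sc] at this ⊢; rw [this])
    (fun i => by
      have := hg i s
      simp [act_gen, hom_gen] at this ⊢; rw [this]) u
  simpa using this

end

/-! ### Partial derivatives -/

/-- `∂/∂x^a`. -/
def pdx (a : Fin n) : Fn W deg →ₗ[ℝ] Fn W deg :=
  LinearMap.rTensor (GAlg deg) (Sm.pd a).toLinearMap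

/-- `∂/∂z_i` (acting from the left). -/
def pdz (i : ι) : Fn W deg →ₗ[ℝ] Fn W deg := LinearMap.lTensor (Sm W) (GAlg.pd i)

theorem pdx_sc (a : Fin n) (r : Sm W) : pdx a (sc r : Fn W deg) = sc (Sm.pd a r) :=
  FnT.pdx_sc a r

theorem pdx_gen (a : Fin n) (i : ι) : pdx a (gen i : Fn W deg) = 0 := FnT.pdx_gen a i

theorem pdz_sc (i : ι) (r : Sm W) : pdz i (sc r : Fn W deg) = 0 := FnT.pdz_sc i r

open Classical in
theorem pdz_gen (i j : ι) : pdz i (gen j : Fn W deg) = if j = i then 1 else 0 :=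
  FnT.pdz_gen i j

theorem pdx_mul (a : Fin n) (u v : Fn W deg) : pdx a (u * v) = pdx a u * v + u * pdx a v :=
  FnT.pdx_mul a u v

theorem pdz_mul (i : ι) (u v : Fn W deg) :
    pdz i (u * v) = pdz i u * v + act ((-1) ^ deg i) u * pdz i v :=
  FnT.pdz_mul i u v

/-- Twisted derivations along an algebra map, of parity given by the sign `ε`, are determined by
their values on the coordinates. -/
theorem der_ext {B : Type*} [Ring B] [Algebra ℝ B] {F : Fn W deg →ₐ[ℝ] B} {ε : ℝ}
    {D D' : Fn W deg →ₗ[ℝ] B}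
    (hD : ∀ u v, D (u * v) = D u * F v + F (act ε u) * D v)
    (hD' : ∀ u v, D' (u * v) = D' u * F v + F (act ε u) * D' v)
    (h0 : ∀ r, D (sc r) = D' (sc r)) (h1 : ∀ i, D (gen i) = D' (gen i)) (u : Fn W deg) :
    D u = D' u := by
  induction u using induction with
  | h0 r => exact h0 r
  | h1 i => exact h1 i
  | hm a b ha hb => rw [hD, hD', ha, hb]
  | ha a b ha hb => rw [map_add, map_add, ha, hb]


end Fn

/-! ## Charts -/

section Charts

variable {n : ℕ} {M : Type*} [TopologicalSpace M] [ChartedSpace (Eu n) M]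

/-- Coordinate charts of the smooth manifold `M` (all charts of the maximal smooth atlas). -/
def Chart (n : ℕ) (M : Type*) [TopologicalSpace M] [ChartedSpace (Eu n) M] :=
  {e : OpenPartialHomeomorph M (Eu n) // e ∈ IsManifold.maximalAtlas (𝓡 n) ∞ M}

namespace Chart

/-- `e ≤ e'` if the domain of `e` is contained in the domain of `e'`. -/
instance : Preorder (Chart n M) where
  le e e' := e.1.source ⊆ e'.1.source
  le_refl _ := Subset.rfl
  le_trans _ _ _ h h' := Subset.trans h h'

/-- The image of the chart, an open subset of `ℝⁿ`. -/
def dom (e : Chart n M) : Opens (Eu n) := ⟨e.1.target, e.1.open_target⟩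

/-- The change of coordinates `e' ∘ e⁻¹` from a chart to a chart with larger domain. -/
def chg {e e' : Chart n M} (h : e ≤ e') : SmMap e.dom e'.dom :=
  ⟨fun x => ⟨e'.1 (e.1.symm x), e'.1.map_source (h (e.1.map_target x.2))⟩, by
    rw [← ContMDiff.subtypeVal_comp_iff]
    intro x
    refine (contMDiffAt_subtype_iff (f := fun y => e'.1 (e.1.symm y))).2 ?_
    exact (contMDiffAt_of_mem_maximalAtlas e'.2 (h (e.1.map_target x.2))).comp _
      (contMDiffAt_symm_of_mem_maximalAtlas e.2 x.2)⟩

theorem coe_chg {e e' : Chart n M} (h : e ≤ e') (x : e.dom) :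
    (chg h x : Eu n) = e'.1 (e.1.symm x) := rfl

theorem chg_refl (e : Chart n M) (x : e.dom) : chg (le_refl e) x = x :=
  Subtype.ext (e.1.right_inv x.2)

theorem chg_chg {e e' e'' : Chart n M} (h : e ≤ e') (h' : e' ≤ e'') (x : e.dom) :
    chg h' (chg h x) = chg (h.trans h') x := by
  apply Subtype.ext
  rw [coe_chg, coe_chg, coe_chg, e'.1.left_inv (h (e.1.map_target x.2))]

/-- The effect of the change of coordinates on functions. -/
abbrev tr {e e' : Chart n M} (h : e ≤ e') : Sm e'.dom →ₐ[ℝ] Sm e.dom := Sm.pull (chg h)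

theorem tr_refl (e : Chart n M) (f : Sm e.dom) : tr (le_refl e) f = f := by
  ext x
  rw [Sm.pull_apply, chg_refl]

theorem tr_tr {e e' e'' : Chart n M} (h : e ≤ e') (h' : e' ≤ e'') (f : Sm e''.dom) :
    tr h (tr h' f) = tr (h.trans h') f := by
  ext x
  rw [Sm.pull_apply, Sm.pull_apply, Sm.pull_apply, chg_chg]

/-- The Jacobian matrix `∂x'^i/∂x^a` of a change of coordinates, with rows `i` and columns `a`. -/
def jac {e e' : Chart n M} (h : e ≤ e') : Matrix (Fin n) (Fin n) (Sm e.dom) :=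
  Matrix.of fun i a => Sm.pd a (tr h (Sm.crd i))

theorem jac_refl (e : Chart n M) : jac (le_refl e) = 1 := by
  ext1 i a
  rw [jac, Matrix.of_apply, tr_refl, Sm.pd_crd, Matrix.one_apply]
  simp [eq_comm]

theorem jac_trans {e e' e'' : Chart n M} (h : e ≤ e') (h' : e' ≤ e'') :
    jac (h.trans h') = (jac h').map (tr h) * jac h := by
  ext1 i a
  rw [jac, Matrix.of_apply, ← tr_tr h h', Sm.pd_pull, Matrix.mul_apply]
  refine Finset.sum_congr rfl fun j _ => ?_
  rw [mul_comm]; rfl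

/-- The chart `e'` restricted to the domain of `e`. -/
def restr (e e' : Chart n M) : Chart n M :=
  ⟨e'.1.restr e.1.source, restr_mem_maximalAtlas _ e'.2 e.1.open_source⟩

theorem isUnit_jac {e e' : Chart n M} (h : e ≤ e') : IsUnit (jac h) := by
  have hs : (restr e e').1.source = e.1.source := by
    show (e'.1.restr e.1.source).source = _
    rw [e'.1.restr_source' _ e.1.open_source]
    exact inter_eq_right.2 h
  have h1 : e ≤ restr e e' := hs.symm.subset
  have h2 : restr e e' ≤ e := hs.subset
  have h3 : restr e e' ≤ e' := h2.trans h
  have e1 : jac h3 = 1 := by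
    ext1 i a
    have : tr h3 (Sm.crd i) = Sm.crd i := by
      ext x
      rw [Sm.pull_apply]
      show (chg h3 x : Eu n) i = (x : Eu n) i
      rw [coe_chg]
      exact congrArg (fun v : Eu n => v i) ((restr e e').1.right_inv x.2)
    rw [jac, Matrix.of_apply, this, Sm.pd_crd, Matrix.one_apply]
    simp [eq_comm]
  have e2 := jac_trans h1 h3
  rw [e1, Matrix.map_one _ (map_zero _) (map_one _), one_mul] at e2
  have e3 := jac_trans h1 h2
  rw [jac_refl] at e3
  rw [show jac h = jac h1 from e2]
  exact IsUnit.of_mul_eq_one_right _ e3.symm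

/-- The inverse Jacobian matrix `∂x^a/∂x'^i`, with rows `a` and columns `i`. -/
def jacInv {e e' : Chart n M} (h : e ≤ e') : Matrix (Fin n) (Fin n) (Sm e.dom) := (jac h)⁻¹

theorem jacInv_refl (e : Chart n M) : jacInv (le_refl e) = 1 := by
  rw [jacInv, jac_refl, inv_one]

theorem jacInv_trans {e e' e'' : Chart n M} (h : e ≤ e') (h' : e' ≤ e'') :
    jacInv (h.trans h') = jacInv h * (jacInv h').map (tr h) := by
  have hu := (Matrix.isUnit_iff_isUnit_det _).1 (isUnit_jac h')
  have : ((jac h').map (tr h))⁻¹ = ((jac h')⁻¹).map (tr h) := by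
    apply Matrix.inv_eq_left_inv
    have := Matrix.nonsing_inv_mul _ hu
    rw [← Matrix.map_mul, this, Matrix.map_one _ (map_zero _) (map_one _)]
  rw [jacInv, jac_trans h h', Matrix.mul_inv_rev, this]
  rfl

end Chart

end Charts

/-! ## The shifted tangent bundle of a graded domain -/

namespace Fn

variable {n : ℕ} {ι ι' : Type} {W W' W'' : Opens (Eu n)}
  {deg : ι → ℕ} {deg' : ι' → ℕ}

/-- Besides the coordinates `x^a` and `z_i` of the given graded domain, its shifted tangent bundle
has the fibre coordinates `dx^a` of degree `1` and `dz_i` of degree `deg i + 1`. The generators are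
indexed by: `inl i` for `z_i`, `inr (inl a)` for `dx^a`, `inr (inr i)` for `dz_i`. -/
def tdeg (n : ℕ) (deg : ι → ℕ) : ι ⊕ (Fin n ⊕ ι) → ℕ :=
  Sum.elim deg (Sum.elim (fun _ => 1) (fun i => deg i + 1))

def dx (a : Fin n) : Fn W (tdeg n deg) := gen (Sum.inr (Sum.inl a))
def dz (i : ι) : Fn W (tdeg n deg) := gen (Sum.inr (Sum.inr i))

/-- Functions on the graded domain as functions on its shifted tangent bundle. -/
def inc : Fn W deg →ₐ[ℝ] Fn W (tdeg n deg) :=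
  hom sc isHom_sc (fun i => gen (Sum.inl i)) (fun i => isHom_gen (Sum.inl i))

theorem inc_sc (r : Sm W) : inc (sc r : Fn W deg) = sc r := hom_sc _ _ _ _ _
theorem inc_gen (i : ι) : inc (gen i : Fn W deg) = gen (Sum.inl i) := hom_gen _ _ _ _ _
theorem inc_act (s : ℝ) (u : Fn W deg) : inc (act s u) = act s (inc u) := hom_act _ _ _ _ _ _

theorem IsHom.inc {k : ℕ} {u : Fn W deg} (hu : IsHom k u) : IsHom k (inc u) := fun s => by
  rw [← inc_act, hu s, map_smul]

variable [Fintype ι] [Fintype ι']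

/-- The de Rham vector field `Q_dR = dx^a ∂/∂x^a + dz_i ∂/∂z_i` on the shifted tangent bundle. -/
def d : Fn W (tdeg n deg) →ₗ[ℝ] Fn W (tdeg n deg) :=
  ∑ a, (LinearMap.mulLeft ℝ (dx a)).comp (pdx a) +
    ∑ i, (LinearMap.mulLeft ℝ (dz i)).comp (pdz (Sum.inl i))

theorem d_apply (u : Fn W (tdeg n deg)) :
    d u = ∑ a, dx a * pdx a u + ∑ i, dz i * pdz (Sum.inl i) u := by
  simp [d, LinearMap.sum_apply]

theorem d_mul (u v : Fn W (tdeg n deg)) : d (u * v) = d u * v + act (-1) u * d v := by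
  have hx : ∀ a : Fin n, dx a * pdx a (u * v) =
      dx a * pdx a u * v + act (-1) u * (dx a * pdx a v) := by
    intro a
    have h : dx a * u = act (-1) u * dx a := by
      have := gen_mul (W := W) (deg := tdeg n deg) (Sum.inr (Sum.inl a)) u
      simpa [tdeg, dx] using this
    rw [pdx_mul, mul_add, ← mul_assoc, ← mul_assoc, h, mul_assoc (act (-1) u)]
  have hz : ∀ i : ι, dz i * pdz (Sum.inl i) (u * v) =
      dz i * pdz (Sum.inl i) u * v + act (-1) u * (dz i * pdz (Sum.inl i) v) := by
    intro i
    have h : dz i * act ((-1) ^ deg i) u = act (-1) u * dz i := by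
      have := gen_mul (W := W) (deg := tdeg n deg) (Sum.inr (Sum.inr i)) (act ((-1) ^ deg i) u)
      rw [act_act] at this
      have e : tdeg n deg (Sum.inr (Sum.inr i)) = deg i + 1 := rfl
      have e2 : ((-1 : ℝ) ^ (deg i + 1) * (-1) ^ deg i) = -1 := by
        rw [← pow_add, Odd.neg_one_pow ⟨deg i, by ring⟩]
      rw [e, e2] at this
      exact this
    rw [pdz_mul, mul_add, ← mul_assoc, ← mul_assoc]
    show _ + dz i * act ((-1) ^ deg i) u * _ = _
    rw [h, mul_assoc (act (-1) u)]
  simp only [d_apply, hx, hz, Finset.sum_add_distrib, mul_add, add_mul, Finset.mul_sum,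
    Finset.sum_mul]
  abel

theorem d_sc (r : Sm W) : d (sc r : Fn W (tdeg n deg)) = ∑ a, dx a * sc (Sm.pd a r) := by
  simp [d_apply, pdx_sc, pdz_sc]

theorem d_gen_inl (i : ι) : d (gen (Sum.inl i) : Fn W (tdeg n deg)) = dz i := by
  classical
  simp [d_apply, pdx_gen, pdz_gen, Finset.sum_ite_eq]

theorem d_dx (a : Fin n) : d (dx a : Fn W (tdeg n deg)) = 0 := by
  simp [d_apply, dx, pdx_gen, pdz_gen]

theorem d_dz (i : ι) : d (dz i : Fn W (tdeg n deg)) = 0 := by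
  simp [d_apply, dz, pdx_gen, pdz_gen]

theorem act_d (s : ℝ) (u : Fn W (tdeg n deg)) : act s (d u) = s • d (act s u) := by
  refine der_ext (F := act s) (ε := -1) (D := (act s).toLinearMap.comp d)
    (D' := s • d.comp (act s).toLinearMap) ?_ ?_ ?_ ?_ u
  · intro u v
    simp [d_mul]
  · intro u v
    simp only [LinearMap.smul_apply, LinearMap.comp_apply, AlgHom.toLinearMap_apply, map_mul,
      d_mul, smul_add, act_act, mul_comm (-1) s]
    rw [smul_mul_assoc, mul_smul_comm]
  · intro r
    simp only [LinearMap.smul_apply, LinearMap.comp_apply, AlgHom.toLinearMap_apply, act_sc, d_sc,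
      map_sum, map_mul, Finset.smul_sum]
    refine Finset.sum_congr rfl fun a _ => ?_
    rw [dx, act_gen, smul_mul_assoc]
    simp [tdeg]
  · rintro (i | a | i)
    · simp only [LinearMap.smul_apply, LinearMap.comp_apply, AlgHom.toLinearMap_apply, act_gen,
        d_gen_inl, map_smul]
      rw [dz, act_gen, smul_smul]
      simp [tdeg, pow_succ, mul_comm]
    · have h := d_dx (W := W) (deg := deg) a
      rw [dx] at h
      simp [act_gen, h]
    · have h := d_dz (W := W) (deg := deg) i
      rw [dz] at h
      simp [act_gen, h]

theorem d_d (u : Fn W (tdeg n deg)) : d (d u) = 0 := by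
  have key : ∀ u : Fn W (tdeg n deg), d (act (-1) u) = - act (-1) (d u) := by
    intro u
    rw [act_d, neg_one_smul, neg_neg]
  refine der_ext (F := AlgHom.id ℝ _) (ε := 1) (D := d.comp d) (D' := 0) ?_ ?_ ?_ ?_ u
  · intro u v
    simp only [LinearMap.comp_apply, d_mul, map_add, key, act_act, AlgHom.id_apply]
    rw [neg_one_mul, neg_neg, act_one, neg_mul]
    abel
  · simp
  · intro r
    have h : ∀ a : Fin n, d (dx a * sc (Sm.pd a r) : Fn W (tdeg n deg)) =
        - ∑ b, dx a * dx b * sc (Sm.pd b (Sm.pd a r)) := by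
      intro a
      have : act (-1) (dx a : Fn W (tdeg n deg)) = - dx a := by
        rw [dx, act_gen]; simp only [tdeg, Sum.elim_inl, Sum.elim_inr, pow_one]; exact neg_one_smul ℝ _
      rw [d_mul, d_dx, zero_mul, zero_add, this, d_sc, neg_mul, Finset.mul_sum]
      simp only [mul_assoc]
    simp only [LinearMap.comp_apply, d_sc, map_sum, h, LinearMap.zero_apply]
    rw [Finset.sum_neg_distrib, neg_eq_zero]
    set S := ∑ a : Fin n, ∑ b : Fin n, dx a * dx b * (sc (Sm.pd b (Sm.pd a r)) : Fn W (tdeg n deg))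
      with hS
    have hneg : S = -S := by
      conv_lhs => rw [hS, Finset.sum_comm]
      rw [hS, ← Finset.sum_neg_distrib]
      refine Finset.sum_congr rfl fun a _ => ?_
      rw [← Finset.sum_neg_distrib]
      refine Finset.sum_congr rfl fun b _ => ?_
      have : (dx b * dx a : Fn W (tdeg n deg)) = - (dx a * dx b) := by
        rw [dx, dx, gen_mul_gen]; simp only [tdeg, Sum.elim_inl, Sum.elim_inr, mul_one, pow_one]
        exact neg_one_smul ℝ _
      rw [this, Sm.pd_comm a b, neg_mul]
    have h2 : (2 : ℝ) • S = 0 := by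
      rw [two_smul]; nth_rewrite 1 [hneg]; exact neg_add_cancel S
    exact (smul_eq_zero.1 h2).resolve_left two_ne_zero
  · rintro (i | a | i)
    · simp only [LinearMap.comp_apply, d_gen_inl, d_dz, LinearMap.zero_apply]
    · have h := d_dx (W := W) (deg := deg) a
      rw [dx] at h
      simp [h]
    · have h := d_dz (W := W) (deg := deg) i
      rw [dz] at h
      simp [h]

theorem IsHom.d {k : ℕ} {u : Fn W (tdeg n deg)} (hu : IsHom k u) : IsHom (k + 1) (d u) :=
  fun s => by rw [act_d, hu s, map_smul, smul_smul, pow_succ, mul_comm]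

/-- The tangent lift of a morphism `F` of graded domains: `z ↦ F z`, `dz ↦ d (F z)`. -/
def tmap (F : Fn W' deg' →ₐ[ℝ] Fn W deg) (hF : ∀ s u, F (act s u) = act s (F u)) :
    Fn W' (tdeg n deg') →ₐ[ℝ] Fn W (tdeg n deg) :=
  hom ((inc.comp F).comp sc)
    (fun r => by
      refine IsHom.inc (u := F (sc r)) fun s => ?_
      rw [← hF, act_sc, pow_zero, one_smul])
    (Sum.elim (fun i => inc (F (gen i)))
      (Sum.elim (fun a => d (inc (F (sc (Sm.crd a))))) (fun i => d (inc (F (gen i))))))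
    (by
      have h : ∀ i, IsHom (deg' i) (F (gen i)) := fun i s => by
        rw [← hF, act_gen, map_smul]
      have h0 : ∀ r, IsHom 0 (F (sc r)) := fun r s => by
        rw [← hF, act_sc]; simp
      rintro (i | a | i)
      · exact (h i).inc
      · exact (h0 _).inc.d.congr (by simp [tdeg])
      · exact (h i).inc.d)

section
variable (F : Fn W' deg' →ₐ[ℝ] Fn W deg) (hF : ∀ s u, F (act s u) = act s (F u))

theorem tmap_sc (r : Sm W') : tmap F hF (sc r) = inc (F (sc r)) := hom_sc _ _ _ _ _
theorem tmap_inl (i : ι') : tmap F hF (gen (Sum.inl i)) = inc (F (gen i)) := hom_gen _ _ _ _ _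
theorem tmap_dx (a : Fin n) : tmap F hF (dx a) = d (inc (F (sc (Sm.crd a)))) := hom_gen _ _ _ _ _
theorem tmap_dz (i : ι') : tmap F hF (dz i) = d (inc (F (gen i))) := hom_gen _ _ _ _ _
theorem tmap_act (s : ℝ) (u : Fn W' (tdeg n deg')) :
    tmap F hF (act s u) = act s (tmap F hF u) := hom_act _ _ _ _ _ _

theorem tmap_inc (u : Fn W' deg') : tmap F hF (inc u) = inc (F u) :=
  algHom_ext (F := (tmap F hF).comp inc) (G := inc.comp F)
    (fun r => by simp [inc_sc, tmap_sc]) (fun i => by simp [inc_gen, tmap_inl]) u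

/-- The tangent lift commutes with the de Rham vector fields, if `F` is induced by a smooth map on
functions of degree zero. -/
theorem tmap_d (φ : SmMap W W') (hφ : ∀ r, F (sc r) = sc (Sm.pull φ r))
    (u : Fn W' (tdeg n deg')) : tmap F hF (d u) = d (tmap F hF u) := by
  refine der_ext (F := tmap F hF) (ε := -1) (D := (tmap F hF).toLinearMap.comp d)
    (D' := d.comp (tmap F hF).toLinearMap) ?_ ?_ ?_ ?_ u
  · intro u v
    simp [d_mul]
  · intro u v
    simp [d_mul, tmap_act]
  · intro r
    simp only [LinearMap.comp_apply, AlgHom.toLinearMap_apply, d_sc, map_sum, map_mul, tmap_sc,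
      tmap_dx, hφ, inc_sc, Finset.sum_mul]
    rw [Finset.sum_comm]
    refine Finset.sum_congr rfl fun a _ => ?_
    rw [Sm.pd_pull, map_sum, Finset.mul_sum]
    refine Finset.sum_congr rfl fun i _ => ?_
    rw [map_mul, mul_assoc]
  · rintro (i | a | i)
    · simp only [LinearMap.comp_apply, AlgHom.toLinearMap_apply, d_gen_inl, tmap_inl, tmap_dz]
    · show tmap F hF (d (dx a)) = d (tmap F hF (dx a))
      rw [d_dx, tmap_dx, d_d, map_zero]
    · show tmap F hF (d (dz i)) = d (tmap F hF (dz i))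
      rw [d_dz, tmap_dz, d_d, map_zero]

end

/-- Contraction `ι_V` of differential forms on a graded domain (functions on the shifted tangent
bundle) with a vector field `V`: `ι_V = V(x^a) ∂/∂(dx^a) + V(z_i) ∂/∂(dz_i)`. -/
def contract (V : Fn W deg →ₗ[ℝ] Fn W deg) : Fn W (tdeg n deg) →ₗ[ℝ] Fn W (tdeg n deg) :=
  ∑ a, (LinearMap.mulLeft ℝ (inc (V (sc (Sm.crd a))))).comp (pdz (Sum.inr (Sum.inl a))) +
    ∑ i, (LinearMap.mulLeft ℝ (inc (V (gen i)))).comp (pdz (Sum.inr (Sum.inr i)))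

end Fn

/-! ## Graded manifolds -/

section Manifolds

universe u v w

variable {n : ℕ} {M : Type u} [TopologicalSpace M] [ChartedSpace (Eu n) M]

/-- A graded-ringed space over `M`, given on the basis of coordinate neighbourhoods: algebras of
functions `Fun e` over the domains of the charts `e`, with an action of the multiplicative monoid
`ℝ` (`f` has degree `k` if `act e s f = s ^ k • f` for all `s`; the operator `act e (-1)` is the
parity operator), and restriction maps. Graded manifolds with base `M` are such spaces which
locally are graded domains; see `NMan` for those used below. -/
structure GradedSpace (n : ℕ) (M : Type u) [TopologicalSpace M] [ChartedSpace (Eu n) M] where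
  Fun : Chart n M → Type v
  [ring : ∀ e, Ring (Fun e)]
  [algebra : ∀ e, Algebra ℝ (Fun e)]
  act : ∀ e, ℝ →* (Fun e →ₐ[ℝ] Fun e)
  res : ∀ {e e' : Chart n M}, e ≤ e' → Fun e' →ₐ[ℝ] Fun e
  res_act : ∀ {e e' : Chart n M} (h : e ≤ e') (s : ℝ) (f : Fun e'),
    res h (act e' s f) = act e s (res h f)
  res_refl : ∀ (e : Chart n M) (f : Fun e), res (le_refl e) f = f
  res_res : ∀ {e e' e'' : Chart n M} (h : e ≤ e') (h' : e' ≤ e'') (f : Fun e''),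
    res h (res h' f) = res (h.trans h') f

namespace GradedSpace

attribute [instance] ring algebra

/-- A morphism `X → Y` over the identity of `M`, given by the pull-back of functions: algebra
homomorphisms compatible with restrictions and with the actions of `ℝ`. -/
structure Hom (X : GradedSpace.{u, v} n M) (Y : GradedSpace.{u, w} n M) where
  pb : ∀ e, Y.Fun e →ₐ[ℝ] X.Fun e
  pb_res : ∀ {e e' : Chart n M} (h : e ≤ e') (f : Y.Fun e'),
    pb e (Y.res h f) = X.res h (pb e' f)
  pb_act : ∀ (e : Chart n M) (s : ℝ) (f : Y.Fun e), pb e (Y.act e s f) = X.act e s (pb e f)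

universe v₁ v₂ v₃

def Hom.id (X : GradedSpace.{u, v} n M) : Hom X X where
  pb _ := AlgHom.id ℝ _
  pb_res _ _ := rfl
  pb_act _ _ _ := rfl

/-- The composition `g ∘ f`. -/
def Hom.comp {X : GradedSpace.{u, v₁} n M} {Y : GradedSpace.{u, v₂} n M}
    {Z : GradedSpace.{u, v₃} n M} (g : Hom Y Z) (f : Hom X Y) : Hom X Z where
  pb e := (f.pb e).comp (g.pb e)
  pb_res h u := by simp [g.pb_res, f.pb_res]
  pb_act e s u := by simp [g.pb_act, f.pb_act]

/-- Families of `ℝ`-linear operators on the functions of `X`. -/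
abbrev Op (X : GradedSpace.{u, v} n M) := ∀ e, X.Fun e →ₗ[ℝ] X.Fun e

/-- `Q` is a homological vector field on `X`: a derivation of degree `1` of the sheaf of functions
with `Q² = 0`. -/
structure IsHomological (X : GradedSpace.{u, v} n M) (Q : Op X) : Prop where
  leibniz : ∀ e (f g : X.Fun e), Q e (f * g) = Q e f * g + X.act e (-1) f * Q e g
  degree : ∀ e (s : ℝ) (f : X.Fun e), X.act e s (Q e f) = s • Q e (X.act e s f)
  square : ∀ e (f : X.Fun e), Q e (Q e f) = 0
  res : ∀ {e e' : Chart n M} (h : e ≤ e') (f : X.Fun e'), X.res h (Q e' f) = Q e (X.res h f)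

/-- The morphism `f : (X, Q_X) → (Y, Q_Y)` intertwines the homological vector fields. -/
def Hom.IsNQ {X : GradedSpace.{u, v} n M} {Y : GradedSpace.{u, w} n M} (f : Hom X Y)
    (QX : Op X) (QY : Op Y) : Prop :=
  ∀ e (a : Y.Fun e), f.pb e (QY e a) = QX e (f.pb e a)

/-- `g` is inverse to `f`. -/
def Hom.IsInverse {X : GradedSpace.{u, v} n M} {Y : GradedSpace.{u, w} n M} (f : Hom X Y)
    (g : Hom Y X) : Prop :=
  g.comp f = Hom.id X ∧ f.comp g = Hom.id Y

/-- `(X, Q_X)` and `(Y, Q_Y)` are isomorphic as dg manifolds. -/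
def DGIso (X : GradedSpace.{u, v} n M) (QX : Op X) (Y : GradedSpace.{u, w} n M) (QY : Op Y) :
    Prop :=
  ∃ (f : Hom X Y) (g : Hom Y X), f.IsInverse g ∧ f.IsNQ QX QY ∧ g.IsNQ QY QX

end GradedSpace

open GradedSpace

/-- An `N`-manifold with base `M`: over every chart `e` of `M` it is the graded domain with body
`e.dom` and fibre coordinates `z_i` of positive degrees `deg i`; the coordinates `z_i` of `e'` are
expressed on a smaller chart `e` by the functions `coord h i`. -/
structure NMan (n : ℕ) (M : Type u) [TopologicalSpace M] [ChartedSpace (Eu n) M] where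
  ι : Type
  [fintype : Fintype ι]
  deg : ι → ℕ
  deg_pos : ∀ i, 0 < deg i
  coord : ∀ {e e' : Chart n M}, e ≤ e' → ι → Fn e.dom deg
  coord_isHom : ∀ {e e' : Chart n M} (h : e ≤ e') (i : ι), Fn.IsHom (deg i) (coord h i)
  coord_refl : ∀ (e : Chart n M) (i : ι), coord (le_refl e) i = Fn.gen i
  coord_coord : ∀ {e e' e'' : Chart n M} (h : e ≤ e') (h' : e' ≤ e'') (i : ι),
    Fn.hom (Fn.sc.comp (Chart.tr h)) (fun _ => Fn.isHom_sc _) (coord h) (coord_isHom h)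
      (coord h' i) = coord (h.trans h') i

namespace NMan

attribute [instance] fintype

variable (X : NMan n M)

/-- The change of coordinates, acting on functions. -/
def trans {e e' : Chart n M} (h : e ≤ e') : Fn e'.dom X.deg →ₐ[ℝ] Fn e.dom X.deg :=
  Fn.hom (Fn.sc.comp (Chart.tr h)) (fun _ => Fn.isHom_sc _) (X.coord h) (X.coord_isHom h)

theorem trans_sc {e e' : Chart n M} (h : e ≤ e') (r : Sm e'.dom) :
    X.trans h (Fn.sc r) = Fn.sc (Chart.tr h r) := Fn.hom_sc _ _ _ _ _

theorem trans_gen {e e' : Chart n M} (h : e ≤ e') (i : X.ι) :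
    X.trans h (Fn.gen i) = X.coord h i := Fn.hom_gen _ _ _ _ _

theorem trans_act {e e' : Chart n M} (h : e ≤ e') (s : ℝ) (u : Fn e'.dom X.deg) :
    X.trans h (Fn.act s u) = Fn.act s (X.trans h u) := Fn.hom_act _ _ _ _ _ _

theorem trans_refl (e : Chart n M) (u : Fn e.dom X.deg) : X.trans (le_refl e) u = u := by
  refine Fn.algHom_ext (F := X.trans (le_refl e)) (G := AlgHom.id ℝ _) (fun r => ?_)
    (fun i => ?_) u
  · rw [trans_sc, Chart.tr_refl]; rfl
  · rw [trans_gen, X.coord_refl]; rfl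

theorem trans_trans {e e' e'' : Chart n M} (h : e ≤ e') (h' : e' ≤ e'')
    (u : Fn e''.dom X.deg) : X.trans h (X.trans h' u) = X.trans (h.trans h') u := by
  refine Fn.algHom_ext (F := (X.trans h).comp (X.trans h')) (G := X.trans (h.trans h'))
    (fun r => ?_) (fun i => ?_) u
  · simp only [AlgHom.comp_apply, trans_sc, Chart.tr_tr]
  · simp only [AlgHom.comp_apply, trans_gen]; exact X.coord_coord h h' i

/-- The sheaf of functions of an `N`-manifold. -/
def space : GradedSpace.{u, 0} n M where
  Fun e := Fn e.dom X.deg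
  act e := Fn.actHom e.dom X.deg
  res h := X.trans h
  res_act h s f := X.trans_act h s f
  res_refl e f := X.trans_refl e f
  res_res h h' f := X.trans_trans h h' f

/-- A morphism of `N`-manifolds over `M`, from the images of the fibre coordinates. -/
def mkHom (X Y : NMan n M) (g : ∀ e : Chart n M, Y.ι → Fn e.dom X.deg)
    (hg : ∀ e i, Fn.IsHom (Y.deg i) (g e i))
    (hres : ∀ {e e' : Chart n M} (h : e ≤ e') (i : Y.ι),
      Fn.hom Fn.sc Fn.isHom_sc (g e) (hg e) (Y.coord h i) = X.trans h (g e' i)) :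
    Hom X.space Y.space where
  pb e := Fn.hom Fn.sc Fn.isHom_sc (g e) (hg e)
  pb_res {e e'} h f := by
    refine Fn.algHom_ext (F := (Fn.hom Fn.sc Fn.isHom_sc (g e) (hg e)).comp (Y.trans h))
      (G := (X.trans h).comp (Fn.hom Fn.sc Fn.isHom_sc (g e') (hg e'))) (fun r => ?_)
      (fun i => ?_) f
    · simp only [AlgHom.comp_apply, trans_sc, Fn.hom_sc]
    · simp only [AlgHom.comp_apply, trans_gen, Fn.hom_gen]; exact hres h i
  pb_act e s f := Fn.hom_act _ _ _ _ s f

/-! ### The shifted tangent bundle -/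

theorem tcoord_isHom {e e' : Chart n M} (h : e ≤ e') (i : X.ι ⊕ (Fin n ⊕ X.ι)) :
    Fn.IsHom (Fn.tdeg n X.deg i) (Fn.tmap (X.trans h) (X.trans_act h) (Fn.gen i)) := fun s => by
  rw [← Fn.tmap_act, Fn.act_gen, map_smul]

/-- The `NQ`-manifold `T[1]X`; its differential forms on `X` are its functions, and its coordinates
change by the tangent lifts of the coordinate changes of `X`. -/
def T : NMan n M where
  ι := X.ι ⊕ (Fin n ⊕ X.ι)
  deg := Fn.tdeg n X.deg
  deg_pos := by
    rintro (i | a | i)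
    · exact X.deg_pos i
    · exact Nat.one_pos
    · exact Nat.succ_pos _
  coord h i := Fn.tmap (X.trans h) (X.trans_act h) (Fn.gen i)
  coord_isHom h i := X.tcoord_isHom h i
  coord_refl e i := by
    rcases i with i | a | i
    · rw [Fn.tmap_inl, X.trans_refl, Fn.inc_gen]
    · show Fn.tmap _ _ (Fn.dx a) = Fn.dx a
      rw [Fn.tmap_dx, X.trans_refl, Fn.inc_sc, Fn.d_sc]
      simp [Sm.pd_crd]
    · show Fn.tmap _ _ (Fn.dz i) = Fn.dz i
      rw [Fn.tmap_dz, X.trans_refl, Fn.inc_gen, Fn.d_gen_inl]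
  coord_coord {e e' e''} h h' i := by
    have key : ∀ u, Fn.hom (Fn.sc.comp (Chart.tr h)) (fun _ => Fn.isHom_sc _)
        (fun i => Fn.tmap (X.trans h) (X.trans_act h) (Fn.gen i)) (X.tcoord_isHom h) u =
        Fn.tmap (X.trans h) (X.trans_act h) u := by
      intro u
      refine Fn.algHom_ext (fun r => ?_) (fun i => ?_) u
      · refine (Fn.hom_sc _ _ _ _ r).trans ?_
        rw [Fn.tmap_sc, trans_sc, Fn.inc_sc]; rfl
      · exact Fn.hom_gen _ _ _ _ i
    rw [key]
    rcases i with i | a | i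
    · rw [Fn.tmap_inl, Fn.tmap_inl, Fn.tmap_inc, trans_trans]
    · show Fn.tmap _ _ (Fn.tmap _ _ (Fn.dx a)) = Fn.tmap _ _ (Fn.dx a)
      rw [Fn.tmap_dx, Fn.tmap_dx, Fn.tmap_d _ _ (Chart.chg h) (X.trans_sc h), Fn.tmap_inc,
        trans_trans]
    · show Fn.tmap _ _ (Fn.tmap _ _ (Fn.dz i)) = Fn.tmap _ _ (Fn.dz i)
      rw [Fn.tmap_dz, Fn.tmap_dz, Fn.tmap_d _ _ (Chart.chg h) (X.trans_sc h), Fn.tmap_inc,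
        trans_trans]

theorem T_trans {e e' : Chart n M} (h : e ≤ e') (u : Fn e'.dom (Fn.tdeg n X.deg)) :
    X.T.trans h u = Fn.tmap (X.trans h) (X.trans_act h) u := by
  refine Fn.algHom_ext (fun r => ?_) (fun i => ?_) u
  · refine (X.T.trans_sc h r).trans ((Fn.tmap_sc _ _ r).trans ?_).symm
    rw [trans_sc, Fn.inc_sc]; rfl
  · exact X.T.trans_gen h i

/-- The de Rham vector field `Q_dR` on `T[1]X`. -/
def dR : Op X.T.space := fun _ => Fn.d

theorem isHomological_dR : IsHomological X.T.space X.dR where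
  leibniz _ f g := Fn.d_mul f g
  degree _ s f := Fn.act_d s f
  square _ f := Fn.d_d f
  res h f := by
    refine (X.T_trans h (Fn.d f)).trans ?_
    refine (Fn.tmap_d _ _ (Chart.chg h) (X.trans_sc h) f).trans ?_
    exact congrArg Fn.d (X.T_trans h f).symm

/-- The canonical projection `T[1]X → X`. -/
def proj : Hom X.T.space X.space :=
  mkHom X.T X (fun _ i => Fn.gen (Sum.inl i)) (fun _ i => Fn.isHom_gen (Sum.inl i))
    (fun h i => (((X.T.trans_gen h (Sum.inl i)).trans (Fn.tmap_inl _ _ i)).trans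
      (congrArg Fn.inc (X.trans_gen h i))).symm)

end NMan

/-! ## The graded manifolds `T[1]M`, `T^*[1]M` and `T^*[2]T[1]M` -/

/-- `M` itself, as an `N`-manifold without coordinates of positive degree. -/
def baseMan (n : ℕ) (M : Type u) [TopologicalSpace M] [ChartedSpace (Eu n) M] : NMan n M where
  ι := Empty
  deg := Empty.elim
  deg_pos := fun i => i.elim
  coord _ i := i.elim
  coord_isHom _ i := i.elim
  coord_refl _ i := i.elim
  coord_coord _ _ i := i.elim

/-- `T[1]M`, with coordinates `x^a` and `ξ^a = dx^a`. -/
abbrev T1 (n : ℕ) (M : Type u) [TopologicalSpace M] [ChartedSpace (Eu n) M] : NMan n M :=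
  (baseMan n M).T

namespace CotangentOne

def deg (n : ℕ) : Fin n → ℕ := fun _ => 1

/-- Under a change of coordinates, `η'_i = (∂x^a/∂x'^i) η_a`. -/
def coord {e e' : Chart n M} (h : e ≤ e') (i : Fin n) : Fn e.dom (deg n) :=
  ∑ a, Fn.sc (Chart.jacInv h a i) * Fn.gen a

theorem coord_isHom {e e' : Chart n M} (h : e ≤ e') (i : Fin n) :
    Fn.IsHom (deg n i) (coord h i) := by
  show Fn.IsHom 1 (∑ a, Fn.sc (Chart.jacInv h a i) * Fn.gen a : Fn e.dom (deg n))
  exact Fn.IsHom.sum fun a => ((Fn.isHom_sc _).mul (Fn.isHom_gen a)).congr (zero_add 1)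

/-- The coordinate change on functions. -/
def change {e e' : Chart n M} (h : e ≤ e') : Fn e'.dom (deg n) →ₐ[ℝ] Fn e.dom (deg n) :=
  Fn.hom (Fn.sc.comp (Chart.tr h)) (fun _ => Fn.isHom_sc _) (coord h) (coord_isHom h)

theorem change_sc {e e' : Chart n M} (h : e ≤ e') (r : Sm e'.dom) :
    change h (Fn.sc r) = Fn.sc (Chart.tr h r) := Fn.hom_sc _ _ _ _ _
theorem change_gen {e e' : Chart n M} (h : e ≤ e') (i : Fin n) :
    change h (Fn.gen i) = coord h i := Fn.hom_gen _ _ _ _ _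

end CotangentOne

/-- `T^*[1]M`, with coordinates `x^a` and `η_a = ∂/∂x^a` of degree `1`. -/
def cotangentOne (n : ℕ) (M : Type u) [TopologicalSpace M] [ChartedSpace (Eu n) M] :
    NMan n M where
  ι := Fin n
  deg := CotangentOne.deg n
  deg_pos _ := Nat.one_pos
  coord := CotangentOne.coord
  coord_isHom := CotangentOne.coord_isHom
  coord_refl e i := by
    rw [CotangentOne.coord, Chart.jacInv_refl]
    simp [Matrix.one_apply, apply_ite, ite_mul]
  coord_coord {e e' e''} h h' i := by
    show CotangentOne.change h (CotangentOne.coord h' i) = CotangentOne.coord (h.trans h') i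
    simp only [CotangentOne.coord, map_sum, map_mul, CotangentOne.change_sc,
      CotangentOne.change_gen, Chart.jacInv_trans h h', Matrix.mul_apply, Finset.mul_sum,
      Finset.sum_mul]
    rw [Finset.sum_comm]
    refine Finset.sum_congr rfl fun a _ => Finset.sum_congr rfl fun k _ => ?_
    rw [← mul_assoc, ← map_mul, mul_comm (Chart.tr h _), map_mul]; rfl

namespace Courant

variable {W : Opens (Eu n)}

/-- Indices of the fibre coordinates `ξ^a`, `p_a`, `η_a` of `T^*[2]T[1]M`. -/
abbrev Idx (n : ℕ) := Fin n ⊕ (Fin n ⊕ Fin n)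

/-- The degrees: `|ξ^a| = 1`, `|p_a| = 2`, `|η_a| = 1`. -/
def deg (n : ℕ) : Idx n → ℕ := Sum.elim (fun _ => 1) (Sum.elim (fun _ => 2) (fun _ => 1))

abbrev iXi (a : Fin n) : Idx n := Sum.inl a
abbrev iP (a : Fin n) : Idx n := Sum.inr (Sum.inl a)
abbrev iEta (a : Fin n) : Idx n := Sum.inr (Sum.inr a)

def xi (a : Fin n) : Fn W (deg n) := Fn.gen (iXi a)
def p (a : Fin n) : Fn W (deg n) := Fn.gen (iP a)
def eta (a : Fin n) : Fn W (deg n) := Fn.gen (iEta a)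

theorem isHom_xi (a : Fin n) : Fn.IsHom 1 (xi a : Fn W (deg n)) := Fn.isHom_gen (iXi a)
theorem isHom_p (a : Fin n) : Fn.IsHom 2 (p a : Fn W (deg n)) := Fn.isHom_gen (iP a)
theorem isHom_eta (a : Fin n) : Fn.IsHom 1 (eta a : Fn W (deg n)) := Fn.isHom_gen (iEta a)

/-- The vector field `Q = ξ^a ∂/∂x^a + p_a ∂/∂η_a`. -/
def Q : Fn W (deg n) →ₗ[ℝ] Fn W (deg n) :=
  ∑ a, ((LinearMap.mulLeft ℝ (xi a)).comp (Fn.pdx a) +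
    (LinearMap.mulLeft ℝ (p a)).comp (Fn.pdz (iEta a)))

theorem Q_apply (u : Fn W (deg n)) :
    Q u = ∑ a, (xi a * Fn.pdx a u + p a * Fn.pdz (iEta a) u) := by
  simp [Q, LinearMap.sum_apply]

theorem Q_mul (u v : Fn W (deg n)) : Q (u * v) = Q u * v + Fn.act (-1) u * Q v := by
  have h : ∀ a : Fin n, xi a * Fn.pdx a (u * v) + p a * Fn.pdz (iEta a) (u * v) =
      (xi a * Fn.pdx a u + p a * Fn.pdz (iEta a) u) * v +
        Fn.act (-1) u * (xi a * Fn.pdx a v + p a * Fn.pdz (iEta a) v) := by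
    intro a
    have h1 : xi a * u = Fn.act (-1) u * xi a := by
      have := (isHom_xi a).mul_eq u
      rwa [pow_one] at this
    have h2 : p a * Fn.act (-1) u = Fn.act (-1) u * p a := by
      have := (isHom_p a).mul_eq (Fn.act (-1) u)
      rwa [Fn.act_act, neg_one_sq, one_mul] at this
    have h3 : Fn.pdz (iEta a) (u * v) =
        Fn.pdz (iEta a) u * v + Fn.act (-1) u * Fn.pdz (iEta a) v := by
      have := Fn.pdz_mul (iEta a) u v
      rwa [show deg n (iEta a) = 1 from rfl, pow_one] at this
    rw [Fn.pdx_mul, h3, mul_add, mul_add, ← mul_assoc, ← mul_assoc, ← mul_assoc, ← mul_assoc, h1,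
      h2, add_mul, mul_add, mul_assoc (Fn.act (-1) u), mul_assoc (Fn.act (-1) u)]
    abel
  simp only [Q_apply, h, Finset.sum_add_distrib, Finset.sum_mul, Finset.mul_sum, add_mul, mul_add]

theorem Q_sc (r : Sm W) : Q (Fn.sc r : Fn W (deg n)) = ∑ a, xi a * Fn.sc (Sm.pd a r) := by
  simp [Q_apply, Fn.pdx_sc, Fn.pdz_sc]

theorem Q_xi (a : Fin n) : Q (xi a : Fn W (deg n)) = 0 := by
  simp [Q_apply, xi, Fn.pdx_gen, Fn.pdz_gen]

theorem Q_p (a : Fin n) : Q (p a : Fn W (deg n)) = 0 := by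
  simp [Q_apply, p, Fn.pdx_gen, Fn.pdz_gen]

theorem Q_eta (a : Fin n) : Q (eta a : Fn W (deg n)) = p a := by
  classical
  simp [Q_apply, eta, Fn.pdx_gen, Fn.pdz_gen]

theorem act_Q (s : ℝ) (u : Fn W (deg n)) : Fn.act s (Q u) = s • Q (Fn.act s u) := by
  refine Fn.der_ext (F := Fn.act s) (ε := -1) (D := (Fn.act s).toLinearMap.comp Q)
    (D' := s • Q.comp (Fn.act s).toLinearMap) ?_ ?_ ?_ ?_ u
  · intro u v
    simp [Q_mul]
  · intro u v
    simp only [LinearMap.smul_apply, LinearMap.comp_apply, AlgHom.toLinearMap_apply, map_mul,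
      Q_mul, smul_add, Fn.act_act, mul_comm (-1) s]
    rw [smul_mul_assoc, mul_smul_comm]
  · intro r
    simp only [LinearMap.smul_apply, LinearMap.comp_apply, AlgHom.toLinearMap_apply, Fn.act_sc,
      Q_sc, map_sum, map_mul, Finset.smul_sum]
    refine Finset.sum_congr rfl fun a _ => ?_
    rw [isHom_xi a s, smul_mul_assoc, pow_one]
  · rintro (a | a | a)
    · show Fn.act s (Q (xi a)) = s • Q (Fn.act s (xi a))
      rw [isHom_xi a s, map_smul, Q_xi, map_zero, smul_zero, smul_zero]
    · show Fn.act s (Q (p a)) = s • Q (Fn.act s (p a))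
      rw [isHom_p a s, map_smul, Q_p, map_zero, smul_zero, smul_zero]
    · show Fn.act s (Q (eta a)) = s • Q (Fn.act s (eta a))
      rw [isHom_eta a s, map_smul, Q_eta, isHom_p a s, smul_smul, pow_one, pow_two]

theorem Q_Q (u : Fn W (deg n)) : Q (Q u) = 0 := by
  have key : ∀ u : Fn W (deg n), Q (Fn.act (-1) u) = - Fn.act (-1) (Q u) := by
    intro u
    rw [act_Q, neg_one_smul, neg_neg]
  refine Fn.der_ext (F := AlgHom.id ℝ _) (ε := 1) (D := Q.comp Q) (D' := 0) ?_ ?_ ?_ ?_ u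
  · intro u v
    simp only [LinearMap.comp_apply, Q_mul, map_add, key, Fn.act_act, AlgHom.id_apply]
    rw [neg_one_mul, neg_neg, Fn.act_one, neg_mul]
    abel
  · simp
  · intro r
    have h : ∀ a : Fin n, Q (xi a * Fn.sc (Sm.pd a r) : Fn W (deg n)) =
        - ∑ b, xi a * xi b * Fn.sc (Sm.pd b (Sm.pd a r)) := by
      intro a
      have : Fn.act (-1) (xi a : Fn W (deg n)) = - xi a := by
        rw [isHom_xi a, pow_one]; exact neg_one_smul ℝ _
      rw [Q_mul, Q_xi, zero_mul, zero_add, this, Q_sc, neg_mul, Finset.mul_sum]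
      simp only [mul_assoc]
    simp only [LinearMap.comp_apply, Q_sc, map_sum, h, LinearMap.zero_apply]
    rw [Finset.sum_neg_distrib, neg_eq_zero]
    set S := ∑ a : Fin n, ∑ b : Fin n, xi a * xi b * (Fn.sc (Sm.pd b (Sm.pd a r)) : Fn W (deg n))
      with hS
    have hneg : S = -S := by
      conv_lhs => rw [hS, Finset.sum_comm]
      rw [hS, ← Finset.sum_neg_distrib]
      refine Finset.sum_congr rfl fun a _ => ?_
      rw [← Finset.sum_neg_distrib]
      refine Finset.sum_congr rfl fun b _ => ?_
      have : (xi b * xi a : Fn W (deg n)) = - (xi a * xi b) := by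
        rw [(isHom_xi b).comm (isHom_xi a), mul_one, pow_one]
        exact neg_one_smul ℝ _
      rw [this, Sm.pd_comm a b, neg_mul]
    have h2 : (2 : ℝ) • S = 0 := by
      rw [two_smul]; nth_rewrite 1 [hneg]; exact neg_add_cancel S
    exact (smul_eq_zero.1 h2).resolve_left two_ne_zero
  · rintro (a | a | a)
    · show Q (Q (xi a)) = 0
      rw [Q_xi, map_zero]
    · show Q (Q (p a)) = 0
      rw [Q_p, map_zero]
    · show Q (Q (eta a)) = 0
      rw [Q_eta, Q_p]

/-- The change of the canonical coordinates of `T^*[2]T[1]M` under a change of coordinates of `M`: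
`ξ'^i = (∂x'^i/∂x^a) ξ^a`, while `p'_i` and `η'_i` change like the vector fields
`∂/∂x'^i` and `∂/∂ξ'^i` on `T[1]M`. -/
def coord {e e' : Chart n M} (h : e ≤ e') : Idx n → Fn e.dom (deg n) :=
  Sum.elim (fun i => ∑ a, Fn.sc (Chart.jac h i a) * xi a)
    (Sum.elim
      (fun i => ∑ a, (Fn.sc (Chart.jacInv h a i) * p a +
        ∑ b, Fn.sc (Sm.pd b (Chart.jacInv h a i)) * (xi b * eta a)))
      (fun i => ∑ a, Fn.sc (Chart.jacInv h a i) * eta a))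

theorem coord_isHom {e e' : Chart n M} (h : e ≤ e') (i : Idx n) :
    Fn.IsHom (deg n i) (coord h i) := by
  rcases i with i | i | i
  · show Fn.IsHom 1 (∑ a, Fn.sc (Chart.jac h i a) * xi a : Fn e.dom (deg n))
    exact Fn.IsHom.sum fun a => ((Fn.isHom_sc _).mul (isHom_xi a)).congr (zero_add 1)
  · show Fn.IsHom 2 (∑ a, (Fn.sc (Chart.jacInv h a i) * p a +
        ∑ b, Fn.sc (Sm.pd b (Chart.jacInv h a i)) * (xi b * eta a)) : Fn e.dom (deg n))
    exact Fn.IsHom.sum fun a => (((Fn.isHom_sc _).mul (isHom_p a)).congr (zero_add 2)).add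
      (Fn.IsHom.sum fun b =>
        ((Fn.isHom_sc _).mul ((isHom_xi b).mul (isHom_eta a))).congr (zero_add 2))
  · show Fn.IsHom 1 (∑ a, Fn.sc (Chart.jacInv h a i) * eta a : Fn e.dom (deg n))
    exact Fn.IsHom.sum fun a => ((Fn.isHom_sc _).mul (isHom_eta a)).congr (zero_add 1)

theorem coord_xi {e e' : Chart n M} (h : e ≤ e') (i : Fin n) :
    coord h (iXi i) = Q (Fn.sc (Chart.tr h (Sm.crd i))) := by
  rw [Q_sc]
  show (∑ a, Fn.sc (Chart.jac h i a) * xi a : Fn e.dom (deg n)) = _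
  refine Finset.sum_congr rfl fun a _ => ?_
  rw [Fn.sc_mul]; rfl

theorem coord_p {e e' : Chart n M} (h : e ≤ e') (i : Fin n) :
    coord h (iP i) = Q (coord h (iEta i)) := by
  show (∑ a, (Fn.sc (Chart.jacInv h a i) * p a +
    ∑ b, Fn.sc (Sm.pd b (Chart.jacInv h a i)) * (xi b * eta a)) : Fn e.dom (deg n)) =
      Q (∑ a, Fn.sc (Chart.jacInv h a i) * eta a)
  rw [map_sum]
  refine Finset.sum_congr rfl fun a _ => ?_
  rw [Q_mul, Q_eta, Fn.act_sc, Q_sc, add_comm, Finset.sum_mul]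
  congr 1
  refine Finset.sum_congr rfl fun b _ => ?_
  rw [← Fn.sc_mul, mul_assoc]

/-- The coordinate change on functions. -/
def change {e e' : Chart n M} (h : e ≤ e') : Fn e'.dom (deg n) →ₐ[ℝ] Fn e.dom (deg n) :=
  Fn.hom (Fn.sc.comp (Chart.tr h)) (fun _ => Fn.isHom_sc _) (coord h) (coord_isHom h)

theorem change_sc {e e' : Chart n M} (h : e ≤ e') (r : Sm e'.dom) :
    change h (Fn.sc r) = Fn.sc (Chart.tr h r) := Fn.hom_sc _ _ _ _ _
theorem change_gen {e e' : Chart n M} (h : e ≤ e') (i : Idx n) :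
    change h (Fn.gen i) = coord h i := Fn.hom_gen _ _ _ _ _

theorem change_Q {e e' : Chart n M} (h : e ≤ e') (u : Fn e'.dom (deg n)) :
    change h (Q u) = Q (change h u) := by
  refine Fn.der_ext (F := change h) (ε := -1) (D := (change h).toLinearMap.comp Q)
    (D' := Q.comp (change h).toLinearMap) ?_ ?_ ?_ ?_ u
  · intro u v
    simp [Q_mul]
  · intro u v
    simp only [LinearMap.comp_apply, AlgHom.toLinearMap_apply, map_mul, Q_mul]
    rw [show change h (Fn.act (-1) u) = Fn.act (-1) (change h u) from Fn.hom_act _ _ _ _ _ _]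
  · intro r
    simp only [LinearMap.comp_apply, AlgHom.toLinearMap_apply, Q_sc, map_sum, map_mul, change_sc]
    have : ∀ i : Fin n, change h (xi i) * Fn.sc (Chart.tr h (Sm.pd i r)) =
        ∑ a, xi a * Fn.sc (Sm.pd a (Chart.tr h (Sm.crd i)) * Chart.tr h (Sm.pd i r)) := by
      intro i
      rw [show change h (xi i) = _ from change_gen h (iXi i), coord_xi, Q_sc, Finset.sum_mul]
      refine Finset.sum_congr rfl fun a _ => ?_
      rw [mul_assoc, ← map_mul]
    rw [Finset.sum_congr rfl fun i _ => this i, Finset.sum_comm]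
    refine Finset.sum_congr rfl fun a _ => ?_
    rw [← Finset.mul_sum, ← map_sum, Sm.pd_pull]
  · rintro (a | a | a)
    · show change h (Q (xi a)) = Q (change h (xi a))
      rw [Q_xi, show change h (xi a) = _ from change_gen h (iXi a), coord_xi, Q_Q, map_zero]
    · show change h (Q (p a)) = Q (change h (p a))
      rw [Q_p, show change h (p a) = _ from change_gen h (iP a), coord_p, Q_Q, map_zero]
    · show change h (Q (eta a)) = Q (change h (eta a))
      rw [Q_eta, show change h (p a) = _ from change_gen h (iP a), coord_p,
        show change h (eta a) = _ from change_gen h (iEta a)]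

theorem change_coord {e e' e'' : Chart n M} (h : e ≤ e') (h' : e' ≤ e'') (i : Idx n) :
    change h (coord h' i) = coord (h.trans h') i := by
  have heta : ∀ i : Fin n, change h (coord h' (iEta i)) = coord (h.trans h') (iEta i) := by
    intro i
    show change h (∑ a, Fn.sc (Chart.jacInv h' a i) * eta a) =
      ∑ a, Fn.sc (Chart.jacInv (h.trans h') a i) * eta a
    simp only [map_sum, map_mul, change_sc, Chart.jacInv_trans h h', Matrix.mul_apply,
      Finset.sum_mul]
    rw [Finset.sum_comm]
    refine Finset.sum_congr rfl fun a _ => ?_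
    rw [show change h (eta a) = _ from change_gen h (iEta a)]
    show Fn.sc _ * (∑ b, Fn.sc (Chart.jacInv h b a) * eta b) = _
    rw [Finset.mul_sum]
    refine Finset.sum_congr rfl fun k _ => ?_
    rw [← mul_assoc, ← map_mul, ← map_mul, mul_comm]; rfl
  rcases i with i | i | i
  · show change h (coord h' (iXi i)) = coord (h.trans h') (iXi i)
    rw [coord_xi, coord_xi, change_Q, change_sc, Chart.tr_tr]
  · show change h (coord h' (iP i)) = coord (h.trans h') (iP i)
    rw [coord_p, coord_p, change_Q, heta]
  · exact heta i

end Courant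

open Courant

/-- The graded manifold `T^*[2]T[1]M`. -/
def cotangentTwo (n : ℕ) (M : Type u) [TopologicalSpace M] [ChartedSpace (Eu n) M] :
    NMan n M where
  ι := Idx n
  deg := Courant.deg n
  deg_pos := by
    rintro (a | a | a)
    · exact Nat.one_pos
    · exact Nat.two_pos
    · exact Nat.one_pos
  coord := coord
  coord_isHom := coord_isHom
  coord_refl e i := by
    have heta : ∀ i : Fin n, coord (le_refl e) (iEta i) = eta i := by
      intro i
      show ∑ a, Fn.sc (Chart.jacInv (le_refl e) a i) * eta a = _
      rw [Chart.jacInv_refl]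
      simp [Matrix.one_apply, apply_ite, ite_mul]
    rcases i with i | i | i
    · show coord (le_refl e) (iXi i) = xi i
      rw [coord_xi, Chart.tr_refl, Q_sc]
      simp [Sm.pd_crd]
    · show coord (le_refl e) (iP i) = p i
      rw [coord_p, heta, Q_eta]
    · exact heta i
  coord_coord h h' i := change_coord h h' i

/-- The homological vector field of the standard Courant algebroid. -/
def stdQ (n : ℕ) (M : Type u) [TopologicalSpace M] [ChartedSpace (Eu n) M] :
    Op (cotangentTwo n M).space := fun _ => Courant.Q

theorem isHomological_stdQ : IsHomological (cotangentTwo n M).space (stdQ n M) where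
  leibniz _ f g := Q_mul f g
  degree _ s f := act_Q s f
  square _ f := Q_Q f
  res h f := change_Q h f

theorem GradedSpace.Hom.ext_apply {X : GradedSpace.{u, v} n M} {Y : GradedSpace.{u, w} n M}
    {f g : Hom X Y} (h : ∀ e a, f.pb e a = g.pb e a) : f = g := by
  cases f; cases g
  congr
  exact funext fun e => AlgHom.ext (h e)

namespace TangentOne

variable {W : Opens (Eu n)}

/-- `T[1]M` has no other coordinates of positive degree than the `ξ^a = dx^a`. -/
abbrev deg (n : ℕ) : Empty ⊕ (Fin n ⊕ Empty) → ℕ := Fn.tdeg n Empty.elim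

def img : Empty ⊕ (Fin n ⊕ Empty) → Fn W (Courant.deg n) :=
  Sum.elim (fun i => i.elim) (Sum.elim (fun a => xi a) (fun i => i.elim))

theorem isHom_img (i : Empty ⊕ (Fin n ⊕ Empty)) :
    Fn.IsHom (deg n i) (img i : Fn W (Courant.deg n)) := by
  rcases i with i | a | i
  · exact i.elim
  · exact isHom_xi a
  · exact i.elim

/-- The pull-back `q^*` along the projection `q : T^*[2]T[1]M → T[1]M`, in coordinates. -/
def map : Fn W (deg n) →ₐ[ℝ] Fn W (Courant.deg n) := Fn.hom Fn.sc Fn.isHom_sc img isHom_img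

theorem map_sc (r : Sm W) : map (Fn.sc r) = Fn.sc r := Fn.hom_sc _ _ _ _ _
theorem map_dx (a : Fin n) : map (Fn.dx a : Fn W _) = xi a := Fn.hom_gen _ _ _ _ _

theorem map_coord {e e' : Chart n M} (h : e ≤ e') (i : Empty ⊕ (Fin n ⊕ Empty)) :
    map ((T1 n M).coord h i) = change h (img i) := by
  have hs : ∀ r, (baseMan n M).trans h (Fn.sc r) = Fn.sc (Chart.tr h r) :=
    (baseMan n M).trans_sc h
  rcases i with i | a | i
  · exact i.elim
  · refine Eq.trans ?_ ((coord_xi h a).symm.trans (change_gen h (iXi a)).symm)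
    refine (congrArg map (Fn.tmap_dx ((baseMan n M).trans h)
      ((baseMan n M).trans_act h) a)).trans ?_
    refine (congrArg (fun v => map (Fn.d (Fn.inc v))) (hs (Sm.crd a))).trans ?_
    show map (Fn.d (Fn.inc (Fn.sc (Chart.tr h (Sm.crd a)) : Fn e.dom Empty.elim))) = _
    rw [Fn.inc_sc, Fn.d_sc, Q_sc, map_sum]
    refine Finset.sum_congr rfl fun b _ => ?_
    rw [map_mul, map_dx, map_sc]
  · exact i.elim

end TangentOne

/-- The projection `q : T^*[2]T[1]M → T[1]M`, forgetting the momenta `p_a`, `η_a`. -/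
def qProj (n : ℕ) (M : Type u) [TopologicalSpace M] [ChartedSpace (Eu n) M] :
    Hom (cotangentTwo n M).space (T1 n M).space :=
  NMan.mkHom (cotangentTwo n M) (T1 n M) (fun _ => TangentOne.img)
    (fun _ => TangentOne.isHom_img) (fun h i => TangentOne.map_coord h i)

/-! ### The morphism `ω^♭ ∘ L` -/

namespace Legendre

variable {W : Opens (Eu n)}

def img : Fin n ⊕ (Fin n ⊕ Fin n) → Fn W (deg n) :=
  Sum.elim (fun i => eta i) (Sum.elim (fun a => xi a) (fun i => p i))

theorem isHom_img (i : Fin n ⊕ (Fin n ⊕ Fin n)) :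
    Fn.IsHom (Fn.tdeg n (CotangentOne.deg n) i) (img i : Fn W (deg n)) := by
  rcases i with i | a | i
  · exact isHom_eta i
  · exact isHom_xi a
  · exact isHom_p i

def map : Fn W (Fn.tdeg n (CotangentOne.deg n)) →ₐ[ℝ] Fn W (deg n) :=
  Fn.hom Fn.sc Fn.isHom_sc img isHom_img

theorem map_sc (r : Sm W) : map (Fn.sc r) = Fn.sc r := Fn.hom_sc _ _ _ _ _
theorem map_gen (i : Fin n ⊕ (Fin n ⊕ Fin n)) : map (Fn.gen i : Fn W _) = img i :=
  Fn.hom_gen _ _ _ _ _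
theorem map_act (s : ℝ) (u : Fn W (Fn.tdeg n (CotangentOne.deg n))) :
    map (Fn.act s u) = Fn.act s (map u) := Fn.hom_act _ _ _ _ _ _

theorem map_d (u : Fn W (Fn.tdeg n (CotangentOne.deg n))) : map (Fn.d u) = Q (map u) := by
  refine Fn.der_ext (F := map) (ε := -1) (D := map.toLinearMap.comp Fn.d)
    (D' := Q.comp map.toLinearMap) ?_ ?_ ?_ ?_ u
  · intro u v
    simp [Fn.d_mul]
  · intro u v
    simp only [LinearMap.comp_apply, AlgHom.toLinearMap_apply, map_mul, Q_mul, map_act]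
  · intro r
    simp only [LinearMap.comp_apply, AlgHom.toLinearMap_apply, Fn.d_sc, map_sum, map_mul, map_sc,
      Q_sc]
    exact Finset.sum_congr rfl fun a _ => congrArg (· * _) (map_gen (Sum.inr (Sum.inl a)))
  · rintro (i | a | i)
    · show map (Fn.d (Fn.gen (Sum.inl i))) = Q (map (Fn.gen (Sum.inl i)))
      rw [Fn.d_gen_inl, map_gen]
      exact (map_gen (Sum.inr (Sum.inr i))).trans (Q_eta i).symm
    · show map (Fn.d (Fn.dx a)) = Q (map (Fn.gen (Sum.inr (Sum.inl a))))
      rw [Fn.d_dx, map_gen, map_zero]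
      exact (Q_xi a).symm
    · show map (Fn.d (Fn.dz i)) = Q (map (Fn.gen (Sum.inr (Sum.inr i))))
      rw [Fn.d_dz, map_gen, map_zero]
      exact (Q_p i).symm

theorem map_inc_coord {e e' : Chart n M} (h : e ≤ e') (i : Fin n) :
    map (Fn.inc (CotangentOne.coord h i)) = coord h (iEta i) := by
  show _ = (∑ a, Fn.sc (Chart.jacInv h a i) * eta a : Fn e.dom (deg n))
  simp only [CotangentOne.coord, map_sum, map_mul, Fn.inc_sc, Fn.inc_gen, map_sc, map_gen]
  rfl

theorem map_coord {e e' : Chart n M} (h : e ≤ e') (i : Fin n ⊕ (Fin n ⊕ Fin n)) :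
    map ((cotangentOne n M).T.coord h i) = change h (img i) := by
  have hg : ∀ i, (cotangentOne n M).trans h (Fn.gen i) = CotangentOne.coord h i :=
    (cotangentOne n M).trans_gen h
  have hs : ∀ r, (cotangentOne n M).trans h (Fn.sc r) = Fn.sc (Chart.tr h r) :=
    (cotangentOne n M).trans_sc h
  rcases i with i | a | i
  · refine Eq.trans ?_ (change_gen h (iEta i)).symm
    refine (congrArg map (Fn.tmap_inl ((cotangentOne n M).trans h)
      ((cotangentOne n M).trans_act h) i)).trans ?_
    refine (congrArg (fun v => map (Fn.inc v)) (hg i)).trans (map_inc_coord h i)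
  · refine Eq.trans ?_ ((coord_xi h a).symm.trans (change_gen h (iXi a)).symm)
    refine (congrArg map (Fn.tmap_dx ((cotangentOne n M).trans h)
      ((cotangentOne n M).trans_act h) a)).trans ?_
    refine (congrArg (fun v => map (Fn.d (Fn.inc v))) (hs (Sm.crd a))).trans ?_
    refine (map_d _).trans (congrArg Q ?_)
    exact (congrArg map (Fn.inc_sc (Chart.tr h (Sm.crd a)))).trans (map_sc _)
  · refine Eq.trans ?_ ((coord_p h i).symm.trans (change_gen h (iP i)).symm)
    refine (congrArg map (Fn.tmap_dz ((cotangentOne n M).trans h)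
      ((cotangentOne n M).trans_act h) i)).trans ?_
    refine (congrArg (fun v => map (Fn.d (Fn.inc v))) (hg i)).trans ?_
    exact (map_d _).trans (congrArg Q (map_inc_coord h i))

def imgInv : Idx n → Fn W (Fn.tdeg n (CotangentOne.deg n)) :=
  Sum.elim (fun a => Fn.dx a) (Sum.elim (fun i => Fn.dz i) (fun i => Fn.gen (Sum.inl i)))

theorem isHom_imgInv (i : Idx n) :
    Fn.IsHom (deg n i) (imgInv i : Fn W (Fn.tdeg n (CotangentOne.deg n))) := by
  rcases i with a | i | i
  · exact Fn.isHom_gen (Sum.inr (Sum.inl a))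
  · exact Fn.isHom_gen (Sum.inr (Sum.inr i))
  · exact Fn.isHom_gen (Sum.inl i)

def mapInv : Fn W (deg n) →ₐ[ℝ] Fn W (Fn.tdeg n (CotangentOne.deg n)) :=
  Fn.hom Fn.sc Fn.isHom_sc imgInv isHom_imgInv

theorem mapInv_sc (r : Sm W) : mapInv (Fn.sc r) = Fn.sc r := Fn.hom_sc _ _ _ _ _
theorem mapInv_gen (i : Idx n) : mapInv (Fn.gen i : Fn W _) = imgInv i := Fn.hom_gen _ _ _ _ _

theorem map_mapInv (u : Fn W (deg n)) : map (mapInv u) = u := by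
  refine Fn.algHom_ext (F := map.comp mapInv) (G := AlgHom.id ℝ _) (fun r => ?_) (fun i => ?_) u
  · simp only [AlgHom.comp_apply, mapInv_sc, map_sc, AlgHom.id_apply]
  · simp only [AlgHom.comp_apply, mapInv_gen, AlgHom.id_apply]
    rcases i with a | i | i
    · exact map_gen (Sum.inr (Sum.inl a))
    · exact map_gen (Sum.inr (Sum.inr i))
    · exact map_gen (Sum.inl i)

theorem mapInv_map (u : Fn W (Fn.tdeg n (CotangentOne.deg n))) : mapInv (map u) = u := by
  refine Fn.algHom_ext (F := mapInv.comp map) (G := AlgHom.id ℝ _) (fun r => ?_) (fun i => ?_) u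
  · simp only [AlgHom.comp_apply, mapInv_sc, map_sc, AlgHom.id_apply]
  · simp only [AlgHom.comp_apply, map_gen, AlgHom.id_apply]
    rcases i with i | a | i
    · exact mapInv_gen (iEta i)
    · exact mapInv_gen (iXi a)
    · exact mapInv_gen (iP i)

end Legendre

/-- The canonical isomorphism `Φ = ω^♭ ∘ L : T^*[2]T[1]M → T^*[2]T^*[1]M → T[1]T^*[1]M`, the
composition of the Legendre transform and of the map given by the canonical symplectic structure
of `T^*[1]M`. In canonical coordinates, a point `(x, ξ, p, η)` is mapped to the point of
`T[1]T^*[1]M` over `(x, η)` with `dx^a = ξ^a` and `dη_a = p_a`. -/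
def legendre (n : ℕ) (M : Type u) [TopologicalSpace M] [ChartedSpace (Eu n) M] :
    Hom (cotangentTwo n M).space (cotangentOne n M).T.space :=
  NMan.mkHom (cotangentTwo n M) (cotangentOne n M).T (fun _ => Legendre.img)
    (fun _ => Legendre.isHom_img) (fun h i => Legendre.map_coord h i)

theorem legendre_isNQ : (legendre n M).IsNQ (stdQ n M) (cotangentOne n M).dR :=
  fun _ u => Legendre.map_d u

theorem Legendre.mapInv_coord {e e' : Chart n M} (h : e ≤ e') (i : Idx n) :
    Legendre.mapInv (coord h i) = (cotangentOne n M).T.trans h (Legendre.imgInv i) := by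
  have h1 : Legendre.map ((cotangentOne n M).T.trans h (Legendre.imgInv i)) =
      change h (Legendre.map (Legendre.imgInv i)) := (legendre n M).pb_res h _
  have h2 : Legendre.map (Legendre.imgInv i) = (Fn.gen i : Fn e'.dom (deg n)) := by
    rw [← Legendre.mapInv_gen, Legendre.map_mapInv]
  have h3 := h1.trans ((congrArg (change h) h2).trans (change_gen h i))
  exact (congrArg Legendre.mapInv h3).symm.trans (Legendre.mapInv_map _)

theorem exists_legendre_isInverse :
    ∃ g : Hom (cotangentOne n M).T.space (cotangentTwo n M).space,
      (legendre n M).IsInverse g :=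
  ⟨NMan.mkHom (cotangentOne n M).T (cotangentTwo n M) (fun _ => Legendre.imgInv)
    (fun _ => Legendre.isHom_imgInv) (fun h i => Legendre.mapInv_coord h i),
    Hom.ext_apply fun _ u => Legendre.map_mapInv u,
    Hom.ext_apply fun _ u => Legendre.mapInv_map u⟩

/-- The projection `s : T[1]T^*[1]M → T^*[1]M`. -/
abbrev sProj (n : ℕ) (M : Type u) [TopologicalSpace M] [ChartedSpace (Eu n) M] :
    Hom (cotangentOne n M).T.space (cotangentOne n M).space :=
  (cotangentOne n M).proj

/-- The `NQ`-morphism `f' : (X, Q_X) → (T[1]Z, Q_dR)` corresponds to the morphism `f : X → Z` of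
graded manifolds under the adjunction between the forgetful functor and `T[1]`, that is,
`f = q_Z ∘ f'` for the projection `q_Z : T[1]Z → Z`. -/
def Corresponds {X : GradedSpace.{u, v} n M} (QX : Op X) (Z : NMan n M) (f' : Hom X Z.T.space)
    (f : Hom X Z.space) : Prop :=
  f'.IsNQ QX Z.dR ∧ Z.proj.comp f' = f

/-! ### The Poisson bracket and the twisted Courant algebroid -/

namespace Courant

variable {W : Opens (Eu n)}

/-- The Poisson bracket `{f, ·}` of degree `-2` of the symplectic form
`ω = dp_a dx^a + dη_a dξ^a`, with `{p_a, x^b} = δ_a^b = {η_a, ξ^b}`: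
`{f, g} = (∂f/∂p_a)(∂g/∂x^a) - (∂f/∂x^a)(∂g/∂p_a)
  + (-1)^{|f|+1} ((∂f/∂η_a)(∂g/∂ξ^a) + (∂f/∂ξ^a)(∂g/∂η_a))`. -/
def bracket (f : Fn W (deg n)) : Fn W (deg n) →ₗ[ℝ] Fn W (deg n) :=
  ∑ a, ((LinearMap.mulLeft ℝ (Fn.pdz (iP a) f)).comp (Fn.pdx a) -
    (LinearMap.mulLeft ℝ (Fn.pdx a f)).comp (Fn.pdz (iP a)) +
    (LinearMap.mulLeft ℝ (Fn.act (-1) (Fn.pdz (iEta a) f))).comp (Fn.pdz (iXi a)) +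
    (LinearMap.mulLeft ℝ (Fn.act (-1) (Fn.pdz (iXi a) f))).comp (Fn.pdz (iEta a)))

end Courant

/-- The expression in a chart `e` of a field of alternating 3-forms on `M`. -/
def formLoc (κ : ∀ x : M, TangentSpace (𝓡 n) x [⋀^Fin 3]→L[ℝ] ℝ) (e : Chart n M) (y : Eu n) :
    Eu n [⋀^Fin 3]→L[ℝ] ℝ :=
  (κ (e.1.symm y)).compContinuousLinearMap (mfderiv (𝓡 n) (𝓡 n) e.1.symm y)

/-- A closed smooth 3-form on `M`. -/
structure ClosedThreeForm (n : ℕ) (M : Type u) [TopologicalSpace M] [ChartedSpace (Eu n) M] where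
  toFun : ∀ x : M, TangentSpace (𝓡 n) x [⋀^Fin 3]→L[ℝ] ℝ
  smooth : ∀ e : Chart n M, ContDiffOn ℝ ∞ (formLoc toFun e) e.1.target
  closed : ∀ (e : Chart n M), ∀ y ∈ e.1.target, extDeriv (formLoc toFun e) y = 0

namespace ClosedThreeForm

variable (κ : ClosedThreeForm n M)

/-- The components `κ(∂_a, ∂_b, ∂_c)` in a chart. -/
def comp (e : Chart n M) (a b c : Fin n) : Sm e.dom :=
  Sm.mk (fun y => formLoc κ.toFun e y ![EuclideanSpace.single a 1, EuclideanSpace.single b 1,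
    EuclideanSpace.single c 1]) (by
      have h : ContDiff ℝ ∞ fun φ : Eu n [⋀^Fin 3]→L[ℝ] ℝ =>
          φ ![EuclideanSpace.single a 1, EuclideanSpace.single b 1, EuclideanSpace.single c 1] :=
        (ContinuousAlternatingMap.apply ℝ (Eu n) ℝ
          ![EuclideanSpace.single a 1, EuclideanSpace.single b 1,
            EuclideanSpace.single c 1]).contDiff
      exact h.comp_contDiffOn (κ.smooth e))

/-- The 3-form as a function of degree `3` on `T[1]M`:
`κ = (1/3!) κ(∂_a, ∂_b, ∂_c) dx^a dx^b dx^c`. -/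
def fn (e : Chart n M) : Fn e.dom (T1 n M).deg :=
  (1 / 6 : ℝ) • ∑ a, ∑ b, ∑ c,
    Fn.sc (κ.comp e a b c) * (Fn.dx a * Fn.dx b * Fn.dx c : Fn e.dom (T1 n M).deg)

/-- `Q_κ = Q + {q^*κ, ·}`. -/
def twistQ : Op (cotangentTwo n M).space := fun e =>
  (Courant.Q : Fn e.dom (Courant.deg n) →ₗ[ℝ] Fn e.dom (Courant.deg n)) +
    bracket ((qProj n M).pb e (κ.fn e))

/-- The pull-back `q_M^*κ` along `q_M : T[1]M → M`, a 3-form on `T[1]M`. -/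
def pullForm (e : Chart n M) : Fn e.dom (T1 n M).T.deg :=
  Fn.tmap ((baseMan n M).proj.pb e) ((baseMan n M).proj.pb_act e) (κ.fn e)

/-- The 1-form `½ ι_{Q_dR} ι_{Q_dR} q_M^*κ` of degree `2` on `T[1]M`. -/
def contracted (e : Chart n M) : Fn e.dom (T1 n M).T.deg :=
  (1 / 2 : ℝ) • Fn.contract ((baseMan n M).dR e) (Fn.contract ((baseMan n M).dR e) (κ.pullForm e))

end ClosedThreeForm

/-- `ψ` is the translation along the fibres of `q : T^*[2]T[1]M → T[1]M` by the 1-form `α` on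
`T[1]M`: if `α = A_a dx^a + B_a dξ^a` with functions `A_a`, `B_a` on `T[1]M`, then `q ∘ ψ = q`,
`ψ^* p_a = p_a + q^* A_a` and `ψ^* η_a = η_a + q^* B_a`. -/
def IsFibreTranslation (ψ : Hom (cotangentTwo n M).space (cotangentTwo n M).space)
    (α : ∀ e : Chart n M, Fn e.dom (T1 n M).T.deg) : Prop :=
  (qProj n M).comp ψ = qProj n M ∧
  ∀ e : Chart n M, ∃ A B : Fin n → Fn e.dom (T1 n M).deg,
    α e = ∑ a, Fn.inc (A a) * Fn.dx a + ∑ a, Fn.inc (B a) * Fn.dz (Sum.inr (Sum.inl a)) ∧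
    ∀ a, ψ.pb e (p a : Fn e.dom (Courant.deg n)) =
        p a + TangentOne.map (A a) ∧
      ψ.pb e (eta a : Fn e.dom (Courant.deg n)) =
        eta a + TangentOne.map (B a)

/-- `(Y, Q_Y, ω_Y)`, with `ω_Y` given by its Poisson bracket, is an exact Courant algebroid over `M`:
it is isomorphic to `(T^*[2]T[1]M, Q_κ, ω)` for a closed 3-form `κ`. -/
def IsExactCourant (Y : GradedSpace.{u, v} n M) (QY : Op Y)
    (bracketY : ∀ e, Y.Fun e → Y.Fun e → Y.Fun e) : Prop :=
  ∃ (κ : ClosedThreeForm n M) (f : Hom (cotangentTwo n M).space Y)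
    (g : Hom Y (cotangentTwo n M).space), f.IsInverse g ∧
    f.IsNQ κ.twistQ QY ∧ g.IsNQ QY κ.twistQ ∧
    ∀ (e : Chart n M) (a b : Fn e.dom (Courant.deg n)),
      g.pb e (bracket a b : Fn e.dom (Courant.deg n)) = bracketY e (g.pb e a) (g.pb e b)

end Manifolds

end GradedGeometry

end

open GradedGeometry GradedGeometry.GradedSpace

/-!
In a chart, `k = κ` is a cubic function of the `ξ^a` on `T[1]M`, and the Hamiltonian vector field of
`q^*k` is `(∂k/∂ξ^a) ∂/∂η_a - (∂k/∂x^a) ∂/∂p_a` (`bracket_map`). That `κ` is closed means that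
`Q_dR k = 0` (`d_cubic`, `pd_comp_skew`), and applying `∂/∂ξ^a` gives
`Q_dR (∂k/∂ξ^a) = ∂k/∂x^a` (`IsClosedCubic.d_pdxi`). This is exactly the vanishing of `Q_κ²` on `η_a`
(`IsClosedCubic.twist_twist`).

A morphism `ψ` over `M` with `ψ^*η_a = η_a` for which `Φ ∘ ψ` intertwines `Q_κ` and `Q_dR` must
satisfy `ψ^*ξ^a = Q_κ x^a = ξ^a` and `ψ^*p_a = Q_κ η_a = p_a + ∂k/∂ξ^a` (`corresponds_iff`).
Conversely these formulas define a map intertwining `Q` and `Q_κ` (`fibreTranslate_Q`), with the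
inverse `p_a ↦ p_a - ∂k/∂ξ^a`. As `ι_{Q_dR}` replaces each `dx^a` by `ξ^a`, the form
`½ ι_{Q_dR} ι_{Q_dR} q_M^*κ` is `(∂k/∂ξ^a) dx^a` (`contracted_eq`).

Compatibility with changes of coordinates rests on the tensor law for `κ` (`comp_eq_sum`) and the
chain rule for `∂/∂ξ^a` (`pdxi_T1trans`). They show that `Q_κ` transforms correctly on `x^a`, `ξ^a`
and `η_a`; for `p_a = Q_κ η_a - ∂k/∂ξ^a` this then follows from `Q_κ² = 0` (`change_twist`), and the
compatibility of `ψ` follows from that of `Q_κ`. The last claim is a composition of isomorphisms.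
-/

namespace GradedGeometry

/-! ### Derivations of graded domains -/

namespace Fn

variable {n : ℕ} {ι : Type} {W : Opens (Eu n)} {deg : ι → ℕ}

theorem IsHom.smul {k : ℕ} {u : Fn W deg} (c : ℝ) (hu : IsHom k u) : IsHom k (c • u) := fun s => by
  rw [map_smul, hu s, smul_comm]

theorem IsHom.neg {k : ℕ} {u : Fn W deg} (hu : IsHom k u) : IsHom k (-u) := by
  simpa using hu.smul (-1)

theorem act_pdx (s : ℝ) (a : Fin n) (u : Fn W deg) : act s (pdx a u) = pdx a (act s u) := by
  refine der_ext (F := act s) (ε := 1) (D := (act s).toLinearMap.comp (pdx a))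
    (D' := (pdx a).comp (act s).toLinearMap) ?_ ?_ ?_ ?_ u
  · intro u v
    simp [pdx_mul, act_one]
  · intro u v
    simp [pdx_mul, act_one]
  · intro r
    simp [pdx_sc, act_sc]
  · intro i
    simp [pdx_gen, act_gen]

theorem IsHom.pdx {k : ℕ} {u : Fn W deg} (hu : IsHom k u) (a : Fin n) : IsHom k (pdx a u) :=
  fun s => by rw [act_pdx, hu s, map_smul]

theorem pdx_comm (a b : Fin n) (u : Fn W deg) : pdx a (pdx b u) = pdx b (pdx a u) := by
  induction u using induction with
  | h0 r => simp only [pdx_sc, Sm.pd_comm a b]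
  | h1 i => simp only [pdx_gen, map_zero]
  | hm u v hu hv => simp only [pdx_mul, map_add, hu, hv]; abel
  | ha u v hu hv => simp only [map_add, hu, hv]

theorem dx_anticomm (a b : Fin n) : (dx b * dx a : Fn W (tdeg n deg)) = -(dx a * dx b) := by
  rw [dx, dx, gen_mul_gen]
  simp only [tdeg, Sum.elim_inl, Sum.elim_inr, mul_one, pow_one]
  exact neg_one_smul ℝ _

theorem act_neg_one_dx (a : Fin n) : act (-1) (dx a : Fn W (tdeg n deg)) = -dx a := by
  rw [dx, act_gen]
  simp only [tdeg, Sum.elim_inl, Sum.elim_inr, pow_one]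
  exact neg_one_smul ℝ _

theorem pdz_dx [DecidableEq (Fin n)] (a b : Fin n) :
    pdz (Sum.inr (Sum.inl a)) (dx b : Fn W (tdeg n deg)) = if b = a then 1 else 0 := by
  classical
  rw [dx, pdz_gen]
  simp

theorem pdz_dx_mul (a : Fin n) (u v : Fn W (tdeg n deg)) :
    pdz (Sum.inr (Sum.inl a)) (u * v) =
      pdz (Sum.inr (Sum.inl a)) u * v + act (-1) u * pdz (Sum.inr (Sum.inl a)) v := by
  have h := pdz_mul (Sum.inr (Sum.inl a)) u v
  rwa [show tdeg n deg (Sum.inr (Sum.inl a)) = 1 from rfl, pow_one] at h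

end Fn

/-! ### Functions on `T[1]M` in a chart -/

namespace TangentOne

variable {n : ℕ} {W W' : Opens (Eu n)}

/-- The derivative `∂/∂ξ^a` of functions on `T[1]M`. -/
noncomputable abbrev pdxi (a : Fin n) : Fn W (deg n) →ₗ[ℝ] Fn W (deg n) :=
  Fn.pdz (Sum.inr (Sum.inl a))

theorem d_eq (u : Fn W (deg n)) : Fn.d u = ∑ a, Fn.dx a * Fn.pdx a u := by
  rw [Fn.d_apply, Finset.univ_eq_empty (α := Empty), Finset.sum_empty, add_zero]

theorem map_act (s : ℝ) (u : Fn W (deg n)) : map (Fn.act s u) = Fn.act s (map u) :=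
  Fn.hom_act _ _ _ _ _ _

theorem isHom_map {k : ℕ} {u : Fn W (deg n)} (hu : Fn.IsHom k u) : Fn.IsHom k (map u) :=
  fun s => by
  rw [← map_act, hu s, map_smul]

theorem map_pdx (a : Fin n) (u : Fn W (deg n)) : map (Fn.pdx a u) = Fn.pdx a (map u) := by
  refine Fn.der_ext (F := map) (ε := 1) (D := map.toLinearMap.comp (Fn.pdx a))
    (D' := (Fn.pdx a).comp map.toLinearMap) ?_ ?_ ?_ ?_ u
  · intro u v
    simp [Fn.pdx_mul, Fn.act_one]
  · intro u v
    simp [Fn.pdx_mul, Fn.act_one]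
  · intro r
    simp [Fn.pdx_sc, map_sc]
  · rintro (i | b | i)
    · exact i.elim
    · show map (Fn.pdx a (Fn.gen _)) = Fn.pdx a (map (Fn.dx b))
      rw [map_dx, Fn.pdx_gen, map_zero, Courant.xi, Fn.pdx_gen]
    · exact i.elim

theorem map_pdxi (a : Fin n) (u : Fn W (deg n)) :
    map (pdxi a u) = Fn.pdz (Courant.iXi a) (map u) := by
  classical
  refine Fn.der_ext (F := map) (ε := -1) (D := map.toLinearMap.comp (pdxi a))
    (D' := (Fn.pdz (Courant.iXi a)).comp map.toLinearMap) ?_ ?_ ?_ ?_ u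
  · intro u v
    simp [Fn.pdz_dx_mul]
  · intro u v
    have h := Fn.pdz_mul (Courant.iXi a) (map u) (map v)
    rw [show Courant.deg n (Courant.iXi a) = 1 from rfl, pow_one, ← map_mul, ← map_act] at h
    exact h
  · intro r
    simp [Fn.pdz_sc, map_sc]
  · rintro (i | b | i)
    · exact i.elim
    · show map (pdxi a (Fn.dx b)) = Fn.pdz _ (map (Fn.dx b))
      rw [map_dx, Fn.pdz_dx, Courant.xi, Fn.pdz_gen]
      by_cases h : b = a <;> simp [h]
    · exact i.elim

theorem pdz_p_map (a : Fin n) (u : Fn W (deg n)) : Fn.pdz (Courant.iP a) (map u) = 0 := by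
  induction u using Fn.induction with
  | h0 r => rw [map_sc, Fn.pdz_sc]
  | h1 i =>
    rcases i with i | b | i
    · exact i.elim
    · show Fn.pdz _ (map (Fn.dx b)) = 0
      rw [map_dx, Courant.xi, Fn.pdz_gen, if_neg (by simp)]
    · exact i.elim
  | hm u v hu hv => rw [map_mul, Fn.pdz_mul, hu, hv, zero_mul, mul_zero, add_zero]
  | ha u v hu hv => rw [map_add, map_add, hu, hv, add_zero]

theorem pdz_eta_map (a : Fin n) (u : Fn W (deg n)) : Fn.pdz (Courant.iEta a) (map u) = 0 := by
  induction u using Fn.induction with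
  | h0 r => rw [map_sc, Fn.pdz_sc]
  | h1 i =>
    rcases i with i | b | i
    · exact i.elim
    · show Fn.pdz _ (map (Fn.dx b)) = 0
      rw [map_dx, Courant.xi, Fn.pdz_gen, if_neg (by simp)]
    · exact i.elim
  | hm u v hu hv => rw [map_mul, Fn.pdz_mul, hu, hv, zero_mul, mul_zero, add_zero]
  | ha u v hu hv => rw [map_add, map_add, hu, hv, add_zero]

theorem map_d (u : Fn W (deg n)) : map (Fn.d u) = Courant.Q (map u) := by
  rw [d_eq, Courant.Q_apply, map_sum]
  refine Finset.sum_congr rfl fun a _ => ?_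
  rw [map_mul, map_dx, map_pdx, pdz_eta_map, mul_zero, add_zero]

theorem pdxi_pdx (a b : Fin n) (u : Fn W (deg n)) : pdxi a (Fn.pdx b u) = Fn.pdx b (pdxi a u) := by
  classical
  refine Fn.der_ext (F := AlgHom.id ℝ _) (ε := -1)
    (D := (pdxi a).comp (Fn.pdx b) - (Fn.pdx b).comp (pdxi a))
    (D' := 0) ?_ ?_ ?_ ?_ u |> sub_eq_zero.1
  · intro u v
    simp only [LinearMap.sub_apply, LinearMap.comp_apply, AlgHom.id_apply, Fn.pdz_dx_mul,
      Fn.pdx_mul, map_add, sub_mul, mul_sub, Fn.act_pdx]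
    abel
  · simp
  · intro r
    simp [Fn.pdx_sc, Fn.pdz_sc]
  · rintro (i | c | i)
    · exact i.elim
    · show pdxi a (Fn.pdx b (Fn.gen _)) - Fn.pdx b (pdxi a (Fn.dx c)) = 0
      rw [Fn.pdx_gen, Fn.pdz_dx, map_zero, zero_sub, neg_eq_zero]
      have h1 : Fn.pdx b (1 : Fn W (deg n)) = 0 := by
        rw [← map_one Fn.sc, Fn.pdx_sc, (Sm.pd b).map_one_eq_zero, map_zero]
      split_ifs
      · exact h1
      · exact map_zero _
    · exact i.elim

/-- Cartan's formula `[∂/∂ξ^a, Q_dR] = ∂/∂x^a`. -/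
theorem pdxi_d (a : Fin n) (u : Fn W (deg n)) :
    pdxi a (Fn.d u) = Fn.pdx a u - Fn.d (pdxi a u) := by
  classical
  simp only [d_eq, map_sum]
  have h : ∀ b : Fin n, pdxi a (Fn.dx b * Fn.pdx b u) =
      (if b = a then 1 else 0) * Fn.pdx b u - Fn.dx b * Fn.pdx b (pdxi a u) := by
    intro b
    rw [Fn.pdz_dx_mul, Fn.pdz_dx, Fn.act_neg_one_dx, pdxi_pdx, neg_mul, sub_eq_add_neg]
  rw [Finset.sum_congr rfl fun b _ => h b, Finset.sum_sub_distrib]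
  simp

theorem d_pdx (a : Fin n) (u : Fn W (deg n)) : Fn.d (Fn.pdx a u) = Fn.pdx a (Fn.d u) := by
  simp only [d_eq, map_sum]
  refine Finset.sum_congr rfl fun b _ => ?_
  rw [Fn.pdx_mul, Fn.dx, Fn.pdx_gen, zero_mul, zero_add, Fn.pdx_comm]

/-! ### Three-forms in a chart -/

/-- The function `(1/3!) c_{abc} ξ^a ξ^b ξ^c` on `T[1]M`. -/
noncomputable def cubic (c : Fin n → Fin n → Fin n → Sm W) : Fn W (deg n) :=
  (1 / 6 : ℝ) • ∑ i, ∑ j, ∑ k, Fn.sc (c i j k) * (Fn.dx i * Fn.dx j * Fn.dx k : Fn W (deg n))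

/-- The function `½ c_{abc} ξ^b ξ^c` on `T[1]M`. -/
noncomputable def quadratic (c : Fin n → Fin n → Fin n → Sm W) (a : Fin n) : Fn W (deg n) :=
  (1 / 2 : ℝ) • ∑ j, ∑ k, Fn.sc (c a j k) * (Fn.dx j * Fn.dx k : Fn W (deg n))

theorem isHom_dx (a : Fin n) : Fn.IsHom 1 (Fn.dx a : Fn W (deg n)) :=
  Fn.isHom_gen (Sum.inr (Sum.inl a))

theorem isHom_cubic (c : Fin n → Fin n → Fin n → Sm W) : Fn.IsHom 3 (cubic c) :=
  Fn.IsHom.smul _ <| Fn.IsHom.sum fun i => Fn.IsHom.sum fun j => Fn.IsHom.sum fun k =>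
    (Fn.isHom_sc _).mul (((isHom_dx i).mul (isHom_dx j)).mul (isHom_dx k)) |>.congr rfl

theorem isHom_quadratic (c : Fin n → Fin n → Fin n → Sm W) (a : Fin n) :
    Fn.IsHom 2 (quadratic c a) :=
  Fn.IsHom.smul _ <| Fn.IsHom.sum fun j => Fn.IsHom.sum fun k =>
    (Fn.isHom_sc _).mul ((isHom_dx j).mul (isHom_dx k)) |>.congr rfl

theorem pdxi_cubic {c : Fin n → Fin n → Fin n → Sm W} (h₁ : ∀ i j k, c j i k = -c i j k)
    (h₂ : ∀ i j k, c i k j = -c i j k) (a : Fin n) : pdxi a (cubic c) = quadratic c a := by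
  classical
  have h : ∀ i j k : Fin n,
      pdxi a (Fn.sc (c i j k) * (Fn.dx i * Fn.dx j * Fn.dx k : Fn W (deg n))) =
        (if i = a then Fn.sc (c i j k) * (Fn.dx j * Fn.dx k) else 0) -
        (if j = a then Fn.sc (c i j k) * (Fn.dx i * Fn.dx k) else 0) +
        (if k = a then Fn.sc (c i j k) * (Fn.dx i * Fn.dx j) else 0) := by
    intro i j k
    simp only [Fn.pdz_dx_mul, Fn.pdz_sc, Fn.act_sc, Fn.pdz_dx, map_mul, Fn.act_neg_one_dx]
    split_ifs <;> noncomm_ring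
  have e₂ : ∀ i k, c i a k = -c a i k := fun i k => h₁ a i k
  have e₃ : ∀ i j, c i j a = c a i j := fun i j => by rw [h₂ i a j, h₁ a i j, neg_neg]
  simp only [cubic, quadratic, map_smul, map_sum, h, Finset.sum_add_distrib,
    Finset.sum_sub_distrib, Finset.sum_ite_irrel, Finset.sum_const_zero, Finset.sum_ite_eq',
    Finset.mem_univ, if_true, e₂, e₃, map_neg, neg_mul, Finset.sum_neg_distrib]
  module

theorem sum_rotate {A : Type*} [AddCommMonoid A] (f : Fin n → Fin n → Fin n → A) :
    ∑ i, ∑ j, ∑ k, f k i j = ∑ i, ∑ j, ∑ k, f i j k :=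
  (Finset.sum_congr rfl fun _ _ => Finset.sum_comm).trans Finset.sum_comm

theorem dx_swap (a b : Fin n) (u : Fn W (deg n)) :
    Fn.dx b * (Fn.dx a * u) = -(Fn.dx a * (Fn.dx b * u)) := by
  rw [← mul_assoc, Fn.dx_anticomm, neg_mul, mul_assoc]

/-- Only the skew-symmetrization of the derivatives `∂_l c_{ijk}` contributes to the differential. -/
theorem d_cubic {c : Fin n → Fin n → Fin n → Sm W}
    (h : ∀ l i j k, Sm.pd l (c i j k) - Sm.pd i (c l j k) + Sm.pd j (c l i k) -
      Sm.pd k (c l i j) = 0) : Fn.d (cubic c) = 0 := by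
  set w : Fin n → Fin n → Fin n → Fin n → Fn W (deg n) :=
    fun l i j k => Fn.dx l * (Fn.dx i * (Fn.dx j * Fn.dx k)) with hw
  set F : Fin n → Fin n → Fin n → Fin n → Fn W (deg n) :=
    fun l i j k => Fn.sc (Sm.pd l (c i j k)) * w l i j k with hF
  have hd : Fn.d (cubic c) = (1 / 6 : ℝ) • ∑ l, ∑ i, ∑ j, ∑ k, F l i j k := by
    rw [d_eq, Finset.smul_sum]
    refine Finset.sum_congr rfl fun l _ => ?_
    simp only [cubic, map_smul, mul_smul_comm, map_sum, Finset.mul_sum]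
    congr 1
    refine Finset.sum_congr rfl fun i _ => Finset.sum_congr rfl fun j _ =>
      Finset.sum_congr rfl fun k _ => ?_
    simp only [Fn.pdx_mul, Fn.pdx_sc, Fn.dx, Fn.pdx_gen, zero_mul, mul_zero, add_zero, hF, hw]
    rw [← mul_assoc, ← Fn.sc_mul, mul_assoc, mul_assoc (Fn.gen _)]
  have h₁ : ∀ l i j k, w l i j k = -w i l j k := fun l i j k => dx_swap _ _ _
  have h₂ : ∀ l i j k, w l i j k = -w l j i k := fun l i j k =>
    (congrArg (Fn.dx l * ·) (dx_swap _ _ _)).trans (mul_neg _ _)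
  have h₃ : ∀ l i j k, w l i j k = -w l i k j := fun l i j k => by
    simp only [hw]
    rw [Fn.dx_anticomm k j, mul_neg, mul_neg]
  have e : ∀ l i j k, F l i j k + F i l j k + F j l i k + F k l i j = 0 := by
    intro l i j k
    have t₁ : w i l j k = -w l i j k := h₁ _ _ _ _
    have t₂ : w j l i k = w l i j k := by rw [h₁ j, h₂ l j, neg_neg]
    have t₃ : w k l i j = -w l i j k := by rw [h₁ k, h₂ l k, h₃ l i k, neg_neg]
    have := congrArg (fun r : Sm W => Fn.sc r * w l i j k) (h l i j k)
    simp only [map_sub, map_add, map_zero, sub_mul, add_mul, zero_mul] at this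
    simp only [hF, t₁, t₂, t₃, mul_neg]
    rw [← this]
    abel
  -- All four terms of the skew-symmetrized derivative have the same sum.
  have s₁ : ∑ l, ∑ i, ∑ j, ∑ k, F i l j k = ∑ l, ∑ i, ∑ j, ∑ k, F l i j k := Finset.sum_comm
  have s₂ : ∑ l, ∑ i, ∑ j, ∑ k, F j l i k = ∑ l, ∑ i, ∑ j, ∑ k, F l i j k :=
    sum_rotate fun l i j => ∑ k, F l i j k
  have s₃ : ∑ l, ∑ i, ∑ j, ∑ k, F k l i j = ∑ l, ∑ i, ∑ j, ∑ k, F l i j k :=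
    (Finset.sum_congr rfl fun l _ => sum_rotate fun k i j => F k l i j).trans Finset.sum_comm
  have h4 : (4 : ℝ) • ∑ l, ∑ i, ∑ j, ∑ k, F l i j k = 0 := by
    have : ∑ l, ∑ i, ∑ j, ∑ k, (F l i j k + F i l j k + F j l i k + F k l i j) = 0 := by
      simp only [e, Finset.sum_const_zero]
    simp only [Finset.sum_add_distrib, s₁, s₂, s₃] at this
    rw [← this]
    module
  rw [hd, (smul_eq_zero.1 h4).resolve_left four_ne_zero, smul_zero]

/-! ### The double contraction with the de Rham vector field -/

/-- The contraction `ι_{Q_dR}` of differential forms on `T[1]M` in a chart. -/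
noncomputable def iotaD : Fn W (Fn.tdeg n (deg n)) →ₗ[ℝ] Fn W (Fn.tdeg n (deg n)) :=
  Fn.contract Fn.d

theorem iotaD_apply (u : Fn W (Fn.tdeg n (deg n))) :
    iotaD u = ∑ a, Fn.inc (Fn.dx a : Fn W (deg n)) * Fn.pdz (Sum.inr (Sum.inl a)) u := by
  have h₁ : ∀ a : Fin n, Fn.d (Fn.sc (Sm.crd a) : Fn W (deg n)) = Fn.dx a := by
    intro a
    rw [Fn.d_sc]
    simp [Sm.pd_crd]
  have h₂ : ∀ i : Empty ⊕ (Fin n ⊕ Empty), Fn.d (Fn.gen i : Fn W (deg n)) = 0 := by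
    rintro (i | a | i)
    · exact i.elim
    · exact Fn.d_dx a
    · exact i.elim
  simp [iotaD, Fn.contract, LinearMap.sum_apply, h₁, h₂]

theorem isHom_inc_dx (a : Fin n) :
    Fn.IsHom 1 (Fn.inc (Fn.dx a : Fn W (deg n)) : Fn W (Fn.tdeg n (deg n))) :=
  (isHom_dx a).inc

/-- As `Q_dR` has degree `1`, the contraction `ι_{Q_dR}` is an even derivation. -/
theorem iotaD_mul (u v : Fn W (Fn.tdeg n (deg n))) :
    iotaD (u * v) = iotaD u * v + u * iotaD v := by
  simp only [iotaD_apply, Finset.sum_mul, Finset.mul_sum, ← Finset.sum_add_distrib]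
  refine Finset.sum_congr rfl fun a _ => ?_
  have h := (isHom_inc_dx a).mul_eq (Fn.act (-1) u)
  rw [pow_one, Fn.act_act, neg_one_mul, neg_neg, Fn.act_one] at h
  rw [Fn.pdz_dx_mul, mul_add, ← mul_assoc, ← mul_assoc, h, mul_assoc u]

theorem iotaD_sc (r : Sm W) : iotaD (Fn.sc r) = 0 := by
  simp [iotaD_apply, Fn.pdz_sc]

theorem iotaD_dx (a : Fin n) : iotaD (Fn.dx a) = Fn.inc (Fn.dx a : Fn W (deg n)) := by
  classical
  simp [iotaD_apply, Fn.pdz_dx]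

theorem iotaD_inc_dx (a : Fin n) : iotaD (Fn.inc (Fn.dx a : Fn W (deg n))) = 0 := by
  rw [Fn.dx, Fn.inc_gen, iotaD_apply]
  simp [Fn.pdz_gen]

/-- The three terms of `ι_{Q_dR} ι_{Q_dR} (dx^a dx^b dx^c)` have the same sum against
skew-symmetric coefficients. -/
theorem iotaD_iotaD_cubic {c : Fin n → Fin n → Fin n → Sm W} (h₁ : ∀ i j k, c j i k = -c i j k)
    (h₂ : ∀ i j k, c i k j = -c i j k) :
    (1 / 2 : ℝ) • iotaD (iotaD ((1 / 6 : ℝ) • ∑ i, ∑ j, ∑ k,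
      Fn.sc (c i j k) * (Fn.dx i * Fn.dx j * Fn.dx k))) =
        ∑ a, Fn.inc (quadratic c a) * Fn.dx a := by
  set X : Fin n → Fn W (Fn.tdeg n (deg n)) := fun a => Fn.inc (Fn.dx a : Fn W (deg n)) with hX
  set D : Fin n → Fn W (Fn.tdeg n (deg n)) := fun a => Fn.dx a with hD
  have hc : ∀ a b, D a * X b = -(X b * D a) := by
    intro a b
    have hD₁ : Fn.IsHom 1 (D a) := Fn.isHom_gen (Sum.inr (Sum.inl a))
    refine (hD₁.comm (isHom_inc_dx b)).trans ?_
    rw [mul_one, pow_one]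
    exact neg_one_smul ℝ _
  have hi : ∀ i j k, iotaD (iotaD (Fn.sc (c i j k) * (D i * D j * D k))) =
      (2 : ℝ) • (Fn.sc (c i j k) * (X i * X j * D k) - Fn.sc (c i j k) * (X i * X k * D j) +
        Fn.sc (c i j k) * (X j * X k * D i)) := by
    intro i j k
    have e₁ : ∀ a, iotaD (D a) = X a := iotaD_dx
    have e₂ : ∀ a, iotaD (X a) = 0 := iotaD_inc_dx
    have e₃ : X i * D j * X k = -(X i * X k * D j) := by
      rw [mul_assoc, hc, mul_neg, mul_assoc]
    have e₄ : D i * X j * X k = X j * X k * D i := by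
      rw [hc, neg_mul, mul_assoc, hc, mul_neg, neg_neg, mul_assoc]
    simp only [iotaD_mul, iotaD_sc, e₁, e₂, map_add, add_mul, mul_add, zero_mul, mul_zero, zero_add,
      add_zero, e₃, e₄, mul_neg]
    module
  have s₁ : ∑ i, ∑ j, ∑ k, Fn.sc (c i j k) * (X i * X j * D k) =
      ∑ i, ∑ j, ∑ k, Fn.sc (c i j k) * (X j * X k * D i) := by
    refine Eq.trans ?_ (sum_rotate fun i j k => Fn.sc (c i j k) * (X j * X k * D i))
    refine Finset.sum_congr rfl fun i _ => Finset.sum_congr rfl fun j _ =>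
      Finset.sum_congr rfl fun k _ => ?_
    rw [h₂ i k j, h₁ k i j, neg_neg]
  have s₂ : ∑ i, ∑ j, ∑ k, Fn.sc (c i j k) * (X i * X k * D j) =
      -∑ i, ∑ j, ∑ k, Fn.sc (c i j k) * (X j * X k * D i) := by
    rw [Finset.sum_comm, ← Finset.sum_neg_distrib]
    refine Finset.sum_congr rfl fun i _ => ?_
    simp only [fun j k => h₁ i j k, map_neg, neg_mul, Finset.sum_neg_distrib]
  have hq : ∀ a, Fn.inc (quadratic c a) * D a =
      (1 / 2 : ℝ) • ∑ j, ∑ k, Fn.sc (c a j k) * (X j * X k * D a) := by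
    intro a
    simp only [quadratic, map_smul, map_sum, map_mul, Fn.inc_sc, smul_mul_assoc, Finset.sum_mul,
      mul_assoc, hX]
  change (1 / 2 : ℝ) • iotaD (iotaD ((1 / 6 : ℝ) • ∑ i, ∑ j, ∑ k,
    Fn.sc (c i j k) * (D i * D j * D k))) = ∑ a, Fn.inc (quadratic c a) * D a
  simp only [hq, map_smul, map_sum, hi, ← Finset.smul_sum, Finset.sum_add_distrib,
    Finset.sum_sub_distrib, s₁, s₂]
  module

end TangentOne

/-! ### The twisted vector field in a chart -/

namespace Courant

open TangentOne

variable {n : ℕ} {W : Opens (Eu n)}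

/-- The Hamiltonian vector field of a function of degree `3` on `T[1]M` is vertical for the
projection `q`. -/
theorem bracket_map (k : Fn W (TangentOne.deg n)) (hk : ∀ a, Fn.IsHom 2 (pdxi a k))
    (u : Fn W (deg n)) :
    bracket (map k) u =
      ∑ a, (map (pdxi a k) * Fn.pdz (iEta a) u - map (Fn.pdx a k) * Fn.pdz (iP a) u) := by
  have h : ∀ a, Fn.act (-1) (map (pdxi a k)) = map (pdxi a k) := fun a => by
    rw [← map_act, hk a]; simp
  simp only [bracket, LinearMap.sum_apply, LinearMap.add_apply, LinearMap.sub_apply,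
    LinearMap.comp_apply, LinearMap.mulLeft_apply, pdz_p_map, pdz_eta_map, ← map_pdx, ← map_pdxi,
    h, map_zero, zero_mul, zero_sub, add_zero]
  exact Finset.sum_congr rfl fun a _ => by abel

/-- The vector field `Q + {q^*k, ·}` for a function `k` on `T[1]M`. -/
noncomputable def twist (k : Fn W (TangentOne.deg n)) : Fn W (deg n) →ₗ[ℝ] Fn W (deg n) :=
  Q + bracket (map k)

/-- The function `k` on `T[1]M` is of degree `3` with derivatives `∂k/∂ξ^a` of degree `2`, and it is
closed under the de Rham vector field. The degree of the derivatives is listed separately because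
homogeneity is tested on all `s : ℝ`, including `s = 0`. -/
structure IsClosedCubic (k : Fn W (TangentOne.deg n)) : Prop where
  isHom : Fn.IsHom 3 k
  isHom_pdxi : ∀ a, Fn.IsHom 2 (pdxi a k)
  d_eq_zero : Fn.d k = 0

namespace IsClosedCubic

variable {k : Fn W (TangentOne.deg n)} (hk : IsClosedCubic k)

include hk

theorem neg : IsClosedCubic (-k) where
  isHom := hk.isHom.neg
  isHom_pdxi a := by rw [map_neg]; exact (hk.isHom_pdxi a).neg
  d_eq_zero := by rw [map_neg, hk.d_eq_zero, neg_zero]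

theorem d_pdxi (a : Fin n) : Fn.d (pdxi a k) = Fn.pdx a k := by
  have h := pdxi_d a k
  rw [hk.d_eq_zero, map_zero] at h
  exact (sub_eq_zero.1 h.symm).symm

theorem bracket_map_map (u : Fn W (TangentOne.deg n)) : bracket (map k) (map u) = 0 := by
  simp [bracket_map k hk.isHom_pdxi, pdz_p_map, pdz_eta_map]

theorem twist_map (u : Fn W (TangentOne.deg n)) : twist k (map u) = map (Fn.d u) := by
  rw [twist, LinearMap.add_apply, hk.bracket_map_map, add_zero, TangentOne.map_d]

theorem twist_sc (r : Sm W) : twist k (Fn.sc r) = ∑ a, xi a * Fn.sc (Sm.pd a r) := by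
  have h := hk.bracket_map_map (Fn.sc r)
  rw [map_sc] at h
  rw [twist, LinearMap.add_apply, h, add_zero, Q_sc]

theorem twist_xi (a : Fin n) : twist k (xi a) = 0 := by
  rw [← map_dx, hk.twist_map, Fn.d_dx, map_zero]

theorem twist_p (a : Fin n) : twist k (p a) = -map (Fn.pdx a k) := by
  classical
  rw [twist, LinearMap.add_apply, Q_p, zero_add, bracket_map k hk.isHom_pdxi]
  simp [p, Fn.pdz_gen, Finset.sum_ite_eq]

theorem twist_eta (a : Fin n) : twist k (eta a) = p a + map (pdxi a k) := by
  classical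
  rw [twist, LinearMap.add_apply, Q_eta, bracket_map k hk.isHom_pdxi]
  simp [eta, Fn.pdz_gen, Finset.sum_ite_eq]

/-- As `k` has odd degree, `{q^*k, ·}` is a derivation of odd degree. -/
theorem bracket_mul (u v : Fn W (deg n)) :
    bracket (map k) (u * v) = bracket (map k) u * v + Fn.act (-1) u * bracket (map k) v := by
  simp only [bracket_map k hk.isHom_pdxi, Finset.sum_mul, Finset.mul_sum,
    ← Finset.sum_add_distrib]
  refine Finset.sum_congr rfl fun a _ => ?_
  have hp : Fn.pdz (iP a) (u * v) = Fn.pdz (iP a) u * v + u * Fn.pdz (iP a) v := by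
    have h := Fn.pdz_mul (iP a) u v
    rwa [show deg n (iP a) = 2 from rfl, neg_one_sq, Fn.act_one] at h
  have he : Fn.pdz (iEta a) (u * v) =
      Fn.pdz (iEta a) u * v + Fn.act (-1) u * Fn.pdz (iEta a) v := by
    have h := Fn.pdz_mul (iEta a) u v
    rwa [show deg n (iEta a) = 1 from rfl, pow_one] at h
  have h₂ : map (pdxi a k) * Fn.act (-1) u = Fn.act (-1) u * map (pdxi a k) := by
    have h := (isHom_map (hk.isHom_pdxi a)).mul_eq (Fn.act (-1) u)
    rwa [neg_one_sq, Fn.act_one] at h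
  have h₃ : map (Fn.pdx a k) * u = Fn.act (-1) u * map (Fn.pdx a k) := by
    have h := (isHom_map (hk.isHom.pdx a)).mul_eq u
    rwa [Odd.neg_one_pow (by decide)] at h
  rw [hp, he, mul_add, mul_add, sub_mul, mul_sub, ← mul_assoc, ← mul_assoc, ← mul_assoc,
    ← mul_assoc, h₂, h₃, mul_assoc (Fn.act (-1) u), mul_assoc (Fn.act (-1) u)]
  abel

theorem twist_mul (u v : Fn W (deg n)) :
    twist k (u * v) = twist k u * v + Fn.act (-1) u * twist k v := by
  simp only [twist, LinearMap.add_apply, Q_mul, hk.bracket_mul, add_mul, mul_add]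
  abel

theorem act_twist (s : ℝ) (u : Fn W (deg n)) :
    Fn.act s (twist k u) = s • twist k (Fn.act s u) := by
  refine Fn.der_ext (F := Fn.act s) (ε := -1) (D := (Fn.act s).toLinearMap.comp (twist k))
    (D' := s • (twist k).comp (Fn.act s).toLinearMap) ?_ ?_ ?_ ?_ u
  · intro u v
    simp [hk.twist_mul]
  · intro u v
    simp only [LinearMap.smul_apply, LinearMap.comp_apply, AlgHom.toLinearMap_apply, map_mul,
      hk.twist_mul, smul_add, Fn.act_act, mul_comm (-1) s]
    rw [smul_mul_assoc, mul_smul_comm]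
  · intro r
    have h := act_Q s (Fn.sc r : Fn W (deg n))
    rw [Fn.act_sc, Q_sc] at h
    simp only [LinearMap.smul_apply, LinearMap.comp_apply, AlgHom.toLinearMap_apply, Fn.act_sc,
      hk.twist_sc, h]
  · rintro (a | a | a)
    · show Fn.act s (twist k (xi a)) = s • twist k (Fn.act s (xi a))
      rw [isHom_xi a s, map_smul, hk.twist_xi, map_zero, smul_zero, smul_zero]
    · show Fn.act s (twist k (p a)) = s • twist k (Fn.act s (p a))
      rw [isHom_p a s, map_smul, hk.twist_p, smul_smul, ← pow_succ',
        (isHom_map (hk.isHom.pdx a)).neg s]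
    · show Fn.act s (twist k (eta a)) = s • twist k (Fn.act s (eta a))
      rw [isHom_eta a s, map_smul, hk.twist_eta, smul_smul, ← pow_succ',
        ((isHom_p a).add (isHom_map (hk.isHom_pdxi a))) s]

/-- On `η_a` and `p_a`, this is the equation `∂k/∂x^a = Q_dR (∂k/∂ξ^a)` for closed `k`. -/
theorem twist_twist (u : Fn W (deg n)) : twist k (twist k u) = 0 := by
  have key : ∀ u : Fn W (deg n), twist k (Fn.act (-1) u) = -Fn.act (-1) (twist k u) := by
    intro u
    rw [hk.act_twist, neg_one_smul, neg_neg]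
  refine Fn.der_ext (F := AlgHom.id ℝ _) (ε := 1) (D := (twist k).comp (twist k)) (D' := 0)
    ?_ ?_ ?_ ?_ u
  · intro u v
    simp only [LinearMap.comp_apply, hk.twist_mul, map_add, key, Fn.act_act, AlgHom.id_apply]
    rw [neg_one_mul, neg_neg, Fn.act_one, neg_mul]
    abel
  · simp
  · intro r
    rw [← map_sc, LinearMap.comp_apply, hk.twist_map, hk.twist_map, Fn.d_d, map_zero,
      LinearMap.zero_apply]
  · rintro (a | a | a)
    · show twist k (twist k (xi a)) = 0
      rw [hk.twist_xi, map_zero]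
    · show twist k (twist k (p a)) = 0
      rw [hk.twist_p, map_neg, hk.twist_map, d_pdx, hk.d_eq_zero, map_zero, map_zero, neg_zero]
    · show twist k (twist k (eta a)) = 0
      rw [hk.twist_eta, map_add, hk.twist_p, hk.twist_map, hk.d_pdxi, neg_add_cancel]

end IsClosedCubic

/-! ### Translation along the fibres in a chart -/

/-- The images of `ξ^a`, `p_a`, `η_a` under `fibreTranslate`. -/
noncomputable def fibreTranslateImg (k : Fn W (TangentOne.deg n)) : Idx n → Fn W (deg n) :=
  Sum.elim (fun a => xi a) (Sum.elim (fun a => p a + map (pdxi a k)) (fun a => eta a))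

theorem isHom_fibreTranslateImg {k : Fn W (TangentOne.deg n)} (hk : IsClosedCubic k) (i : Idx n) :
    Fn.IsHom (deg n i) (fibreTranslateImg k i) := by
  rcases i with a | a | a
  · exact isHom_xi a
  · exact (isHom_p a).add (isHom_map (hk.isHom_pdxi a))
  · exact isHom_eta a

/-- The pull-back of functions along the translation by the 1-form `(∂k/∂ξ^a) dx^a` on `T[1]M`. -/
noncomputable def fibreTranslate {k : Fn W (TangentOne.deg n)} (hk : IsClosedCubic k) :
    Fn W (deg n) →ₐ[ℝ] Fn W (deg n) :=
  Fn.hom Fn.sc Fn.isHom_sc (fibreTranslateImg k) (isHom_fibreTranslateImg hk)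

section

variable {k : Fn W (TangentOne.deg n)} (hk : IsClosedCubic k)

theorem fibreTranslate_sc (r : Sm W) : fibreTranslate hk (Fn.sc r) = Fn.sc r :=
  Fn.hom_sc _ _ _ _ _
theorem fibreTranslate_xi (a : Fin n) : fibreTranslate hk (xi a) = xi a :=
  Fn.hom_gen _ _ _ _ (iXi a)
theorem fibreTranslate_p (a : Fin n) : fibreTranslate hk (p a) = p a + map (pdxi a k) :=
  Fn.hom_gen _ _ _ _ (iP a)
theorem fibreTranslate_eta (a : Fin n) : fibreTranslate hk (eta a) = eta a :=
  Fn.hom_gen _ _ _ _ (iEta a)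
theorem fibreTranslate_act (s : ℝ) (u : Fn W (deg n)) :
    fibreTranslate hk (Fn.act s u) = Fn.act s (fibreTranslate hk u) := Fn.hom_act _ _ _ _ _ _

theorem fibreTranslate_map (u : Fn W (TangentOne.deg n)) : fibreTranslate hk (map u) = map u := by
  refine Fn.algHom_ext (F := (fibreTranslate hk).comp map) (G := map) (fun r => ?_) ?_ u
  · rw [AlgHom.comp_apply, map_sc, fibreTranslate_sc]
  · rintro (i | a | i)
    · exact i.elim
    · exact (congrArg (fibreTranslate hk) (map_dx a)).trans
        ((fibreTranslate_xi hk a).trans (map_dx a).symm)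
    · exact i.elim

theorem fibreTranslate_cancel_neg (u : Fn W (deg n)) :
    fibreTranslate hk (fibreTranslate hk.neg u) = u := by
  refine Fn.algHom_ext (F := (fibreTranslate hk).comp (fibreTranslate hk.neg)) (G := AlgHom.id ℝ _)
    (fun r => ?_) ?_ u
  · simp only [AlgHom.comp_apply, fibreTranslate_sc, AlgHom.id_apply]
  · rintro (a | a | a)
    · show fibreTranslate hk (fibreTranslate hk.neg (xi a)) = xi a
      rw [fibreTranslate_xi, fibreTranslate_xi]
    · show fibreTranslate hk (fibreTranslate hk.neg (p a)) = p a
      rw [fibreTranslate_p, map_add, fibreTranslate_p, fibreTranslate_map, map_neg, map_neg,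
        add_neg_cancel_right]
    · show fibreTranslate hk (fibreTranslate hk.neg (eta a)) = eta a
      rw [fibreTranslate_eta, fibreTranslate_eta]

theorem fibreTranslate_neg_cancel (u : Fn W (deg n)) :
    fibreTranslate hk.neg (fibreTranslate hk u) = u := by
  have h := fibreTranslate_cancel_neg hk.neg u
  simpa only [neg_neg] using h

/-- The translation intertwines `Q` with `Q + {q^*k, ·}`. -/
theorem fibreTranslate_Q (u : Fn W (deg n)) :
    fibreTranslate hk (Q u) = twist k (fibreTranslate hk u) := by
  refine Fn.der_ext (F := fibreTranslate hk) (ε := -1) (D := (fibreTranslate hk).toLinearMap.comp Q)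
    (D' := (twist k).comp (fibreTranslate hk).toLinearMap) ?_ ?_ ?_ ?_ u
  · intro u v
    simp [Q_mul]
  · intro u v
    simp only [LinearMap.comp_apply, AlgHom.toLinearMap_apply, map_mul, hk.twist_mul,
      fibreTranslate_act]
  · intro r
    simp only [LinearMap.comp_apply, AlgHom.toLinearMap_apply, Q_sc, map_sum, map_mul,
      fibreTranslate_sc, fibreTranslate_xi, hk.twist_sc]
  · rintro (a | a | a)
    · show fibreTranslate hk (Q (xi a)) = twist k (fibreTranslate hk (xi a))
      rw [Q_xi, fibreTranslate_xi, hk.twist_xi, map_zero]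
    · show fibreTranslate hk (Q (p a)) = twist k (fibreTranslate hk (p a))
      rw [Q_p, fibreTranslate_p, ← hk.twist_eta, hk.twist_twist, map_zero]
    · show fibreTranslate hk (Q (eta a)) = twist k (fibreTranslate hk (eta a))
      rw [Q_eta, fibreTranslate_eta, hk.twist_eta, fibreTranslate_p]

end

/-! ### Change of coordinates -/

section

universe u

variable {M : Type u} [TopologicalSpace M] [ChartedSpace (Eu n) M] {e e' : Chart n M}

/-- The change of coordinates on functions of `T[1]M`, with a type in which the fibre coordinates
are spelled out. -/
noncomputable def T1trans (h : e ≤ e') :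
    Fn e'.dom (TangentOne.deg n) →ₐ[ℝ] Fn e.dom (TangentOne.deg n) :=
  (T1 n M).trans h

theorem T1trans_sc (h : e ≤ e') (r : Sm e'.dom) :
    T1trans h (Fn.sc r) = Fn.sc (Chart.tr h r) :=
  (T1 n M).trans_sc h r

theorem T1trans_dx (h : e ≤ e') (i : Fin n) :
    T1trans h (Fn.dx i) = ∑ a, Fn.dx a * Fn.sc (Chart.jac h i a) := by
  refine ((baseMan n M).T_trans h (Fn.dx i)).trans ((Fn.tmap_dx _ _ i).trans ?_)
  rw [(baseMan n M).trans_sc, Fn.inc_sc, Fn.d_sc]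
  rfl

theorem T1trans_act (h : e ≤ e') (s : ℝ) (u : Fn e'.dom (TangentOne.deg n)) :
    T1trans h (Fn.act s u) = Fn.act s (T1trans h u) :=
  (T1 n M).trans_act h s u

theorem T1trans_d (h : e ≤ e') (u : Fn e'.dom (TangentOne.deg n)) :
    T1trans h (Fn.d u) = Fn.d (T1trans h u) :=
  (baseMan n M).isHomological_dR.res h u

theorem change_map (h : e ≤ e') (u : Fn e'.dom (TangentOne.deg n)) :
    change h (map u) = map (T1trans h u) :=
  ((qProj n M).pb_res h u).symm

/-- The chain rule for the derivatives along the fibres of `T[1]M`. -/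
theorem pdxi_T1trans (h : e ≤ e') (a : Fin n) (u : Fn e'.dom (TangentOne.deg n)) :
    pdxi a (T1trans h u) = ∑ i, Fn.sc (Chart.jac h i a) * T1trans h (pdxi i u) := by
  classical
  refine Fn.der_ext (F := T1trans h) (ε := -1)
    (D := (pdxi a).comp (T1trans h).toLinearMap)
    (D' := ∑ i, (LinearMap.mulLeft ℝ (Fn.sc (Chart.jac h i a))).comp
      ((T1trans h).toLinearMap.comp (pdxi i))) ?_ ?_ ?_ ?_ u |>.trans (by simp)
  · intro u v
    simp only [LinearMap.comp_apply, AlgHom.toLinearMap_apply, map_mul, Fn.pdz_dx_mul,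
      T1trans_act]
  · intro u v
    simp only [LinearMap.sum_apply, LinearMap.comp_apply, AlgHom.toLinearMap_apply,
      LinearMap.mulLeft_apply, map_mul, map_add, Fn.pdz_dx_mul, Finset.sum_add_distrib,
      Finset.sum_mul, Finset.mul_sum, mul_assoc]
    congr 1
    refine Finset.sum_congr rfl fun i _ => ?_
    rw [← mul_assoc, Fn.sc_mul, mul_assoc]
  · intro r
    simp [T1trans_sc, Fn.pdz_sc]
  · rintro (i | j | i)
    · exact i.elim
    · show pdxi a (T1trans h (Fn.dx j)) = (∑ i, (LinearMap.mulLeft ℝ (Fn.sc (Chart.jac h i a))).comp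
        ((T1trans h).toLinearMap.comp (pdxi i))) (Fn.dx j)
      simp [T1trans_dx, Fn.pdz_dx_mul, Fn.pdz_dx, Fn.pdz_sc, LinearMap.sum_apply, apply_ite]
    · exact i.elim

/-- The derivatives `∂/∂ξ^a` change like the coordinates `η_a`. -/
theorem sum_jacInv_pdxi_T1trans (h : e ≤ e') (i : Fin n) (u : Fn e'.dom (TangentOne.deg n)) :
    ∑ a, Fn.sc (Chart.jacInv h a i) * pdxi a (T1trans h u) = T1trans h (pdxi i u) := by
  have hj : ∀ j, ∑ a, Chart.jac h j a * Chart.jacInv h a i = if j = i then 1 else 0 := by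
    intro j
    have := congrFun (congrFun (Matrix.mul_nonsing_inv (Chart.jac h)
      ((Matrix.isUnit_iff_isUnit_det _).1 (Chart.isUnit_jac h))) j) i
    rw [Matrix.mul_apply, Matrix.one_apply] at this
    exact this
  simp only [pdxi_T1trans, Finset.mul_sum]
  rw [Finset.sum_comm]
  have : ∀ j, ∑ a, Fn.sc (Chart.jacInv h a i) *
      (Fn.sc (Chart.jac h j a) * T1trans h (pdxi j u)) =
        if j = i then T1trans h (pdxi j u) else 0 := by
    intro j
    have e₁ : ∀ a, Fn.sc (Chart.jacInv h a i) *
        (Fn.sc (Chart.jac h j a) * T1trans h (pdxi j u)) =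
        Fn.sc (Chart.jac h j a * Chart.jacInv h a i) * T1trans h (pdxi j u) := fun a => by
      rw [← mul_assoc, ← map_mul, mul_comm]
    rw [Finset.sum_congr rfl fun a _ => e₁ a, ← Finset.sum_mul, ← map_sum, hj]
    split_ifs <;> simp
  rw [Finset.sum_congr rfl fun j _ => this j]
  simp

/-- The twisted vector fields of `k` and of its expression in other coordinates agree. -/
theorem change_twist (h : e ≤ e') {k : Fn e'.dom (TangentOne.deg n)} (hk : IsClosedCubic k)
    (hk' : IsClosedCubic (T1trans h k)) (u : Fn e'.dom (deg n)) :
    change h (twist k u) = twist (T1trans h k) (change h u) := by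
  have heta : ∀ i, change h (twist k (eta i)) = twist (T1trans h k) (change h (eta i)) := by
    intro i
    have hc : change h (eta i) = ∑ a, Fn.sc (Chart.jacInv h a i) * eta a := change_gen h (iEta i)
    have hb : bracket (map (T1trans h k)) (change h (eta i)) = map (T1trans h (pdxi i k)) := by
      rw [hc, map_sum, ← sum_jacInv_pdxi_T1trans, map_sum]
      refine Finset.sum_congr rfl fun a _ => ?_
      have h₀ := hk'.bracket_map_map (Fn.sc (Chart.jacInv h a i))
      have h₁ := hk'.twist_eta a
      rw [twist, LinearMap.add_apply, Q_eta, add_right_inj] at h₁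
      rw [map_sc] at h₀
      rw [hk'.bracket_mul, h₀, h₁, zero_mul, zero_add, Fn.act_sc, map_mul, map_sc]
    rw [hk.twist_eta, map_add, change_map, twist, LinearMap.add_apply, hb, ← change_Q, Q_eta]
  refine Fn.der_ext (F := change h) (ε := -1) (D := (change h).toLinearMap.comp (twist k))
    (D' := (twist (T1trans h k)).comp (change h).toLinearMap) ?_ ?_ ?_ ?_ u
  · intro u v
    simp [hk.twist_mul]
  · intro u v
    simp only [LinearMap.comp_apply, AlgHom.toLinearMap_apply, map_mul, hk'.twist_mul]
    rw [show change h (Fn.act (-1) u) = Fn.act (-1) (change h u) from Fn.hom_act _ _ _ _ _ _]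
  · intro r
    rw [← map_sc]
    simp only [LinearMap.comp_apply, AlgHom.toLinearMap_apply, hk.twist_map, change_map,
      hk'.twist_map, T1trans_d]
  · rintro (a | a | a)
    · show change h (twist k (xi a)) = twist (T1trans h k) (change h (xi a))
      rw [← map_dx, hk.twist_map, change_map, change_map, hk'.twist_map, T1trans_d]
    · -- `p_a = Q_k η_a - ∂k/∂ξ^a` reduces the claim to `η_a` and to functions on `T[1]M`.
      show change h (twist k (p a)) = twist (T1trans h k) (change h (p a))
      have hp : p a = twist k (eta a) - map (pdxi a k) := by
        rw [hk.twist_eta, add_sub_cancel_right]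
      rw [hp, map_sub, map_sub, map_sub, map_sub, hk.twist_twist, heta, hk'.twist_twist,
        hk.twist_map, change_map, change_map, hk'.twist_map, T1trans_d, map_zero]
    · exact heta a

end

end Courant

open Courant TangentOne

universe u

variable {n : ℕ} {M : Type u} [TopologicalSpace M] [ChartedSpace (Eu n) M]

/-! ### Closed 3-forms as functions on `T[1]M` -/

/-- The change of coordinates as a map on `ℝⁿ`. -/
def chgFun (e e' : Chart n M) (y : Eu n) : Eu n := e'.1 (e.1.symm y)

theorem differentiableAt_chgFun {e e' : Chart n M} (h : e ≤ e') {y : Eu n} (hy : y ∈ e.1.target) :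
    DifferentiableAt ℝ (chgFun e e') y := by
  rw [← mdifferentiableAt_iff_differentiableAt]
  exact ((contMDiffAt_of_mem_maximalAtlas e'.2 (h (e.1.map_target hy))).comp y
    (contMDiffAt_symm_of_mem_maximalAtlas e.2 hy)).mdifferentiableAt (by simp)

/-- The components of the differential of a change of coordinates are the entries of the Jacobian
matrix. -/
theorem fderiv_chgFun {e e' : Chart n M} (h : e ≤ e') (y : e.dom) (a : Fin n) :
    fderiv ℝ (chgFun e e') y (EuclideanSpace.single a 1) =
      ∑ i, Chart.jac h i a y • EuclideanSpace.single i (1 : ℝ) := by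
  have hd := differentiableAt_chgFun h y.2
  have hc : ∀ i, fderiv ℝ (chgFun e e') y (EuclideanSpace.single a 1) i = Chart.jac h i a y := by
    intro i
    have h₁ : Chart.jac h i a y =
        fderiv ℝ (fun z => chgFun e e' z i) y (EuclideanSpace.single a 1) :=
      Sm.pd_apply_of a _ _ (fun _ => rfl) y
    have h₂ : fderiv ℝ (fun z => chgFun e e' z i) y = _ :=
      ((EuclideanSpace.proj i : Eu n →L[ℝ] ℝ).hasFDerivAt.comp (y : Eu n) hd.hasFDerivAt).fderiv
    rw [h₁, h₂]
    rfl
  ext j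
  rw [hc]
  simp [Pi.single_apply]

theorem mfderiv_symm_eq {e e' : Chart n M} (h : e ≤ e') {y : Eu n} (hy : y ∈ e.1.target)
    (v : Eu n) :
    (mfderiv (𝓡 n) (𝓡 n) e.1.symm y v : Eu n) =
      (mfderiv (𝓡 n) (𝓡 n) e'.1.symm (chgFun e e' y) (fderiv ℝ (chgFun e e') y v) : Eu n) := by
  have h' : e.1.symm =ᶠ[nhds y] e'.1.symm ∘ chgFun e e' := by
    filter_upwards [e.1.open_target.mem_nhds hy] with z hz
    exact (e'.1.left_inv (h (e.1.map_target hz))).symm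
  have h₁ : MDifferentiableAt (𝓡 n) (𝓡 n) e'.1.symm (chgFun e e' y) :=
    (contMDiffAt_symm_of_mem_maximalAtlas e'.2
      (e'.1.map_source (h (e.1.map_target hy)))).mdifferentiableAt (by simp)
  have h₂ : MDifferentiableAt (𝓡 n) (𝓡 n) (chgFun e e') y :=
    (differentiableAt_chgFun h hy).mdifferentiableAt
  have h₃ := h'.mfderiv_eq (I := 𝓡 n) (I' := 𝓡 n)
  have h₄ := mfderiv_comp y h₁ h₂
  rw [mfderiv_eq_fderiv] at h₄
  exact congrArg (fun L : Eu n →L[ℝ] Eu n => L v) (h₃.trans h₄)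

theorem formLoc_apply {e e' : Chart n M} (h : e ≤ e')
    (κ : ∀ x : M, TangentSpace (𝓡 n) x [⋀^Fin 3]→L[ℝ] ℝ) {y : Eu n} (hy : y ∈ e.1.target)
    (v : Fin 3 → Eu n) :
    formLoc κ e y v = formLoc κ e' (chgFun e e' y) (fun m => fderiv ℝ (chgFun e e') y (v m)) := by
  -- All tangent spaces are the model space; this form of `κ` allows for rewriting the base point.
  let κ' : M → Eu n [⋀^Fin 3]→L[ℝ] ℝ := κ
  have hx : e.1.symm y = e'.1.symm (chgFun e e' y) :=
    (e'.1.left_inv (h (e.1.map_target hy))).symm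
  have hv : (fun m => (mfderiv (𝓡 n) (𝓡 n) e.1.symm y (v m) : Eu n)) = fun m =>
      (mfderiv (𝓡 n) (𝓡 n) e'.1.symm (chgFun e e' y) (fderiv ℝ (chgFun e e') y (v m)) : Eu n) :=
    funext fun m => mfderiv_symm_eq h hy (v m)
  show κ' (e.1.symm y) (fun m => (mfderiv (𝓡 n) (𝓡 n) e.1.symm y (v m) : Eu n)) =
    κ' (e'.1.symm (chgFun e e' y)) _
  exact (congrArg (fun x => κ' x _) hx).trans (congrArg (κ' _) hv)

theorem Sm.sum_apply {W : Opens (Eu n)} {τ : Type*} (s : Finset τ)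
    (F : τ → Sm W) (x : W) : (∑ i ∈ s, F i) x = ∑ i ∈ s, F i x :=
  map_sum (ContMDiffMap.evalRingHom (I := 𝓡 n) (n := ∞) x : Sm W →+* ℝ) F s

theorem sum_comm₃ {A : Type*} [AddCommMonoid A]
    (f : Fin n → Fin n → Fin n → Fin n → Fin n → Fin n → A) :
    ∑ i, ∑ j, ∑ k, ∑ a, ∑ b, ∑ c, f i j k a b c = ∑ a, ∑ b, ∑ c, ∑ i, ∑ j, ∑ k, f i j k a b c := by
  have h := Finset.sum_comm (s := Finset.univ) (t := Finset.univ)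
    (f := fun (q r : Fin n × Fin n × Fin n) => f q.1 q.2.1 q.2.2 r.1 r.2.1 r.2.2)
  simpa only [Fintype.sum_prod_type] using h

namespace ClosedThreeForm

variable (κ : ClosedThreeForm n M)

theorem comp_apply (e : Chart n M) (a b c : Fin n) (y : e.dom) :
    κ.comp e a b c y = formLoc κ.toFun e y ![EuclideanSpace.single a 1,
      EuclideanSpace.single b 1, EuclideanSpace.single c 1] := rfl

theorem comp_swap₁ (e : Chart n M) (a b c : Fin n) : κ.comp e b a c = -κ.comp e a b c := by
  ext y
  show κ.comp e b a c y = -κ.comp e a b c y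
  refine Eq.trans ?_ ((formLoc κ.toFun e y).toAlternatingMap.map_swap ![EuclideanSpace.single a 1,
    EuclideanSpace.single b 1, EuclideanSpace.single c 1] (show (0 : Fin 3) ≠ 1 by decide))
  refine congrArg (formLoc κ.toFun e y) ?_
  ext m : 1
  fin_cases m <;> rfl

theorem comp_swap₂ (e : Chart n M) (a b c : Fin n) : κ.comp e a c b = -κ.comp e a b c := by
  ext y
  show κ.comp e a c b y = -κ.comp e a b c y
  refine Eq.trans ?_ ((formLoc κ.toFun e y).toAlternatingMap.map_swap ![EuclideanSpace.single a 1,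
    EuclideanSpace.single b 1, EuclideanSpace.single c 1] (show (1 : Fin 3) ≠ 2 by decide))
  refine congrArg (formLoc κ.toFun e y) ?_
  ext m : 1
  fin_cases m <;> rfl

theorem pd_comp (e : Chart n M) (l a b c : Fin n) (y : e.dom) :
    Sm.pd l (κ.comp e a b c) y = fderiv ℝ (formLoc κ.toFun e) y (EuclideanSpace.single l 1)
      ![EuclideanSpace.single a 1, EuclideanSpace.single b 1, EuclideanSpace.single c 1] := by
  rw [Sm.pd_apply_of l _ (fun z => formLoc κ.toFun e z ![EuclideanSpace.single a 1,
    EuclideanSpace.single b 1, EuclideanSpace.single c 1]) (fun z => κ.comp_apply e a b c z) y]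
  have hd : DifferentiableAt ℝ (formLoc κ.toFun e) y :=
    ((κ.smooth e).contDiffAt (e.1.open_target.mem_nhds y.2)).differentiableAt (by simp)
  have := ((ContinuousAlternatingMap.apply ℝ (Eu n) ℝ ![EuclideanSpace.single a 1,
    EuclideanSpace.single b 1, EuclideanSpace.single c 1]).hasFDerivAt.comp (y : Eu n)
      hd.hasFDerivAt).fderiv
  exact congrArg (fun L : Eu n →L[ℝ] ℝ => L (EuclideanSpace.single l 1)) this

/-- The equation `dκ = 0` in components. -/
theorem pd_comp_skew (e : Chart n M) (l a b c : Fin n) :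
    Sm.pd l (κ.comp e a b c) - Sm.pd a (κ.comp e l b c) + Sm.pd b (κ.comp e l a c) -
      Sm.pd c (κ.comp e l a b) = 0 := by
  ext y
  show Sm.pd l (κ.comp e a b c) y - Sm.pd a (κ.comp e l b c) y + Sm.pd b (κ.comp e l a c) y -
      Sm.pd c (κ.comp e l a b) y = 0
  have h : ContinuousAlternatingMap.alternatizeUncurryFin (fderiv ℝ (formLoc κ.toFun e) y)
      ![EuclideanSpace.single l 1, EuclideanSpace.single a 1, EuclideanSpace.single b 1,
        EuclideanSpace.single c 1] = 0 :=
    congrArg (fun φ : Eu n [⋀^Fin 4]→L[ℝ] ℝ => φ _) (κ.closed e y y.2)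
  rw [ContinuousAlternatingMap.alternatizeUncurryFin_apply, Fin.sum_univ_four] at h
  rw [pd_comp, pd_comp, pd_comp, pd_comp, ← h]
  have e₀ : ∀ w₀ w₁ w₂ w₃ : Eu n, (0 : Fin 4).removeNth ![w₀, w₁, w₂, w₃] = ![w₁, w₂, w₃] := by
    intros; ext m : 1; fin_cases m <;> rfl
  have e₁ : ∀ w₀ w₁ w₂ w₃ : Eu n, (1 : Fin 4).removeNth ![w₀, w₁, w₂, w₃] = ![w₀, w₂, w₃] := by
    intros; ext m : 1; fin_cases m <;> rfl
  have e₂ : ∀ w₀ w₁ w₂ w₃ : Eu n, (2 : Fin 4).removeNth ![w₀, w₁, w₂, w₃] = ![w₀, w₁, w₃] := by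
    intros; ext m : 1; fin_cases m <;> rfl
  have e₃ : ∀ w₀ w₁ w₂ w₃ : Eu n, (3 : Fin 4).removeNth ![w₀, w₁, w₂, w₃] = ![w₀, w₁, w₂] := by
    intros; ext m : 1; fin_cases m <;> rfl
  rw [e₀, e₁, e₂, e₃]
  simp [pow_succ]
  ring

/-- The components of a 3-form change like a tensor. -/
theorem comp_eq_sum {e e' : Chart n M} (h : e ≤ e') (a b c : Fin n) :
    κ.comp e a b c = ∑ i, ∑ j, ∑ k, Chart.tr h (κ.comp e' i j k) *
      (Chart.jac h i a * Chart.jac h j b * Chart.jac h k c) := by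
  ext y
  simp only [Sm.sum_apply]
  show κ.comp e a b c y = ∑ i, ∑ j, ∑ k, κ.comp e' i j k (Chart.chg h y) *
      (Chart.jac h i a y * Chart.jac h j b y * Chart.jac h k c y)
  simp only [comp_apply]
  rw [formLoc_apply h _ y.2]
  set φ : Eu n [⋀^Fin 3]→L[ℝ] ℝ := formLoc κ.toFun e' (chgFun e e' y) with hφ
  have hv : (fun m => fderiv ℝ (chgFun e e') y ((![EuclideanSpace.single a 1,
      EuclideanSpace.single b 1, EuclideanSpace.single c 1] : Fin 3 → Eu n) m)) =
      fun m => ∑ i, Chart.jac h i (![a, b, c] m) y • EuclideanSpace.single i (1 : ℝ) := by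
    funext m
    fin_cases m <;> exact fderiv_chgFun h y _
  rw [hv]
  have hs := φ.toMultilinearMap.map_sum
    (fun (m : Fin 3) (i : Fin n) => Chart.jac h i (![a, b, c] m) y •
      (EuclideanSpace.single i (1 : ℝ) : Eu n))
  refine hs.trans ?_
  let E : (Fin 3 → Fin n) ≃ Fin n × Fin n × Fin n :=
    { toFun := fun r => (r 0, r 1, r 2)
      invFun := fun q => ![q.1, q.2.1, q.2.2]
      left_inv := fun r => by ext m : 1; fin_cases m <;> rfl
      right_inv := fun q => rfl }
  have hE := E.symm.sum_comp fun r : Fin 3 → Fin n => φ.toMultilinearMap fun m =>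
    Chart.jac h (r m) (![a, b, c] m) y • (EuclideanSpace.single (r m) (1 : ℝ) : Eu n)
  refine hE.symm.trans ?_
  simp only [Fintype.sum_prod_type]
  refine Finset.sum_congr rfl fun i _ => Finset.sum_congr rfl fun j _ =>
    Finset.sum_congr rfl fun k _ => ?_
  rw [φ.toMultilinearMap.map_smul_univ, Fin.prod_univ_three, smul_eq_mul, mul_comm]
  refine congrArg₂ (· * ·) (congrArg φ ?_) rfl
  ext m : 1
  fin_cases m <;> rfl

/-- The function `κ` on `T[1]M` in a chart. It is `ClosedThreeForm.fn`, with a type in which the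
fibre coordinates of `T[1]M` are spelled out. -/
noncomputable def localFn (e : Chart n M) : Fn e.dom (TangentOne.deg n) := cubic (κ.comp e)

theorem pdxi_localFn (e : Chart n M) (a : Fin n) : pdxi a (κ.localFn e) = quadratic (κ.comp e) a :=
  pdxi_cubic (κ.comp_swap₁ e) (κ.comp_swap₂ e) a

theorem isClosedCubic (e : Chart n M) : IsClosedCubic (κ.localFn e) where
  isHom := isHom_cubic _
  isHom_pdxi a := by
    rw [pdxi_localFn]
    exact isHom_quadratic _ a
  d_eq_zero := d_cubic (κ.pd_comp_skew e)

/-- The expressions of a 3-form in two charts are related by the change of coordinates. -/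
theorem T1trans_localFn {e e' : Chart n M} (h : e ≤ e') :
    T1trans h (κ.localFn e') = κ.localFn e := by
  have hl : T1trans h (cubic (κ.comp e')) = (1 / 6 : ℝ) • ∑ i, ∑ j, ∑ k, ∑ a, ∑ b, ∑ c,
      (Fn.sc (Chart.tr h (κ.comp e' i j k) *
        (Chart.jac h i a * Chart.jac h j b * Chart.jac h k c)) *
          (Fn.dx a * Fn.dx b * Fn.dx c) : Fn e.dom (TangentOne.deg n)) := by
    simp only [cubic, map_smul, map_sum, map_mul, T1trans_sc, T1trans_dx]
    congr 1
    refine Finset.sum_congr rfl fun i _ => Finset.sum_congr rfl fun j _ =>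
      Finset.sum_congr rfl fun k _ => ?_
    rw [mul_assoc (∑ a, _), Finset.sum_mul_sum, Finset.sum_mul, Finset.mul_sum]
    refine Finset.sum_congr rfl fun a _ => ?_
    rw [Finset.mul_sum, Finset.mul_sum]
    refine Finset.sum_congr rfl fun b _ => ?_
    rw [Finset.mul_sum, Finset.mul_sum]
    refine Finset.sum_congr rfl fun c _ => ?_
    rw [← Fn.sc_mul _ (Fn.dx a), ← Fn.sc_mul _ (Fn.dx b), ← Fn.sc_mul _ (Fn.dx c)]
    simp only [mul_assoc]
    rw [← mul_assoc (Fn.dx a) (Fn.sc _), ← Fn.sc_mul _ (Fn.dx a),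
      ← mul_assoc (Fn.dx b) (Fn.sc _), ← Fn.sc_mul _ (Fn.dx b)]
    simp only [mul_assoc]
    rw [← mul_assoc (Fn.dx a) (Fn.sc _), ← Fn.sc_mul _ (Fn.dx a)]
    simp only [mul_assoc]
  rw [localFn, localFn, hl, cubic]
  congr 1
  simp only [κ.comp_eq_sum h, map_sum, Finset.sum_mul]
  exact sum_comm₃ _

end ClosedThreeForm

/-! ### Isomorphisms of graded spaces -/

universe v₁ v₂ v₃

/-- The inverses of the pull-backs of a morphism of graded spaces form a morphism. -/
theorem GradedSpace.Hom.exists_isInverse {X : GradedSpace.{u, v₁} n M}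
    {Y : GradedSpace.{u, v₂} n M} (f : Hom X Y)
    (g : ∀ e, X.Fun e →ₐ[ℝ] Y.Fun e) (h₁ : ∀ e a, f.pb e (g e a) = a)
    (h₂ : ∀ e a, g e (f.pb e a) = a) : ∃ f' : Hom Y X, f.IsInverse f' :=
  ⟨{ pb := g
     pb_res := fun {e e'} h a => by rw [← h₂ e (Y.res h _), f.pb_res, h₁]
     pb_act := fun e s a => by rw [← h₂ e (Y.act e s _), f.pb_act, h₁] },
    Hom.ext_apply h₁, Hom.ext_apply h₂⟩

theorem GradedSpace.Hom.IsInverse.isNQ {X : GradedSpace.{u, v₁} n M}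
    {Y : GradedSpace.{u, v₂} n M} {f : Hom X Y} {g : Hom Y X} (h : f.IsInverse g)
    {QX : Op X} {QY : Op Y} (hf : f.IsNQ QX QY) : g.IsNQ QY QX := by
  intro e a
  have h₁ : ∀ a, f.pb e (g.pb e a) = a := fun a =>
    congrArg (fun k : Hom X X => k.pb e a) h.1
  have h₂ : ∀ a, g.pb e (f.pb e a) = a := fun a =>
    congrArg (fun k : Hom Y Y => k.pb e a) h.2
  rw [← h₂ (QY e (g.pb e a)), hf, h₁]

theorem GradedSpace.Hom.IsInverse.trans {X : GradedSpace.{u, v₁} n M}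
    {Y : GradedSpace.{u, v₂} n M} {Z : GradedSpace.{u, v₃} n M} {f : Hom X Y} {f' : Hom Y X}
    {g : Hom Y Z} {g' : Hom Z Y} (hf : f.IsInverse f')
    (hg : g.IsInverse g') : (g.comp f).IsInverse (f'.comp g') := by
  have h₁ : ∀ e a, f.pb e (f'.pb e a) = a := fun e a =>
    congrArg (fun k : Hom X X => k.pb e a) hf.1
  have h₂ : ∀ e a, f'.pb e (f.pb e a) = a := fun e a =>
    congrArg (fun k : Hom Y Y => k.pb e a) hf.2
  have h₃ : ∀ e a, g.pb e (g'.pb e a) = a := fun e a =>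
    congrArg (fun k : Hom Y Y => k.pb e a) hg.1
  have h₄ : ∀ e a, g'.pb e (g.pb e a) = a := fun e a =>
    congrArg (fun k : Hom Z Z => k.pb e a) hg.2
  refine ⟨Hom.ext_apply fun e a => ?_, Hom.ext_apply fun e a => ?_⟩
  · show f.pb e (g.pb e (g'.pb e (f'.pb e a))) = a
    rw [h₃, h₁]
  · show g'.pb e (f'.pb e (f.pb e (g.pb e a))) = a
    rw [h₂, h₄]

/-! ### The twisted Courant algebroid -/

namespace ClosedThreeForm

variable (κ : ClosedThreeForm n M)

theorem twistQ_eq (e : Chart n M) : κ.twistQ e = twist (κ.localFn e) := rfl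

theorem change_twist_localFn {e e' : Chart n M} (h : e ≤ e') (u : Fn e'.dom (Courant.deg n)) :
    change h (twist (κ.localFn e') u) = twist (κ.localFn e) (change h u) := by
  have hk := κ.isClosedCubic e
  have ht := κ.T1trans_localFn h
  have h' := change_twist h (κ.isClosedCubic e') (ht.symm ▸ hk) u
  rwa [ht] at h'

theorem isHomological_twistQ : IsHomological (cotangentTwo n M).space κ.twistQ where
  leibniz e := (κ.isClosedCubic e).twist_mul
  degree e := (κ.isClosedCubic e).act_twist
  square e := (κ.isClosedCubic e).twist_twist
  res h := κ.change_twist_localFn h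

theorem fibreTranslate_coord {e e' : Chart n M} (h : e ≤ e') (i : Idx n) :
    fibreTranslate (κ.isClosedCubic e) (coord h i) =
      change h (fibreTranslateImg (κ.localFn e') i) := by
  have hx : ∀ i, coord h (iXi i) = map (T1trans h (Fn.dx i)) := fun i => by
    rw [← change_map, map_dx]
    exact (change_gen h (iXi i)).symm
  have heta : ∀ i, fibreTranslate (κ.isClosedCubic e) (coord h (iEta i)) = coord h (iEta i) := by
    intro i
    show fibreTranslate _ (∑ a, Fn.sc (Chart.jacInv h a i) * eta a) =
      ∑ a, Fn.sc (Chart.jacInv h a i) * eta a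
    simp only [map_sum, map_mul, fibreTranslate_sc, fibreTranslate_eta]
  rcases i with i | i | i
  · show fibreTranslate _ (coord h (iXi i)) = change h (Fn.gen (iXi i))
    rw [change_gen, hx, fibreTranslate_map]
  · -- `p_i = Q η_i` is mapped to `Q_κ η_i`, and `Q_κ` is compatible with coordinate changes.
    show fibreTranslate _ (coord h (iP i)) = change h (p i + map (pdxi i (κ.localFn e')))
    rw [coord_p, fibreTranslate_Q, heta, ← change_gen, ← (κ.isClosedCubic e').twist_eta,
      κ.change_twist_localFn h]
    rfl
  · show fibreTranslate _ (coord h (iEta i)) = change h (Fn.gen (iEta i))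
    rw [change_gen, heta]

/-- The morphism `ψ_κ`, in coordinates `p_a ↦ p_a + ∂κ/∂ξ^a`. -/
noncomputable def fibreTranslation : Hom (cotangentTwo n M).space (cotangentTwo n M).space :=
  NMan.mkHom (cotangentTwo n M) (cotangentTwo n M) (fun e => fibreTranslateImg (κ.localFn e))
    (fun e => isHom_fibreTranslateImg (κ.isClosedCubic e)) (fun h i => κ.fibreTranslate_coord h i)

theorem fibreTranslation_isNQ : κ.fibreTranslation.IsNQ κ.twistQ (stdQ n M) := fun e u =>
  fibreTranslate_Q (κ.isClosedCubic e) u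

theorem exists_fibreTranslation_isInverse :
    ∃ ψ' : Hom (cotangentTwo n M).space (cotangentTwo n M).space,
      κ.fibreTranslation.IsInverse ψ' ∧ ψ'.IsNQ (stdQ n M) κ.twistQ := by
  obtain ⟨ψ', h⟩ := κ.fibreTranslation.exists_isInverse
    (fun e => fibreTranslate (κ.isClosedCubic e).neg)
    (fun e u => fibreTranslate_cancel_neg (κ.isClosedCubic e) u)
    (fun e u => fibreTranslate_neg_cancel (κ.isClosedCubic e) u)
  exact ⟨ψ', h, h.isNQ κ.fibreTranslation_isNQ⟩

/-- The two conditions on `ψ` determine the images of `x^a` and `η_a`, and then those of their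
differentials `ξ^a` and `p_a`. -/
theorem corresponds_iff (ψ : Hom (cotangentTwo n M).space (cotangentTwo n M).space) :
    Corresponds κ.twistQ (cotangentOne n M) ((legendre n M).comp ψ)
      ((sProj n M).comp (legendre n M)) ↔ ψ = κ.fibreTranslation := by
  constructor
  · rintro ⟨hQ, hs⟩
    refine Hom.ext_apply fun e u => ?_
    have hinc : ∀ v : Fn e.dom (CotangentOne.deg n),
        ψ.pb e (Legendre.map (Fn.inc v)) = Legendre.map (Fn.inc v) := fun v =>
      congrArg (fun f : Hom (cotangentTwo n M).space (cotangentOne n M).space => f.pb e v) hs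
    have hsc : ∀ r : Sm e.dom, ψ.pb e (Fn.sc r : Fn e.dom (Courant.deg n)) =
        (Fn.sc r : Fn e.dom (Courant.deg n)) := fun r => by
      have := hinc (Fn.sc r)
      rwa [Fn.inc_sc, Legendre.map_sc] at this
    have heta : ∀ a, ψ.pb e (eta a : Fn e.dom (Courant.deg n)) =
        (eta a : Fn e.dom (Courant.deg n)) := fun a => by
      have := hinc (Fn.gen a)
      rwa [Fn.inc_gen, Legendre.map_gen] at this
    have hd : ∀ v : Fn e.dom (Courant.deg n), ψ.pb e (Courant.Q v) = κ.twistQ e (ψ.pb e v) := by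
      intro v
      have := hQ e (Legendre.mapInv v)
      change ψ.pb e (Legendre.map (Fn.d (Legendre.mapInv v))) =
        κ.twistQ e (ψ.pb e (Legendre.map (Legendre.mapInv v))) at this
      rwa [Legendre.map_d, Legendre.map_mapInv] at this
    refine Fn.algHom_ext (F := ψ.pb e) (G := κ.fibreTranslation.pb e) (fun r => ?_) ?_ u
    · exact (hsc r).trans (fibreTranslate_sc (κ.isClosedCubic e) r).symm
    · rintro (a | a | a)
      · have h := hd (Fn.sc (Sm.crd a))
        have hx : Q (Fn.sc (Sm.crd a) : Fn e.dom (Courant.deg n)) = xi a := by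
          rw [Q_sc]; simp [Sm.pd_crd]
        rw [hsc, hx, twistQ_eq] at h
        refine (h.trans ?_).trans (fibreTranslate_xi (κ.isClosedCubic e) a).symm
        refine ((κ.isClosedCubic e).twist_sc _).trans ?_
        rw [← Q_sc, hx]
      · have h := hd (eta a)
        rw [heta, Q_eta, twistQ_eq] at h
        refine (h.trans ?_).trans (fibreTranslate_p (κ.isClosedCubic e) a).symm
        exact (κ.isClosedCubic e).twist_eta a
      · exact (heta a).trans (fibreTranslate_eta (κ.isClosedCubic e) a).symm
  · rintro rfl
    refine ⟨fun e u => ?_, Hom.ext_apply fun e u => ?_⟩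
    · exact (congrArg (κ.fibreTranslation.pb e) (legendre_isNQ e u)).trans
        (κ.fibreTranslation_isNQ e _)
    · refine Fn.algHom_ext
        (F := (((sProj n M).comp ((legendre n M).comp κ.fibreTranslation)).pb e))
        (G := (((sProj n M).comp (legendre n M)).pb e)) (fun r => ?_) (fun a => ?_) u
      · show fibreTranslate (κ.isClosedCubic e) (Legendre.map (Fn.inc (Fn.sc r))) =
          Legendre.map (Fn.inc (Fn.sc r))
        rw [Fn.inc_sc, Legendre.map_sc, fibreTranslate_sc]
      · have h : Legendre.map (Fn.inc (Fn.gen a : Fn e.dom (CotangentOne.deg n))) = eta a :=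
          (congrArg Legendre.map (Fn.inc_gen (ι := Fin n) a)).trans
            (Legendre.map_gen (Sum.inl a))
        refine (congrArg (fibreTranslate (κ.isClosedCubic e)) h).trans (Eq.trans ?_ h.symm)
        exact fibreTranslate_eta (κ.isClosedCubic e) a

theorem pullForm_eq (e : Chart n M) : κ.pullForm e = ((1 / 6 : ℝ) • ∑ i, ∑ j, ∑ k,
    Fn.sc (κ.comp e i j k) * (Fn.dx i * Fn.dx j * Fn.dx k) :
      Fn e.dom (Fn.tdeg n (TangentOne.deg n))) := by
  let F : Fn e.dom (TangentOne.deg n) →ₐ[ℝ] Fn e.dom (Fn.tdeg n (TangentOne.deg n)) :=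
    Fn.tmap ((baseMan n M).proj.pb e) ((baseMan n M).proj.pb_act e)
  have hp : ∀ r : Sm e.dom, (baseMan n M).proj.pb e (Fn.sc r : Fn e.dom (baseMan n M).deg) =
      (Fn.sc r : Fn e.dom (TangentOne.deg n)) := fun r =>
    Fn.hom_sc Fn.sc Fn.isHom_sc (fun i : Empty => Fn.gen (Sum.inl i)) (fun i => i.elim) r
  have hs : ∀ r, F (Fn.sc r) = Fn.sc r := fun r =>
    (Fn.tmap_sc _ _ r).trans ((congrArg Fn.inc (hp r)).trans (Fn.inc_sc r))
  have hx : ∀ a, F (Fn.dx a) = Fn.dx a := fun a => by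
    refine (Fn.tmap_dx _ _ a).trans ((congrArg (fun v => Fn.d (Fn.inc v)) (hp _)).trans ?_)
    refine (congrArg Fn.d (Fn.inc_sc _)).trans ((Fn.d_sc _).trans ?_)
    simp [Sm.pd_crd]
    rfl
  show F (cubic (κ.comp e)) = _
  simp only [cubic, map_smul, map_sum, map_mul, hs, hx]

theorem contracted_eq (e : Chart n M) : κ.contracted e =
    (∑ a, Fn.inc (pdxi a (κ.localFn e)) * Fn.dx a : Fn e.dom (Fn.tdeg n (TangentOne.deg n))) := by
  have h := iotaD_iotaD_cubic (κ.comp_swap₁ e) (κ.comp_swap₂ e)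
  rw [← κ.pullForm_eq e] at h
  refine h.trans (Finset.sum_congr rfl fun a _ => ?_)
  rw [κ.pdxi_localFn]

theorem fibreTranslation_isFibreTranslation :
    IsFibreTranslation κ.fibreTranslation κ.contracted := by
  refine ⟨Hom.ext_apply fun e u => fibreTranslate_map (κ.isClosedCubic e) u, fun e =>
    ⟨fun a => pdxi a (κ.localFn e), fun _ => 0, ?_, fun a =>
      ⟨fibreTranslate_p (κ.isClosedCubic e) a, ?_⟩⟩⟩
  · refine (κ.contracted_eq e).trans ?_
    have h₀ : ∑ a, (Fn.inc (0 : Fn e.dom (TangentOne.deg n)) *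
        Fn.dz (Sum.inr (Sum.inl a)) : Fn e.dom (Fn.tdeg n (TangentOne.deg n))) = 0 := by
      simp only [map_zero, zero_mul, Finset.sum_const_zero]
    exact ((congrArg (_ + ·) h₀).trans (add_zero _)).symm
  · refine (fibreTranslate_eta (κ.isClosedCubic e) a).trans ?_
    exact ((congrArg (eta a + ·) (map_zero TangentOne.map)).trans (add_zero _)).symm

end ClosedThreeForm

end GradedGeometry

theorem mainTheorem3 {n : ℕ} {M : Type*} [TopologicalSpace M] [ChartedSpace (Eu n) M]
    [IsManifold (𝓡 n) ∞ M] (κ : ClosedThreeForm n M) :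
    IsHomological (cotangentTwo n M).space κ.twistQ ∧
    (∃ ψ : Hom (cotangentTwo n M).space (cotangentTwo n M).space,
      (∀ ψ' : Hom (cotangentTwo n M).space (cotangentTwo n M).space,
        Corresponds κ.twistQ (cotangentOne n M) ((legendre n M).comp ψ')
          ((sProj n M).comp (legendre n M)) ↔ ψ' = ψ) ∧
      ψ.IsNQ κ.twistQ (stdQ n M) ∧
      IsFibreTranslation ψ κ.contracted ∧
      ∃ ψinv : Hom (cotangentTwo n M).space (cotangentTwo n M).space,
        ψ.IsInverse ψinv ∧ ψinv.IsNQ (stdQ n M) κ.twistQ) ∧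
    (∀ (Y : GradedSpace n M) (QY : Op Y) (bracketY : ∀ e, Y.Fun e → Y.Fun e → Y.Fun e),
      IsExactCourant Y QY bracketY →
        DGIso Y QY (cotangentTwo n M).space (stdQ n M)) := by
  refine ⟨κ.isHomological_twistQ, ⟨κ.fibreTranslation, κ.corresponds_iff, κ.fibreTranslation_isNQ,
    κ.fibreTranslation_isFibreTranslation, κ.exists_fibreTranslation_isInverse⟩, ?_⟩
  rintro Y QY bracketY ⟨κ', f, g, hfg, hf, hg, -⟩
  obtain ⟨ψ, hψ, hψQ⟩ := κ'.exists_fibreTranslation_isInverse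
  -- `f` maps into `Y`, and its inverse `g` is followed by the translation for the form of `Y`.
  refine ⟨κ'.fibreTranslation.comp g, f.comp ψ, GradedSpace.Hom.IsInverse.trans ⟨hfg.2, hfg.1⟩ hψ,
    fun e a => ?_, fun e a => ?_⟩
  · exact (congrArg (g.pb e) (κ'.fibreTranslation_isNQ e a)).trans (hg e _)
  · exact (congrArg (ψ.pb e) (hf e a)).trans (hψQ e _)
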